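/- Let $\mathcal P(\mathbb R^d)$ be the set of strictly positive, twice continuously differentiable probability densities on $\mathbb R^d$ with finite second moment. For $\rho,\sigma\in\mathcal P(\mathbb R^d)$ let $I(\rho|\sigma)=\int|\nabla\log\frac{\rho}{\sigma}|^2\rho\,dx$ and $\mathrm{KL}(\rho|\sigma)=\int\rho\log\frac{\rho}{\sigma}\,dx$, both in $[0,\infty]$. Let $\mathcal H_k$ be the reproducing kernel Hilbert space of a continuous symmetric positive (semi)definite kernel $k$ on $\mathbb R^d$. For a density $\rho$ with $\int k(x,x)\rho(x)\,dx<\infty$ let $\iota_{k,\rho}:\mathcal H_k^d\to L_2^d(\rho)$ be the inclusion and $\iota_{k,\rho}^*$ its adjoint. Then $\iota_{k,\rho}\iota_{k,\rho}^*$ is a compact positive self-adjoint operator on $L_2^d(\rho)$, and its real powers are defined spectrally. Fix a target $\pi\in\mathcal P(\mathbb R^d)$. For $\nu\in(0,1]$, a solution $(\rho_t)_{t\ge0}$ of the regularized Stein variational gradient flow (R-SVGF) is a solution of $$\partial_t\rho_t=\nabla\cdot\Big(\rho_t\,\iota_{k,\rho_t}\big((1-\nu)\iota_{k,\rho_t}^*\iota_{k,\rho_t}+\nu\,\mathrm{Id}\big)^{-1}\iota_{k,\rho_t}^*\nabla\log\tfrac{\rho_t}{\pi}\Big),\qquad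 t>0,$$ with $\int k(x,x)\rho_t(x)\,dx<\infty$ and $\nabla\log\frac{\rho_t}{\pi}\in L_2^d(\rho_t)$ for $t>0$. A solution $(\mu_t)_{t\ge0}$ of the Wasserstein gradient flow (WGF) is a solution of $\partial_t\mu_t=\nabla\cdot(\mu_t\nabla\log\frac{\mu_t}{\pi})$, $t>0$. Here a solution of $\partial_t\rho_t=\nabla\cdot(\rho_tv_t)$ is a family in $\mathcal P(\mathbb R^d)$, jointly continuous on $[0,\infty)\times\mathbb R^d$, whose time derivative exists and is jointly continuous on $(0,\infty)\times\mathbb R^d$, such that the equation holds at every time $t>0$ with the divergence in the sense of distributions. For $\gamma\in(0,\frac12]$ let $\mathfrak I(\rho,\gamma)=(\iota_{k,\rho}\iota_{k,\rho}^*)^{-\gamma}\nabla\log\frac{\rho}{\pi}$ be the (least-norm) pre-image of $\nabla\log\frac\rho\pi$ under $(\iota_{k,\rho}\iota_{k,\rho}^*)^{\gamma}$, with $\|\mathfrak I(\rho,\gamma)\|_{L_2^d(\rho)}=\infty$ if there is none. For an R-SVGF $(\rho_t)$ let $\lambda_{1,t}$ be the largest eigenvalue of $\iota_{k,\rho_t}\iota_{k,\rho_t}^*$.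 **Theorem.** Let $(\mu_t)$ be a solution of the WGF. (a) Let $\nu\in(0,1]$, let $(\rho_t)$ be a solution of the R-SVGF, and suppose that for every $t>0$ there is $\gamma_t\in(0,\frac12]$ with $\|\mathfrak I(\rho_t,\gamma_t)\|_{L_2^d(\rho_t)}<\infty$. Then for every $T\in(0,\infty)$, $$\int_0^TI(\rho_t|\mu_t)\,dt\le\frac43\mathrm{KL}(\rho_0|\mu_0)+\frac43\,\mathcal E,\qquad \mathcal E:=\int_0^T(\lambda_{1,t}\vee1)^2\,\nu^{2\gamma_t}(1-\nu)^{-2\gamma_t}\|\mathfrak I(\rho_t,\gamma_t)\|_{L_2^d(\rho_t)}^2\,dt,$$ where both sides take values in $[0,\infty]$, and where for $\nu=1$ one sets $(1-\nu)^{-2\gamma_t}=\infty$ and $\infty\cdot0=0$. (b) Consequently the R-SVGF approximates the WGF in averaged Fisher information: for every family (for instance with $\nu\to0$) of parameters $\nu\in(0,1]$, horizons $T>0$ and solutions of the corresponding R-SVGF started at $\rho_0=\mu_0$, with exponents $\gamma_t$ as in (a), if $T^{-1}\mathcal E\to0$ along the family, then $T^{-1}\int_0^TI(\rho_t|\mu_t)\,dt\to0$.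 -/

import Mathlib

open MeasureTheory Set Filter Topology
open scoped ENNReal InnerProductSpace

noncomputable section

namespace RSVGF

/-- The Euclidean space `ℝ^d`. -/
abbrev E (d : ℕ) : Type := EuclideanSpace ℝ (Fin d)

/-! ### Densities, divergence and Fisher information -/

/-- The class `𝒫(ℝ^d)`: twice continuously differentiable, everywhere positive probability
densities with respect to Lebesgue measure, with finite second moment. -/
structure IsDensity {d : ℕ} (ρ : E d → ℝ) : Prop where
  contDiff : ContDiff ℝ 2 ρ
  pos : ∀ x, 0 < ρ x
  integrable : Integrable ρ
  integral_eq_one : ∫ x, ρ x = 1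
  second_moment : Integrable fun x => ‖x‖ ^ 2 * ρ x

/-- The measure `ρ(x) dx`. -/
def densityMeasure {d : ℕ} (ρ : E d → ℝ) : Measure (E d) :=
  volume.withDensity fun x => ENNReal.ofReal (ρ x)

/-- The vector field `∇ log (ρ / σ)`. -/
def gradLogRatio {d : ℕ} (ρ σ : E d → ℝ) : E d → E d :=
  gradient fun x => Real.log (ρ x / σ x)

/-- Relative Fisher information `I(ρ|σ) = ∫ |∇ log (ρ / σ)|² ρ dx`, with values in `[0, ∞]`. -/
def fisherInfo {d : ℕ} (ρ σ : E d → ℝ) : ℝ≥0∞ :=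
  ∫⁻ x, ‖gradLogRatio ρ σ x‖ₑ ^ 2 ∂densityMeasure ρ

/-- Relative entropy `KL(ρ|σ) = ∫ log (ρ / σ) ρ dx`, with values in `[0, ∞]`. -/
def klDensity {d : ℕ} (ρ σ : E d → ℝ) : ℝ≥0∞ :=
  InformationTheory.klDiv (densityMeasure ρ) (densityMeasure σ)

/-- The Hilbert space `L₂^d(ρ)` of vector fields that are square integrable for `ρ(x) dx`. -/
abbrev L2 {d : ℕ} (ρ : E d → ℝ) : Type := Lp (E d) 2 (densityMeasure ρ)

open Classical in
/-- `∇ log (ρ / σ)` as an element of `L₂^d(ρ)` (it is only used when the Fisher information is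
finite; otherwise the value is `0`). -/
def score {d : ℕ} (ρ σ : E d → ℝ) : L2 ρ :=
  if h : MemLp (gradLogRatio ρ σ) 2 (densityMeasure ρ) then h.toLp else 0

/-! ### The reproducing kernel Hilbert space and its operators -/

section Kernel

variable {d : ℕ} (H : Type*) [NormedAddCommGroup H] [InnerProductSpace ℝ H] [CompleteSpace H]
  [RKHS ℝ H (E d) ℝ]

/-- The reproducing kernel `k(x, y)` of the space `H` of real functions on `ℝ^d`. -/
def reproKernel (x y : E d) : ℝ := RKHS.kernel H x y 1

/-- The space `H^d` of vector fields with components in `H`, with `‖f‖² = ∑ i, ‖f i‖²`. -/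
abbrev VecRKHS (d : ℕ) (H : Type*) [NormedAddCommGroup H] : Type _ := PiLp 2 fun _ : Fin d => H

/-- The vector field on `ℝ^d` given by an element of `H^d`. -/
def VecRKHS.toFun {d : ℕ} {H : Type*} [NormedAddCommGroup H] [InnerProductSpace ℝ H]
    [RKHS ℝ H (E d) ℝ] (f : VecRKHS d H) (x : E d) : E d :=
  WithLp.toLp 2 fun i => f i x

variable {H} in
theorem abs_apply_sq_le (f : H) (x : E d) : f x ^ 2 ≤ ‖f‖ ^ 2 * reproKernel H x x := by
  have h1 := RKHS.norm_apply_le f x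
  have h2 : ‖RKHS.kernel H x x‖ = reproKernel H x x := by
    have h3 : 0 ≤ reproKernel H x x := by
      have := RKHS.kernel_inner H x x (1 : ℝ) (1 : ℝ)
      rw [real_inner_self_eq_norm_sq] at this
      have e : reproKernel H x x = ‖RKHS.kerFun H x 1‖ ^ 2 := by
        rw [← this]; simp [reproKernel]
      rw [e]; positivity
    have h4 : RKHS.kernel H x x = (reproKernel H x x) • ContinuousLinearMap.id ℝ ℝ := by
      ext; simp [reproKernel]
    rw [h4, norm_smul, ContinuousLinearMap.norm_id, mul_one, Real.norm_of_nonneg h3]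
  rw [h2] at h1
  have h5 : 0 ≤ reproKernel H x x := h2 ▸ norm_nonneg _
  calc f x ^ 2 = ‖f x‖ ^ 2 := by simp
    _ ≤ (‖f‖ * √(reproKernel H x x)) ^ 2 := by gcongr
    _ = _ := by rw [mul_pow, Real.sq_sqrt h5]

theorem continuous_of_continuous_inner {X F : Type*} [TopologicalSpace X] [NormedAddCommGroup F]
    [InnerProductSpace ℝ F] (K : X → F) (h : Continuous fun p : X × X => ⟪K p.1, K p.2⟫_ℝ) :
    Continuous K := by
  rw [continuous_iff_continuousAt]
  intro x
  rw [ContinuousAt, tendsto_iff_norm_sub_tendsto_zero]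
  have hs : ∀ y, ‖K y - K x‖ = √(⟪K y, K y⟫_ℝ - 2 * ⟪K y, K x⟫_ℝ + ⟪K x, K x⟫_ℝ) := by
    intro y
    rw [← Real.sqrt_sq (norm_nonneg (K y - K x)), norm_sub_sq_real, real_inner_self_eq_norm_sq,
      real_inner_self_eq_norm_sq]
  have h1 : Continuous fun y => ⟪K y, K y⟫_ℝ := h.comp (continuous_id.prodMk continuous_id)
  have h2 : Continuous fun y => ⟪K y, K x⟫_ℝ := h.comp (continuous_id.prodMk continuous_const)
  have hc : Continuous fun y => √(⟪K y, K y⟫_ℝ - 2 * ⟪K y, K x⟫_ℝ + ⟪K x, K x⟫_ℝ) :=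
    ((h1.sub (h2.const_mul 2)).add continuous_const).sqrt
  have h3 := hc.tendsto x
  have h0 : ⟪K x, K x⟫_ℝ - 2 * ⟪K x, K x⟫_ℝ + ⟪K x, K x⟫_ℝ = 0 := by ring
  rw [h0, Real.sqrt_zero] at h3
  simpa only [hs] using h3

variable {H} in
theorem continuous_coe (hk : Continuous fun p : E d × E d => reproKernel H p.1 p.2) (f : H) :
    Continuous fun x : E d => f x := by
  have hin : ∀ x y : E d, ⟪RKHS.kerFun H x (1 : ℝ), RKHS.kerFun H y (1 : ℝ)⟫_ℝ =
      reproKernel H y x := by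
    intro x y
    rw [← RKHS.kernel_inner]
    simp [reproKernel]
  have h2 : Continuous fun p : E d × E d =>
      ⟪RKHS.kerFun H p.1 (1 : ℝ), RKHS.kerFun H p.2 (1 : ℝ)⟫_ℝ :=
    (hk.comp (continuous_snd.prodMk continuous_fst)).congr fun p => (hin p.1 p.2).symm
  have hK : Continuous fun x : E d => RKHS.kerFun H x (1 : ℝ) :=
    continuous_of_continuous_inner _ h2
  have h1 : ∀ x : E d, ⟪f, RKHS.kerFun H x (1 : ℝ)⟫_ℝ = f x := by
    intro x
    rw [RKHS.inner_kerFun]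
    simp
  exact ((continuous_const (y := f)).inner (𝕜 := ℝ) hK).congr h1

variable {H} in
theorem memLp_toFun (hk : Continuous fun p : E d × E d => reproKernel H p.1 p.2) {ρ : E d → ℝ}
    (hint : Integrable (fun x => reproKernel H x x) (densityMeasure ρ)) (f : VecRKHS d H) :
    MemLp f.toFun 2 (densityMeasure ρ) := by
  have hc : Continuous f.toFun := by
    have : Continuous fun x : E d => fun i => f i x :=
      continuous_pi fun i => continuous_coe hk (f i)
    exact (PiLp.continuous_toLp 2 _).comp this
  rw [memLp_two_iff_integrable_sq_norm hc.aestronglyMeasurable]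
  refine Integrable.mono' (hint.const_mul (‖f‖ ^ 2))
    (hc.norm.pow 2).aestronglyMeasurable (Eventually.of_forall fun x => ?_)
  rw [Real.norm_of_nonneg (by positivity), EuclideanSpace.norm_sq_eq, PiLp.norm_sq_eq_of_L2,
    Finset.sum_mul]
  refine Finset.sum_le_sum fun i _ => ?_
  simpa [VecRKHS.toFun] using abs_apply_sq_le (f i) x

variable {H} in
theorem exists_inclusion (hk : Continuous fun p : E d × E d => reproKernel H p.1 p.2)
    {ρ : E d → ℝ} (hint : Integrable (fun x => reproKernel H x x) (densityMeasure ρ)) :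
    ∃ L : VecRKHS d H →L[ℝ] L2 ρ, ∀ f, L f =ᵐ[densityMeasure ρ] f.toFun := by
  let A : VecRKHS d H →ₗ[ℝ] L2 ρ :=
    { toFun := fun f => (memLp_toFun hk hint f).toLp
      map_add' := by
        intro f g
        rw [← MemLp.toLp_add]
        congr 1
        ext x i
        simp [VecRKHS.toFun]
      map_smul' := by
        intro c f
        rw [RingHom.id_apply, ← MemLp.toLp_const_smul]
        congr 1
        ext x i
        simp [VecRKHS.toFun] }
  refine ⟨A.mkContinuous √(∫ x, reproKernel H x x ∂densityMeasure ρ) fun f => ?_, fun f => ?_⟩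
  · have h0 : 0 ≤ ∫ x, reproKernel H x x ∂densityMeasure ρ := by
      refine integral_nonneg fun x => ?_
      have e : reproKernel H x x = ‖RKHS.kerFun H x (1 : ℝ)‖ ^ 2 := by
        rw [← real_inner_self_eq_norm_sq, ← RKHS.kernel_inner]; simp [reproKernel]
      simp only [Pi.zero_apply, e]; positivity
    refine (sq_le_sq₀ (norm_nonneg _) (by positivity)).1 ?_
    rw [mul_pow, Real.sq_sqrt h0, ← real_inner_self_eq_norm_sq, L2.inner_def, mul_comm,
      ← integral_const_mul]
    have hA : (A f : E d → E d) =ᵐ[densityMeasure ρ] f.toFun := (memLp_toFun hk hint f).coeFn_toLp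
    refine integral_mono_ae (L2.integrable_inner _ _) (hint.const_mul _) ?_
    filter_upwards [hA] with x hx
    simp only [hx]
    rw [real_inner_self_eq_norm_sq, EuclideanSpace.norm_sq_eq, PiLp.norm_sq_eq_of_L2,
      Finset.sum_mul]
    refine Finset.sum_le_sum fun i _ => ?_
    simpa [VecRKHS.toFun] using abs_apply_sq_le (f i) x
  · exact (memLp_toFun hk hint f).coeFn_toLp

open Classical in
/-- The inclusion operator `ι_{k,ρ} : H^d → L₂^d(ρ)`. It exists as soon as `k` is continuous and
`∫ k(x,x) ρ(x) dx < ∞` (see `exists_inclusion`). -/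
def inclusion (ρ : E d → ℝ) : VecRKHS d H →L[ℝ] L2 ρ :=
  if h : ∃ L : VecRKHS d H →L[ℝ] L2 ρ, ∀ f, L f =ᵐ[densityMeasure ρ] f.toFun then h.choose else 0

variable {H} in
theorem inclusion_coeFn (hk : Continuous fun p : E d × E d => reproKernel H p.1 p.2)
    {ρ : E d → ℝ} (hint : Integrable (fun x => reproKernel H x x) (densityMeasure ρ))
    (f : VecRKHS d H) : inclusion H ρ f =ᵐ[densityMeasure ρ] f.toFun := by
  have h := exists_inclusion hk hint
  rw [inclusion, dif_pos h]
  exact h.choose_spec f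

/-- The adjoint `ι_{k,ρ}^* : L₂^d(ρ) → H^d`. -/
def inclusionAdj (ρ : E d → ℝ) : L2 ρ →L[ℝ] VecRKHS d H := (inclusion H ρ).adjoint

/-- The integral operator `ι_{k,ρ} ι_{k,ρ}^*` on `L₂^d(ρ)`. -/
def integralOp (ρ : E d → ℝ) : L2 ρ →L[ℝ] L2 ρ := inclusion H ρ ∘L inclusionAdj H ρ

/-- The velocity `ι ((1 - ν) ι^* ι + ν I)⁻¹ ι^* u` for `u ∈ L₂^d(ρ)`, where `ι = ι_{k,ρ}`. The
operator `(1 - ν) ι^* ι + ν I` on `H^d` is invertible for `0 < ν ≤ 1`. -/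
def velocity (ν : ℝ) (ρ : E d → ℝ) (u : L2 ρ) : L2 ρ :=
  inclusion H ρ
    (Ring.inverse ((1 - ν) • (inclusionAdj H ρ ∘L inclusion H ρ) +
      ν • ContinuousLinearMap.id ℝ (VecRKHS d H)) (inclusionAdj H ρ u))

/-- The largest eigenvalue `λ₁` of `ι_{k,ρ} ι_{k,ρ}^*`. -/
def topEigenvalue (ρ : E d → ℝ) : ℝ :=
  sSup {c : ℝ | Module.End.HasEigenvalue (integralOp H ρ : L2 ρ →ₗ[ℝ] L2 ρ) c}

end Kernel

/-- `A ^ γ h = u` for a compact positive self-adjoint operator `A` and `γ > 0`, through the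
spectral representation: `A ^ γ` acts as multiplication by `c ^ γ` on the eigenspace of `A` for the
eigenvalue `c`. As the eigenvectors of `A` span a dense subspace, this determines `u` from `h`. -/
def IsPowApply {F : Type*} [NormedAddCommGroup F] [InnerProductSpace ℝ F]
    (A : F →L[ℝ] F) (γ : ℝ) (h u : F) : Prop :=
  ∀ (c : ℝ) (e : F), A e = c • e → ⟪e, u⟫_ℝ = c ^ γ * ⟪e, h⟫_ℝ

/-- The norm in `L₂^d(ρ)` of the pre-image `(ι_{k,ρ} ι_{k,ρ}^*)^{-γ} ∇ log (ρ / σ)`, with values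
in `[0, ∞]`: it is finite if and only if `∇ log (ρ / σ)` lies in the range of
`(ι_{k,ρ} ι_{k,ρ}^*)^γ`. If the operator is not injective, the pre-image of least norm, i.e. the
one orthogonal to the kernel, is meant. -/
def preimageNorm {d : ℕ} (H : Type*) [NormedAddCommGroup H] [InnerProductSpace ℝ H]
    [CompleteSpace H] [RKHS ℝ H (E d) ℝ] (ρ σ : E d → ℝ) (γ : ℝ) : ℝ≥0∞ :=
  ⨅ (h : L2 ρ) (_ : IsPowApply (integralOp H ρ) γ h (score ρ σ)), ‖h‖ₑ

/-! ### The two flows -/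

/-- `ρ_t ∈ 𝒫(ℝ^d)`, `t ≥ 0`, solves `∂_t ρ_t = ∇ · (ρ_t v_t)` for `t > 0` with initial value `ρ_0`:
`ρ` is continuous up to time `0`, its time derivative exists and is continuous for `t > 0`, and the
equation holds at each time `t > 0`, with the divergence in the sense of distributions (as
`∂_t ρ_t` is continuous and `ρ_t v_t` locally integrable, test functions of class `C^1_c` and of
class `C^∞_c` give the same condition). -/
structure SolvesContinuityEq {d : ℕ} (ρ : ℝ → E d → ℝ) (v : ℝ → E d → E d) : Prop where
  isDensity : ∀ t, 0 ≤ t → IsDensity (ρ t)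
  continuousOn : ContinuousOn (fun p : ℝ × E d => ρ p.1 p.2) (Ici 0 ×ˢ univ)
  differentiableAt : ∀ t, 0 < t → ∀ x, DifferentiableAt ℝ (fun s => ρ s x) t
  continuousOn_deriv :
    ContinuousOn (fun p : ℝ × E d => deriv (fun s => ρ s p.2) p.1) (Ioi 0 ×ˢ univ)
  equation : ∀ t, 0 < t → ∀ φ : E d → ℝ, ContDiff ℝ 1 φ → HasCompactSupport φ →
    ∫ x, φ x * deriv (fun s => ρ s x) t = -∫ x, ⟪gradient φ x, v t x⟫_ℝ ∂densityMeasure (ρ t)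

/-- `(μ_t)` solves the Wasserstein gradient flow (Fokker–Planck equation)
`∂_t μ = ∇ · (μ ∇ log (μ / π))`. -/
def IsWGF {d : ℕ} (π : E d → ℝ) (μ : ℝ → E d → ℝ) : Prop :=
  SolvesContinuityEq μ fun t => gradLogRatio (μ t) π

/-- `(ρ_t)` solves the regularized Stein variational gradient flow
`∂_t ρ_t = ∇ · (ρ_t ι_t ((1 - ν) ι_t^* ι_t + ν I)⁻¹ ι_t^* ∇ log (ρ_t / π))`, `ι_t = ι_{k,ρ_t}`.
The first two fields say that the objects in the equation are defined: `ι_t` maps `H^d` to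
`L₂^d(ρ_t)`, and `∇ log (ρ_t / π) ∈ L₂^d(ρ_t)`. -/
structure IsRSVGF {d : ℕ} (H : Type*) [NormedAddCommGroup H] [InnerProductSpace ℝ H]
    [CompleteSpace H] [RKHS ℝ H (E d) ℝ] (ν : ℝ) (π : E d → ℝ) (ρ : ℝ → E d → ℝ) : Prop where
  kernel_integrable : ∀ t, 0 < t →
    Integrable (fun x => reproKernel H x x) (densityMeasure (ρ t))
  score_memLp : ∀ t, 0 < t → MemLp (gradLogRatio (ρ t) π) 2 (densityMeasure (ρ t))
  solves : SolvesContinuityEq ρ fun t => velocity H ν (ρ t) (score (ρ t) π)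

/-- The condition on the exponents: `γ_t ∈ (0, 1/2]` and the pre-image of `∇ log (ρ_t / π)` under
`(ι_{k,ρ_t} ι_{k,ρ_t}^*)^{γ_t}` has finite norm, for all `t > 0`. -/
def AdmissibleExponents {d : ℕ} (H : Type*) [NormedAddCommGroup H] [InnerProductSpace ℝ H]
    [CompleteSpace H] [RKHS ℝ H (E d) ℝ] (π : E d → ℝ) (ρ : ℝ → E d → ℝ) (γ : ℝ → ℝ) : Prop :=
  ∀ t, 0 < t → 0 < γ t ∧ γ t ≤ 1 / 2 ∧ preimageNorm H (ρ t) π (γ t) < ∞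

/-- `∫₀ᵀ (λ_{1,t} ∨ 1)² ν^{2γ_t} (1-ν)^{-2γ_t} ‖𝔍(ρ_t, γ_t)‖² dt`, with values in `[0, ∞]`
(for `ν = 1` the power `(1-ν)^{-2γ_t}` is `∞`). -/
def errorIntegral {d : ℕ} (H : Type*) [NormedAddCommGroup H] [InnerProductSpace ℝ H]
    [CompleteSpace H] [RKHS ℝ H (E d) ℝ] (ν : ℝ) (π : E d → ℝ) (ρ : ℝ → E d → ℝ) (γ : ℝ → ℝ)
    (T : ℝ) : ℝ≥0∞ :=
  ∫⁻ t in Ioc 0 T, ENNReal.ofReal (max (topEigenvalue H (ρ t)) 1) ^ 2 *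
    ENNReal.ofReal ν ^ (2 * γ t) * ENNReal.ofReal (1 - ν) ^ (-(2 * γ t)) *
    preimageNorm H (ρ t) π (γ t) ^ 2

end RSVGF

end

/-!
The Fisher information along the two flows is the dissipation of their relative entropy, and the
regularization enters only through the `L²` distance between the two velocities.

*Reduction.* Relative to the probability measure `m = π dx`, the Wasserstein gradient flow is the
reversible diffusion `∂_t f = m⁻¹ ∇ · (m ∇ f)` for `f = μ / π`, and the regularized flow is the
perturbation `∂_t g = m⁻¹ ∇ · (m (∇ g + g w))` for `g = ρ / π`, where `w` is the difference between
the regularized velocity and `∇ log (ρ / π)` (`IsWGF.isPerturbedFlow`, `IsRSVGF.isPerturbedFlow`).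
Formally,
`d/dt KL(ρ|μ) = - I(ρ|μ) - ∫ ⟪w, ∇ log (g / f)⟫ dρ ≤ - 3/4 I(ρ|μ) + ‖w‖²`,
which integrates to the claim with the constant `4/3`, once `∫ ‖w‖² dt` is bounded by the error
integral.

*The error.* The inclusion `ι` is a limit of finite rank operators, as the feature map
`x ↦ k(x, ·)` is a limit of simple functions in `L²(ρ)`, so `ι ι^*` is compact and its eigenvectors
span a dense subspace. On an eigenvector with eigenvalue `c`, the difference of the velocities acts
on the pre-image as the multiplier `ν (c - 1) / ((1 - ν) c + ν) · c ^ γ`, and the weighted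
arithmetic-geometric mean inequality bounds it by `(λ₁ ∨ 1) ν ^ γ (1 - ν) ^ (-γ)`
(`ofReal_norm_velocity_sub_sq_le`).

*The entropy inequality.* Neither decay at infinity nor integrability of `∇ log (μ / π)` nor
finiteness of the entropy at positive times is assumed, so the formal computation is carried out
with truncations on the logarithmic scale. A density `g` is replaced by `cutSize η g`, whose slope
`cutSlope η` varies so slowly that its dissipation tends to `0` with `η`; this is where the
conservation of mass is used (`IsPerturbedFlow.lintegral_dissipation_cutSlope_le`). The entropy
density `r log r - r + 1` is replaced by one whose derivative and Legendre transform, at `r = exp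
y`, are the bounded functions `truncId ε y` and `truncExp ε y`. Spatial cutoffs with gradient at
most `c` cost a multiple of `c`, because the energies `∫∫ |∇ log (1 + g)|² dm dt` and `∫∫ |∇ log
(1 + f)|² dm dt` are bounded a priori (`IsPerturbedFlow.lintegral_logEnergy_le`). This gives the
truncated inequality (`integral_cutFisher_le`); letting `c`, then `η`, then `ε` tend to `0`,
Fatou's lemma removes the truncations (`lintegral_fisher_le`).

The second assertion follows from the first one, as the relative entropy vanishes at time `0`.
-/

noncomputable section

namespace RSVGF

/-! ### Compactness of the inclusion -/

theorem isProbabilityMeasure_densityMeasure {d : ℕ} {ρ : E d → ℝ} (hρ : IsDensity ρ) :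
    IsProbabilityMeasure (densityMeasure ρ) := by
  constructor
  rw [densityMeasure, withDensity_apply _ MeasurableSet.univ, Measure.restrict_univ,
    ← ofReal_integral_eq_lintegral_ofReal hρ.integrable
      (Eventually.of_forall fun x => (hρ.pos x).le),
    hρ.integral_eq_one, ENNReal.ofReal_one]

section Compact

variable {d : ℕ} {H : Type*} [NormedAddCommGroup H] [InnerProductSpace ℝ H]

/-- The vector field with components `⟪f i, κ x⟫`, for `f ∈ H^d` and a feature map `κ` into `H`. -/
def featureField (κ : E d → H) (f : VecRKHS d H) (x : E d) : E d :=
  WithLp.toLp 2 fun i => ⟪f i, κ x⟫_ℝ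

theorem norm_featureField_le (κ : E d → H) (f : VecRKHS d H) (x : E d) :
    ‖featureField κ f x‖ ≤ ‖f‖ * ‖κ x‖ := by
  refine (sq_le_sq₀ (norm_nonneg _) (by positivity)).1 ?_
  rw [EuclideanSpace.norm_sq_eq, mul_pow, PiLp.norm_sq_eq_of_L2, Finset.sum_mul]
  refine Finset.sum_le_sum fun i _ => ?_
  rw [← mul_pow]
  exact pow_le_pow_left₀ (norm_nonneg _) (norm_inner_le_norm _ _) 2

theorem aestronglyMeasurable_featureField {m : Measure (E d)} {κ : E d → H}
    (hκ : AEStronglyMeasurable κ m) (f : VecRKHS d H) :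
    AEStronglyMeasurable (featureField κ f) m := by
  have hc : Continuous fun v : H => (WithLp.toLp 2 fun i => ⟪f i, v⟫_ℝ : E d) :=
    (PiLp.continuous_toLp 2 _).comp (continuous_pi fun i => by fun_prop)
  exact hc.comp_aestronglyMeasurable hκ

theorem memLp_featureField {m : Measure (E d)} {κ : E d → H} (hκ : MemLp κ 2 m)
    (f : VecRKHS d H) : MemLp (featureField κ f) 2 m :=
  hκ.of_le_mul (c := ‖f‖) (aestronglyMeasurable_featureField hκ.1 f)
    (Eventually.of_forall fun x => norm_featureField_le κ f x)

/-- The operator `f ↦ (x ↦ ⟪f, κ x⟫)` from `H^d` to `L₂^d` of a square integrable feature map. -/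
def featureOp {m : Measure (E d)} (κ : E d → H) (hκ : MemLp κ 2 m) :
    VecRKHS d H →L[ℝ] Lp (E d) 2 m :=
  LinearMap.mkContinuous
    { toFun := fun f => (memLp_featureField hκ f).toLp
      map_add' := by
        intro f g
        rw [← MemLp.toLp_add]
        congr 1
        ext x i
        simp [featureField, inner_add_left]
      map_smul' := by
        intro c f
        rw [RingHom.id_apply, ← MemLp.toLp_const_smul]
        congr 1
        ext x i
        simp [featureField, inner_smul_left] }
    (eLpNorm κ 2 m).toReal (by
      intro f
      simp only [LinearMap.coe_mk, AddHom.coe_mk, Lp.norm_toLp]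
      have h := eLpNorm_le_mul_eLpNorm_of_ae_le_mul (p := 2) (c := ‖f‖) (μ := m)
        (Eventually.of_forall fun x => norm_featureField_le κ f x)
      rw [mul_comm, ← ENNReal.toReal_ofReal (norm_nonneg f), ← ENNReal.toReal_mul]
      exact ENNReal.toReal_mono (ENNReal.mul_ne_top ENNReal.ofReal_ne_top hκ.2.ne) h)

theorem norm_featureOp_le {m : Measure (E d)} (κ : E d → H) (hκ : MemLp κ 2 m) :
    ‖featureOp κ hκ‖ ≤ (eLpNorm κ 2 m).toReal :=
  LinearMap.mkContinuous_norm_le _ ENNReal.toReal_nonneg _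

theorem featureOp_coeFn {m : Measure (E d)} (κ : E d → H) (hκ : MemLp κ 2 m)
    (f : VecRKHS d H) : featureOp κ hκ f =ᵐ[m] featureField κ f :=
  (memLp_featureField hκ f).coeFn_toLp

theorem featureOp_sub {m : Measure (E d)} {κ κ' : E d → H} (hκ : MemLp κ 2 m)
    (hκ' : MemLp κ' 2 m) : featureOp κ hκ - featureOp κ' hκ' = featureOp (κ - κ') (hκ.sub hκ') := by
  ext1 f
  refine Lp.ext ?_
  filter_upwards [featureOp_coeFn κ hκ f, featureOp_coeFn κ' hκ' f,
    featureOp_coeFn _ (hκ.sub hκ') f, Lp.coeFn_sub (featureOp κ hκ f) (featureOp κ' hκ' f)]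
    with x h1 h2 h3 h4
  rw [sub_apply, h4, Pi.sub_apply, h1, h2, h3]
  ext i
  simp [featureField, inner_sub_right]

/-- A feature map with finitely many values gives an operator of finite rank: it factors through
the finitely many functionals `⟪·, v⟫`, `v` a value of the feature map. -/
theorem isCompactOperator_featureOp_simpleFunc {m : Measure (E d)} [IsFiniteMeasure m]
    (s : SimpleFunc (E d) H) (hs : MemLp s 2 m) : IsCompactOperator (featureOp s hs) := by
  classical
  let Q : VecRKHS d H →L[ℝ] (s.range → E d) :=
    { toFun := fun f v => WithLp.toLp 2 fun i => ⟪f i, (v : H)⟫_ℝ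
      map_add' := by
        intro f g
        ext v i
        simp [inner_add_left]
      map_smul' := by
        intro c f
        ext v i
        simp [inner_smul_left]
      cont := by fun_prop }
  let w' : (s.range → E d) → H → E d := fun w h => if hh : h ∈ s.range then w ⟨h, hh⟩ else 0
  have hmem : ∀ w : s.range → E d, MemLp (s.map (w' w)) 2 m := fun w =>
    SimpleFunc.memLp_of_isFiniteMeasure _ _ _
  let B : (s.range → E d) →ₗ[ℝ] Lp (E d) 2 m :=
    { toFun := fun w => (hmem w).toLp
      map_add' := by
        intro w z
        rw [← MemLp.toLp_add]
        congr 1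
        ext x i
        simp [w']
      map_smul' := by
        intro c w
        rw [RingHom.id_apply, ← MemLp.toLp_const_smul]
        congr 1
        ext x i
        simp [w'] }
  have hfac : (featureOp s hs : VecRKHS d H → Lp (E d) 2 m) =
      (LinearMap.toContinuousLinearMap B) ∘ Q := by
    ext1 f
    refine Lp.ext ?_
    filter_upwards [featureOp_coeFn s hs f, (hmem (Q f)).coeFn_toLp] with x h1 h2
    rw [h1]
    refine Eq.trans ?_ h2.symm
    simp [w', featureField, Q]
  rw [hfac]
  exact (isCompactOperator_of_locallyCompactSpace_dom Q).clm_comp _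

/-- The operator of a square integrable feature map is compact: the feature map is a limit of
simple functions in `L²`. -/
theorem isCompactOperator_featureOp {m : Measure (E d)} [IsFiniteMeasure m] [CompleteSpace H]
    (κ : E d → H) (hκ : MemLp κ 2 m) : IsCompactOperator (featureOp κ hκ) := by
  have h : ∀ n : ℕ, ∃ s : SimpleFunc (E d) H,
      eLpNorm (κ - ⇑s) 2 m < ENNReal.ofReal (1 / ((n : ℝ) + 1)) ∧ MemLp (⇑s) 2 m := fun n =>
    hκ.exists_simpleFunc_eLpNorm_sub_lt (by simp)
      (by rw [ne_eq, ENNReal.ofReal_eq_zero, not_le]; positivity)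
  choose s hs hs' using h
  refine isCompactOperator_of_tendsto (l := atTop) (F := fun n => featureOp (s n) (hs' n)) ?_
    (Eventually.of_forall fun n => isCompactOperator_featureOp_simpleFunc _ _)
  rw [tendsto_iff_norm_sub_tendsto_zero]
  refine squeeze_zero (fun _ => norm_nonneg _) (fun n => ?_)
    (tendsto_one_div_add_atTop_nhds_zero_nat (𝕜 := ℝ))
  rw [norm_sub_rev, featureOp_sub]
  refine (norm_featureOp_le _ _).trans ?_
  exact ENNReal.toReal_le_of_le_ofReal (by positivity) (hs n).le

end Compact

section Operators

variable {d : ℕ} {H : Type*} [NormedAddCommGroup H] [InnerProductSpace ℝ H] [CompleteSpace H]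
  [RKHS ℝ H (E d) ℝ]

theorem inner_kerFun_kerFun (x y : E d) :
    ⟪RKHS.kerFun H x (1 : ℝ), RKHS.kerFun H y (1 : ℝ)⟫_ℝ = reproKernel H y x := by
  rw [← RKHS.kernel_inner]
  simp [reproKernel]

theorem isCompactOperator_inclusion
    (hk : Continuous fun p : E d × E d => reproKernel H p.1 p.2) {ρ : E d → ℝ}
    [IsFiniteMeasure (densityMeasure ρ)]
    (hint : Integrable (fun x => reproKernel H x x) (densityMeasure ρ)) :
    IsCompactOperator (inclusion H ρ) := by
  have hKc : Continuous fun x : E d => RKHS.kerFun H x (1 : ℝ) :=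
    continuous_of_continuous_inner _
      ((hk.comp (continuous_snd.prodMk continuous_fst)).congr fun p =>
        (inner_kerFun_kerFun p.1 p.2).symm)
  have hK : MemLp (fun x : E d => RKHS.kerFun H x (1 : ℝ)) 2 (densityMeasure ρ) := by
    rw [memLp_two_iff_integrable_sq_norm hKc.aestronglyMeasurable]
    refine hint.congr (Eventually.of_forall fun x => ?_)
    simp only [← inner_kerFun_kerFun, real_inner_self_eq_norm_sq]
  have h : inclusion H ρ = featureOp _ hK := by
    ext1 f
    refine Lp.ext ?_
    filter_upwards [inclusion_coeFn hk hint f, featureOp_coeFn _ hK f] with x h1 h2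
    rw [h1, h2]
    ext i
    simp [VecRKHS.toFun, featureField]
  rw [h]
  exact isCompactOperator_featureOp _ _

end Operators

/-! ### The regularization error through the spectral theorem -/

section Spectral

variable {F : Type*} [NormedAddCommGroup F] [InnerProductSpace ℝ F] [CompleteSpace F]

/-- If the coefficients of `w` along the eigenvectors of a compact symmetric operator are obtained
from those of `h` by multipliers that `C` bounds, then `‖w‖ ≤ C ‖h‖`. -/
theorem norm_le_of_inner_eigenvector_eq {A : F →L[ℝ] F} (hA : IsCompactOperator A)
    (hs : (A : F →ₗ[ℝ] F).IsSymmetric) {w h : F} {m : ℝ → ℝ} {C : ℝ} (hC : 0 ≤ C)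
    (hm : ∀ c, Module.End.HasEigenvalue (A : F →ₗ[ℝ] F) c → |m c| ≤ C)
    (hw : ∀ c e, A e = c • e → ⟪e, w⟫_ℝ = m c * ⟪e, h⟫_ℝ) : ‖w‖ ≤ C * ‖h‖ := by
  set S : Submodule ℝ F := ⨆ c, Module.End.eigenspace (A : Module.End ℝ F) c with hS
  have hdense : Dense (S : Set F) := by
    rw [Submodule.dense_iff_topologicalClosure_eq_top, Submodule.topologicalClosure_eq_top_iff]
    exact ContinuousLinearMap.orthogonalComplement_iSup_eigenspaces_eq_bot hA hs
  have key : ∀ z ∈ S, ⟪z, w⟫_ℝ ≤ C * ‖z‖ * ‖h‖ := by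
    intro z hz
    obtain ⟨f, hf, rfl⟩ := (Submodule.mem_iSup_iff_exists_finsupp _ _).1 hz
    have hf' : ∀ c, A (f c) = c • f c := fun c => by
      simpa using Module.End.mem_eigenspace_iff.1 (hf c)
    have h1 : ⟪f.sum fun _ xi => xi, w⟫_ℝ = ⟪∑ c ∈ f.support, m c • f c, h⟫_ℝ := by
      rw [Finsupp.sum, sum_inner, sum_inner]
      exact Finset.sum_congr rfl fun c _ => by rw [hw c _ (hf' c), real_inner_smul_left]
    have hn : ∀ a : ℝ → ℝ, ‖∑ c ∈ f.support, a c • f c‖ ^ 2 =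
        ∑ c ∈ f.support, ‖a c • f c‖ ^ 2 := fun a => by
      have := hs.orthogonalFamily_eigenspaces.norm_sum
        (fun c => ⟨a c • f c, Submodule.smul_mem _ _ (hf c)⟩) f.support
      simpa using this
    have h2 : ‖∑ c ∈ f.support, m c • f c‖ ≤ C * ‖f.sum fun _ xi => xi‖ := by
      refine (sq_le_sq₀ (norm_nonneg _) (by positivity)).1 ?_
      have h1' := hn fun _ => 1
      simp only [one_smul] at h1'
      rw [hn, mul_pow, Finsupp.sum, h1', Finset.mul_sum]
      refine Finset.sum_le_sum fun c hc => ?_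
      rw [norm_smul, mul_pow]
      refine mul_le_mul_of_nonneg_right ?_ (by positivity)
      refine pow_le_pow_left₀ (norm_nonneg _) (hm c ?_) 2
      exact Module.End.hasEigenvalue_of_hasEigenvector ⟨hf c, Finsupp.mem_support_iff.1 hc⟩
    rw [h1]
    exact (real_inner_le_norm _ _).trans (mul_le_mul_of_nonneg_right h2 (norm_nonneg _))
  have hall : ∀ z, ⟪z, w⟫_ℝ ≤ C * ‖z‖ * ‖h‖ := fun z =>
    closure_minimal (s := (S : Set F)) (t := {z | ⟪z, w⟫_ℝ ≤ C * ‖z‖ * ‖h‖}) key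
      (isClosed_le (by fun_prop) (by fun_prop)) (hdense z)
  have h3 := hall w
  rw [real_inner_self_eq_norm_sq] at h3
  rcases (norm_nonneg w).eq_or_lt with h0 | h0
  · rw [← h0]; positivity
  · nlinarith

/-- The scalar form of the bound on the regularization error: `((1 - ν) c + ν)` dominates the
weighted geometric mean `((1 - ν) c) ^ γ ν ^ (1 - γ)`. -/
theorem abs_multiplier_le {ν c γ L : ℝ} (hν : 0 < ν) (hν1 : ν < 1) (hc : 0 ≤ c) (hcL : c ≤ L)
    (hγ : 0 < γ) (hγ1 : γ ≤ 1) :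
    |ν * (c - 1) / ((1 - ν) * c + ν) * c ^ γ| ≤ max L 1 * (ν ^ γ * (1 - ν) ^ (-γ)) := by
  have h1ν : 0 < 1 - ν := by linarith
  have hden : 0 < (1 - ν) * c + ν := by positivity
  have hmean : ((1 - ν) * c) ^ γ * ν ^ (1 - γ) ≤ (1 - ν) * c + ν := by
    have h := Real.geom_mean_le_arith_mean2_weighted hγ.le (by linarith : 0 ≤ 1 - γ)
      (by positivity : 0 ≤ (1 - ν) * c) hν.le (by ring)
    have h2 : 0 ≤ (1 - ν) * c := by positivity
    nlinarith
  have hcm : |c - 1| ≤ max L 1 := by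
    rw [abs_le]
    constructor
    · have := le_max_right L 1; linarith
    · have := le_max_left L 1; linarith
  have hq : ν * c ^ γ / ((1 - ν) * c + ν) ≤ ν ^ γ * (1 - ν) ^ (-γ) := by
    rw [div_le_iff₀ hden]
    calc ν * c ^ γ = ν ^ γ * (1 - ν) ^ (-γ) * (((1 - ν) * c) ^ γ * ν ^ (1 - γ)) := by
          rw [Real.mul_rpow h1ν.le hc, Real.rpow_neg h1ν.le]
          have h3 : ν = ν ^ γ * ν ^ (1 - γ) := by
            rw [← Real.rpow_add hν]; simp
          have h4 : (1 - ν) ^ γ ≠ 0 := (Real.rpow_pos_of_pos h1ν γ).ne'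
          conv_lhs => rw [h3]
          field_simp
      _ ≤ _ := mul_le_mul_of_nonneg_left hmean (by positivity)
  have hcγ : 0 ≤ c ^ γ := Real.rpow_nonneg hc γ
  calc |ν * (c - 1) / ((1 - ν) * c + ν) * c ^ γ|
      = |c - 1| * (ν * c ^ γ / ((1 - ν) * c + ν)) := by
        rw [abs_mul, abs_div, abs_mul, abs_of_pos hν, abs_of_pos hden, abs_of_nonneg hcγ]
        ring
    _ ≤ _ := mul_le_mul hcm hq (by positivity) (by positivity)

end Spectral

section RegularizationError

variable {d : ℕ} {H : Type*} [NormedAddCommGroup H] [InnerProductSpace ℝ H] [CompleteSpace H]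
  [RKHS ℝ H (E d) ℝ]

theorem isPositive_integralOp (ρ : E d → ℝ) : (integralOp H ρ).IsPositive :=
  ContinuousLinearMap.isPositive_self_comp_adjoint (inclusion H ρ)

theorem isUnit_regularized {ν : ℝ} (hν : 0 < ν) (hν1 : ν ≤ 1) (ρ : E d → ℝ) :
    IsUnit ((1 - ν) • (inclusionAdj H ρ ∘L inclusion H ρ) +
      ν • ContinuousLinearMap.id ℝ (VecRKHS d H)) := by
  refine ContinuousLinearMap.isUnit_of_forall_le_norm_inner_map _ (c := ⟨ν, hν.le⟩) hν fun x => ?_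
  have h : ⟪((1 - ν) • (inclusionAdj H ρ ∘L inclusion H ρ) +
      ν • ContinuousLinearMap.id ℝ (VecRKHS d H)) x, x⟫_ℝ =
      (1 - ν) * ‖inclusion H ρ x‖ ^ 2 + ν * ‖x‖ ^ 2 := by
    simp [inner_add_left, real_inner_smul_left, inclusionAdj,
      ContinuousLinearMap.adjoint_inner_left]
  rw [h]
  have h1 : 0 ≤ (1 - ν) * ‖inclusion H ρ x‖ ^ 2 := mul_nonneg (by linarith) (by positivity)
  calc ‖x‖ ^ 2 * ν ≤ (1 - ν) * ‖inclusion H ρ x‖ ^ 2 + ν * ‖x‖ ^ 2 := by linarith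
    _ ≤ _ := Real.le_norm_self _

/-- The regularized operator is symmetric, and acts on an eigenvector of `ι ι^*` for the
eigenvalue `c` as multiplication by `c / ((1 - ν) c + ν)`. -/
theorem inner_velocity_of_eigenvector {ν : ℝ} (hν : 0 < ν) (hν1 : ν ≤ 1) (ρ : E d → ℝ) (u e : L2 ρ)
    {c : ℝ} (hc : 0 ≤ c) (he : integralOp H ρ e = c • e) :
    ⟪e, velocity H ν ρ u⟫_ℝ = c / ((1 - ν) * c + ν) * ⟪e, u⟫_ℝ := by
  set R := (1 - ν) • (inclusionAdj H ρ ∘L inclusion H ρ) +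
      ν • ContinuousLinearMap.id ℝ (VecRKHS d H) with hR
  have hunit : IsUnit R := isUnit_regularized hν hν1 ρ
  have hden : 0 < (1 - ν) * c + ν := by
    have : 0 ≤ (1 - ν) * c := mul_nonneg (by linarith) hc
    linarith
  set z := Ring.inverse R (inclusionAdj H ρ u) with hz
  have hRz : R z = inclusionAdj H ρ u := by
    rw [hz, ← mul_apply_eq_comp, Ring.mul_inverse_cancel _ hunit]; rfl
  have he' : inclusion H ρ (inclusionAdj H ρ e) = c • e := he
  have hadj : ∀ (a : L2 ρ) (b : VecRKHS d H), ⟪inclusionAdj H ρ a, b⟫_ℝ = ⟪a, inclusion H ρ b⟫_ℝ :=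
    fun a b => ContinuousLinearMap.adjoint_inner_left _ _ _
  have hadj' : ∀ (a : L2 ρ) (b : VecRKHS d H), ⟪b, inclusionAdj H ρ a⟫_ℝ = ⟪inclusion H ρ b, a⟫_ℝ :=
    fun a b => ContinuousLinearMap.adjoint_inner_right _ _ _
  have h1 : ⟪inclusionAdj H ρ e, R z⟫_ℝ = ((1 - ν) * c + ν) * ⟪e, inclusion H ρ z⟫_ℝ := by
    simp only [hR, add_apply, smul_apply, inner_add_right,
      real_inner_smul_right, ContinuousLinearMap.comp_apply, ContinuousLinearMap.id_apply]
    rw [hadj', he', hadj, real_inner_smul_left]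
    ring
  have h2 : ⟪inclusionAdj H ρ e, R z⟫_ℝ = c * ⟪e, u⟫_ℝ := by
    rw [hRz, hadj', he', real_inner_smul_left]
  have h3 : velocity H ν ρ u = inclusion H ρ z := rfl
  rw [h3, div_mul_eq_mul_div, eq_div_iff hden.ne', ← h2, h1]
  ring

theorem eigenvalue_nonneg {ρ : E d → ℝ} {c : ℝ}
    (hc : Module.End.HasEigenvalue (integralOp H ρ : L2 ρ →ₗ[ℝ] L2 ρ) c) : 0 ≤ c :=
  eigenvalue_nonneg_of_nonneg hc fun x => by
    have := (isPositive_integralOp (H := H) ρ).inner_nonneg_right x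
    simpa using this

theorem eigenvalue_le_topEigenvalue {ρ : E d → ℝ} {c : ℝ}
    (hc : Module.End.HasEigenvalue (integralOp H ρ : L2 ρ →ₗ[ℝ] L2 ρ) c) :
    c ≤ topEigenvalue H ρ := by
  refine le_csSup ⟨‖integralOp H ρ‖, ?_⟩ hc
  intro b hb
  obtain ⟨v, hv⟩ := Module.End.HasEigenvalue.exists_hasEigenvector hb
  have h1 : integralOp H ρ v = b • v := hv.apply_eq_smul
  have h2 := (integralOp H ρ).le_opNorm v
  rw [h1, norm_smul] at h2
  exact (Real.le_norm_self b).trans (le_of_mul_le_mul_right h2 (norm_pos_iff.2 hv.2))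

/-- `velocity - u` has the coefficient `ν (c - 1) / ((1 - ν) c + ν) · c ^ γ ⟪e, h⟫` along an
eigenvector `e`, if `u = A ^ γ h`. -/
theorem norm_velocity_sub_le (hk : Continuous fun p : E d × E d => reproKernel H p.1 p.2)
    {ρ : E d → ℝ} (hρ : IsDensity ρ)
    (hint : Integrable (fun x => reproKernel H x x) (densityMeasure ρ)) {ν γ C : ℝ} (hν : 0 < ν)
    (hν1 : ν ≤ 1) {u h : L2 ρ} (hu : IsPowApply (integralOp H ρ) γ h u) (hC : 0 ≤ C)
    (hm : ∀ c, 0 ≤ c → c ≤ topEigenvalue H ρ →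
      |ν * (c - 1) / ((1 - ν) * c + ν) * c ^ γ| ≤ C) :
    ‖velocity H ν ρ u - u‖ ≤ C * ‖h‖ := by
  have := isProbabilityMeasure_densityMeasure hρ
  have hcomp : IsCompactOperator (integralOp H ρ) :=
    (isCompactOperator_inclusion hk hint).comp_clm (inclusionAdj H ρ)
  refine norm_le_of_inner_eigenvector_eq hcomp (isPositive_integralOp ρ).isSymmetric hC
    (m := fun c => ν * (c - 1) / ((1 - ν) * c + ν) * c ^ γ)
    (fun c hc => hm c (eigenvalue_nonneg hc) (eigenvalue_le_topEigenvalue hc)) fun c e he => ?_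
  by_cases he0 : e = 0
  · simp [he0]
  have hc : 0 ≤ c := eigenvalue_nonneg
    (Module.End.hasEigenvalue_of_hasEigenvector
      (f := (integralOp H ρ : L2 ρ →ₗ[ℝ] L2 ρ)) ⟨Module.End.mem_eigenspace_iff.2 he, he0⟩)
  have hden : 0 < (1 - ν) * c + ν := by
    have : 0 ≤ (1 - ν) * c := mul_nonneg (by linarith) hc
    linarith
  rw [inner_sub_right, inner_velocity_of_eigenvector hν hν1 ρ u e hc he, hu c e he]
  have h1 : c / ((1 - ν) * c + ν) - 1 = ν * (c - 1) / ((1 - ν) * c + ν) := by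
    rw [div_sub_one hden.ne']
    ring
  rw [← h1]
  ring

/-- The regularization error of the velocity is bounded by the integrand of the error integral. -/
theorem ofReal_norm_velocity_sub_sq_le
    (hk : Continuous fun p : E d × E d => reproKernel H p.1 p.2)
    {ρ π : E d → ℝ} (hρ : IsDensity ρ)
    (hint : Integrable (fun x => reproKernel H x x) (densityMeasure ρ)) {ν γ : ℝ} (hν : 0 < ν)
    (hν1 : ν ≤ 1) (hγ : 0 < γ) (hγ1 : γ ≤ 1) :
    ENNReal.ofReal (‖velocity H ν ρ (score ρ π) - score ρ π‖ ^ 2) ≤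
      ENNReal.ofReal (max (topEigenvalue H ρ) 1) ^ 2 *
        ENNReal.ofReal ν ^ (2 * γ) * ENNReal.ofReal (1 - ν) ^ (-(2 * γ)) *
        preimageNorm H ρ π γ ^ 2 := by
  set u := score ρ π
  set w := velocity H ν ρ u - u
  have hinf : ∀ C : ℝ, 0 < C → (∀ c, 0 ≤ c → c ≤ topEigenvalue H ρ →
      |ν * (c - 1) / ((1 - ν) * c + ν) * c ^ γ| ≤ C) →
      ENNReal.ofReal (‖w‖ ^ 2) ≤ ENNReal.ofReal C ^ 2 * preimageNorm H ρ π γ ^ 2 := by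
    intro C hC hm
    rw [← mul_pow, ENNReal.ofReal_pow (norm_nonneg _), ofReal_norm]
    refine pow_le_pow_left' ?_ 2
    rw [preimageNorm, ENNReal.mul_iInf_of_ne (by simpa using hC) (by simp)]
    refine le_iInf fun h => ?_
    rw [ENNReal.mul_iInf_of_ne (by simpa using hC) (by simp)]
    refine le_iInf fun hh => ?_
    rw [← ofReal_norm, ← ofReal_norm, ← ENNReal.ofReal_mul hC.le]
    exact ENNReal.ofReal_le_ofReal (norm_velocity_sub_le hk hρ hint hν hν1 hh hC.le hm)
  set L := max (topEigenvalue H ρ) 1 with hL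
  have hL1 : 1 ≤ L := le_max_right _ _
  rcases hν1.lt_or_eq with hlt | rfl
  · have h1ν : 0 < 1 - ν := by linarith
    refine (hinf (L * (ν ^ γ * (1 - ν) ^ (-γ))) (by positivity) fun c hc hc' =>
      abs_multiplier_le hν hlt hc hc' hγ hγ1).trans_eq ?_
    congr 1
    rw [ENNReal.ofReal_mul (by positivity), ENNReal.ofReal_mul (by positivity), mul_pow, mul_pow,
      ← mul_assoc, ENNReal.ofReal_rpow_of_pos hν, ENNReal.ofReal_rpow_of_pos h1ν,
      ← ENNReal.ofReal_pow (by positivity), ← ENNReal.ofReal_pow (by positivity),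
      ← ENNReal.ofReal_pow (by positivity), ← Real.rpow_mul_natCast hν.le,
      ← Real.rpow_mul_natCast h1ν.le, mul_comm γ, neg_mul, mul_comm γ]
    norm_num
  · -- For `ν = 1` the right-hand side is `0` or `∞`; it vanishes only if `u` has arbitrarily
    -- small pre-images, and then any finite bound forces the error to vanish.
    have hC := hinf (L * L ^ γ) (by positivity) fun c hc hc' => by
      have h1 : |c - 1| ≤ L := by
        rw [abs_le]
        constructor
        · linarith
        · have := le_max_left (topEigenvalue H ρ) 1; linarith
      have h2 : c ^ γ ≤ L ^ γ := Real.rpow_le_rpow hc (hc'.trans (le_max_left _ _)) hγ.le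
      have h3 : 0 ≤ c ^ γ := Real.rpow_nonneg hc γ
      simp only [sub_self, zero_mul, zero_add, one_mul, div_one, abs_mul, abs_of_nonneg h3]
      exact mul_le_mul h1 h2 h3 (by positivity)
    rcases eq_or_ne (preimageNorm H ρ π γ) 0 with h0 | h0
    · rw [h0] at hC ⊢
      simpa using hC
    · have : ENNReal.ofReal (1 - 1) ^ (-(2 * γ)) = ∞ := by
        rw [sub_self, ENNReal.ofReal_zero, ENNReal.zero_rpow_of_neg (by linarith)]
      rw [this, ENNReal.mul_top, ENNReal.top_mul (by simpa using h0)]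
      · exact le_top
      · refine mul_ne_zero (by simp; linarith) ?_
        simp

end RegularizationError

/-! ### Gaussian truncations on the logarithmic scale -/

/-- The weight `exp (-(ε y)²)`, a smooth truncation at scale `1 / ε`. -/
def gaussWeight (ε y : ℝ) : ℝ := Real.exp (-(ε * y) ^ 2)

/-- The bounded substitute `∫₀^y exp (-(ε u)²) du` of `y`; at `ε = 0` it is `y`. -/
def truncId (ε y : ℝ) : ℝ := ∫ u in (0 : ℝ)..y, gaussWeight ε u

/-- The bounded substitute `∫₀^y exp (u - (ε u)²) du` of `exp y - 1`. -/
def truncExp (ε y : ℝ) : ℝ := ∫ u in (0 : ℝ)..y, Real.exp u * gaussWeight ε u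

/-- The truncation slope `exp (-(η log (1 + s))²)`, the derivative of `cutSize η`. It varies slowly:
its derivative with respect to `log s` is of order `η`. -/
def cutSlope (η s : ℝ) : ℝ := gaussWeight η (Real.log (1 + s))

/-- The concave truncation `∫₀^s exp (-(η log (1 + r))²) dr` of `s`, bounded for `η ≠ 0`; it is
written as an integral over the logarithmic scale. -/
def cutSize (η s : ℝ) : ℝ := truncExp η (Real.log (1 + s))

theorem gaussWeight_pos (ε y : ℝ) : 0 < gaussWeight ε y := Real.exp_pos _

theorem gaussWeight_le_one (ε y : ℝ) : gaussWeight ε y ≤ 1 :=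
  Real.exp_le_one_iff.2 (by nlinarith [sq_nonneg (ε * y)])

theorem contDiff_gaussWeight (ε : ℝ) {n : WithTop ℕ∞} : ContDiff ℝ n (gaussWeight ε) := by
  unfold gaussWeight; fun_prop

theorem continuous_gaussWeight (ε : ℝ) : Continuous (gaussWeight ε) :=
  (contDiff_gaussWeight ε (n := 0)).continuous

theorem hasDerivAt_gaussWeight (ε y : ℝ) :
    HasDerivAt (gaussWeight ε) (-(2 * ε ^ 2 * y) * gaussWeight ε y) y := by
  have h : HasDerivAt (fun y : ℝ => -(ε * y) ^ 2) (-(2 * ε ^ 2 * y)) y := by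
    have h1 := (((hasDerivAt_id y).const_mul ε).pow 2).neg
    refine h1.congr_deriv ?_
    simp
    ring
  refine h.exp.congr_deriv ?_
  rw [gaussWeight, mul_comm]

theorem hasDerivAt_truncId (ε y : ℝ) : HasDerivAt (truncId ε) (gaussWeight ε y) y :=
  (continuous_gaussWeight ε).integral_hasStrictDerivAt 0 y |>.hasDerivAt

theorem hasDerivAt_truncExp (ε y : ℝ) :
    HasDerivAt (truncExp ε) (Real.exp y * gaussWeight ε y) y :=
  (Real.continuous_exp.mul (continuous_gaussWeight ε)).integral_hasStrictDerivAt 0 y |>.hasDerivAt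

theorem contDiff_truncId (ε : ℝ) : ContDiff ℝ 1 (truncId ε) :=
  contDiff_one_iff_deriv.2 ⟨fun y => (hasDerivAt_truncId ε y).differentiableAt, by
    rw [funext fun y => (hasDerivAt_truncId ε y).deriv]; exact continuous_gaussWeight ε⟩

theorem contDiff_truncExp (ε : ℝ) : ContDiff ℝ 1 (truncExp ε) :=
  contDiff_one_iff_deriv.2 ⟨fun y => (hasDerivAt_truncExp ε y).differentiableAt, by
    rw [funext fun y => (hasDerivAt_truncExp ε y).deriv]
    exact Real.continuous_exp.mul (continuous_gaussWeight ε)⟩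

theorem integrable_gaussWeight {ε : ℝ} (hε : 0 < ε) : Integrable (gaussWeight ε) := by
  refine (integrable_exp_neg_mul_sq (b := ε ^ 2) (by positivity)).congr
    (Eventually.of_forall fun u => ?_)
  simp only [gaussWeight]
  ring_nf

theorem integrable_exp_mul_gaussWeight {ε : ℝ} (hε : 0 < ε) :
    Integrable fun u => Real.exp u * gaussWeight ε u := by
  -- Half of the Gaussian absorbs the exponential.
  have hb : 0 < ε ^ 2 / 2 := by positivity
  refine ((integrable_exp_neg_mul_sq hb).const_mul (Real.exp (1 / (2 * ε ^ 2)))).mono'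
    (by unfold gaussWeight; fun_prop) (Eventually.of_forall fun u => ?_)
  rw [Real.norm_of_nonneg (mul_nonneg (Real.exp_pos _).le (gaussWeight_pos _ _).le), gaussWeight,
    ← Real.exp_add, ← Real.exp_add]
  refine Real.exp_le_exp.2 ?_
  have h1 : u ≤ 1 / (2 * ε ^ 2) + ε ^ 2 / 2 * u ^ 2 := by
    have h2 : 1 / (2 * ε ^ 2) + ε ^ 2 / 2 * u ^ 2 - u = (ε ^ 2 * u - 1) ^ 2 / (2 * ε ^ 2) := by
      field_simp
      ring
    have h3 : 0 ≤ (ε ^ 2 * u - 1) ^ 2 / (2 * ε ^ 2) := by positivity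
    linarith
  nlinarith

theorem abs_intervalIntegral_le_integral {f : ℝ → ℝ} (hf : Integrable f) (h0 : ∀ u, 0 ≤ f u)
    (y : ℝ) : |∫ u in (0 : ℝ)..y, f u| ≤ ∫ u, f u := by
  refine (intervalIntegral.norm_integral_le_integral_norm_uIoc (f := f) (μ := volume)).trans ?_
  simp only [Real.norm_of_nonneg (h0 _)]
  exact setIntegral_le_integral hf (Eventually.of_forall h0)

/-- Both truncations are bounded. -/
theorem exists_bound_trunc {ε : ℝ} (hε : 0 < ε) :
    ∃ M : ℝ, 1 ≤ M ∧ ∀ y, |truncId ε y| ≤ M ∧ |truncExp ε y| ≤ M :=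
  ⟨max 1 (max (∫ u, gaussWeight ε u) (∫ u, Real.exp u * gaussWeight ε u)), le_max_left _ _,
    fun y => ⟨(abs_intervalIntegral_le_integral (integrable_gaussWeight hε)
      (fun u => (gaussWeight_pos ε u).le) y).trans
        ((le_max_left _ _).trans (le_max_right _ _)),
      (abs_intervalIntegral_le_integral (integrable_exp_mul_gaussWeight hε)
        (fun u => mul_nonneg (Real.exp_pos u).le (gaussWeight_pos ε u).le) y).trans
        ((le_max_right _ _).trans (le_max_right _ _))⟩⟩

theorem exp_mul_truncId_sub_truncExp (ε y : ℝ) :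
    Real.exp y * truncId ε y - truncExp ε y =
      ∫ u in (0 : ℝ)..y, (Real.exp y - Real.exp u) * gaussWeight ε u := by
  have h1 : IntervalIntegrable (fun u => Real.exp y * gaussWeight ε u) volume 0 y :=
    (continuous_const.mul (continuous_gaussWeight ε)).intervalIntegrable _ _
  have h2 : IntervalIntegrable (fun u => Real.exp u * gaussWeight ε u) volume 0 y :=
    (Real.continuous_exp.mul (continuous_gaussWeight ε)).intervalIntegrable _ _
  rw [truncId, truncExp, ← intervalIntegral.integral_const_mul,
    ← intervalIntegral.integral_sub h1 h2]
  simp only [sub_mul]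

/-- The truncated entropy density lies between `0` and the entropy density `r log r - r + 1`,
`r = exp y`. -/
theorem exp_mul_truncId_sub_truncExp_mem (ε y : ℝ) :
    0 ≤ Real.exp y * truncId ε y - truncExp ε y ∧
      Real.exp y * truncId ε y - truncExp ε y ≤ InformationTheory.klFun (Real.exp y) := by
  have hkl : InformationTheory.klFun (Real.exp y) =
      ∫ u in (0 : ℝ)..y, (Real.exp y - Real.exp u) := by
    rw [intervalIntegral.integral_sub (by simp) (Real.continuous_exp.intervalIntegrable _ _)]
    simp [InformationTheory.klFun]
    ring
  have hc1 : Continuous fun u => (Real.exp y - Real.exp u) * gaussWeight ε u :=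
    (continuous_const.sub Real.continuous_exp).mul (continuous_gaussWeight ε)
  have hc2 : Continuous fun u => Real.exp y - Real.exp u := continuous_const.sub Real.continuous_exp
  rw [exp_mul_truncId_sub_truncExp, hkl]
  rcases le_total 0 y with hy | hy
  · have h0 : ∀ u ∈ Icc 0 y, 0 ≤ Real.exp y - Real.exp u := fun u hu =>
      sub_nonneg.2 (Real.exp_le_exp.2 hu.2)
    exact ⟨intervalIntegral.integral_nonneg hy fun u hu =>
        mul_nonneg (h0 u hu) (gaussWeight_pos _ _).le,
      intervalIntegral.integral_mono_on hy (hc1.intervalIntegrable _ _)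
        (hc2.intervalIntegrable _ _) fun u hu =>
          mul_le_of_le_one_right (h0 u hu) (gaussWeight_le_one _ _)⟩
  · have h0 : ∀ u ∈ Icc y 0, Real.exp y - Real.exp u ≤ 0 := fun u hu =>
      sub_nonpos.2 (Real.exp_le_exp.2 hu.1)
    rw [intervalIntegral.integral_symm y 0, intervalIntegral.integral_symm y 0]
    constructor
    · rw [← intervalIntegral.integral_neg]
      exact intervalIntegral.integral_nonneg hy fun u hu => by
        have := mul_nonneg (neg_nonneg.2 (h0 u hu)) (gaussWeight_pos ε u).le
        linarith
    · refine neg_le_neg (intervalIntegral.integral_mono_on hy (hc2.intervalIntegrable _ _)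
        (hc1.intervalIntegrable _ _) fun u hu => ?_)
      nlinarith [h0 u hu, gaussWeight_le_one ε u]

theorem cutSlope_pos (η s : ℝ) : 0 < cutSlope η s := gaussWeight_pos _ _

theorem cutSlope_le_one (η s : ℝ) : cutSlope η s ≤ 1 := gaussWeight_le_one _ _

theorem hasDerivAt_cutSize (η : ℝ) {s : ℝ} (hs : -1 < s) :
    HasDerivAt (cutSize η) (cutSlope η s) s := by
  have h1 : HasDerivAt (fun s : ℝ => Real.log (1 + s)) (1 / (1 + s)) s :=
    ((hasDerivAt_id s).const_add 1).log (by simp; linarith)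
  refine ((hasDerivAt_truncExp η _).comp s h1).congr_deriv ?_
  rw [Real.exp_log (by linarith), cutSlope]
  field_simp [(by linarith : (1 + s) ≠ 0)]

theorem hasDerivAt_cutSlope (η : ℝ) {s : ℝ} (hs : -1 < s) :
    HasDerivAt (cutSlope η) (-(2 * η ^ 2 * Real.log (1 + s) / (1 + s)) * cutSlope η s) s := by
  have h1 : HasDerivAt (fun s : ℝ => Real.log (1 + s)) (1 / (1 + s)) s :=
    ((hasDerivAt_id s).const_add 1).log (by simp; linarith)
  refine ((hasDerivAt_gaussWeight η _).comp s h1).congr_deriv ?_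
  rw [cutSlope]
  ring

theorem contDiffOn_cutSlope (η : ℝ) : ContDiffOn ℝ 1 (cutSlope η) (Ioi 0) :=
  (contDiff_gaussWeight η).comp_contDiffOn
    (ContDiffOn.log (by fun_prop) fun s hs => by have := mem_Ioi.1 hs; positivity)

theorem deriv_cutSlope_nonpos (η : ℝ) {s : ℝ} (hs : 0 < s) : deriv (cutSlope η) s ≤ 0 := by
  rw [(hasDerivAt_cutSlope η (by linarith)).deriv]
  have h1 : 0 ≤ Real.log (1 + s) := Real.log_nonneg (by linarith)
  have := cutSlope_pos η s
  have h2 : 0 ≤ 2 * η ^ 2 * Real.log (1 + s) / (1 + s) := by positivity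
  nlinarith

/-- The slope varies by at most `2 η` on the logarithmic scale. -/
theorem abs_deriv_cutSlope_mul_le {η : ℝ} (hη : 0 < η) {s : ℝ} (hs : 0 < s) :
    |deriv (cutSlope η) s| * s ≤ 2 * η := by
  rw [(hasDerivAt_cutSlope η (by linarith)).deriv]
  have h1 : 0 ≤ Real.log (1 + s) := Real.log_nonneg (by linarith)
  have h0 := cutSlope_pos η s
  set L := Real.log (1 + s) with hL
  have h2 : 0 ≤ 2 * η ^ 2 * L / (1 + s) * cutSlope η s := by positivity
  rw [neg_mul, abs_neg, abs_of_nonneg h2]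
  have h3 : η * L * cutSlope η s ≤ 1 := by
    have h4 : cutSlope η s = (Real.exp ((η * L) ^ 2))⁻¹ := by
      rw [cutSlope, gaussWeight, Real.exp_neg]
    rw [h4, ← div_eq_mul_inv, div_le_one (Real.exp_pos _)]
    have h5 := Real.add_one_le_exp ((η * L) ^ 2)
    nlinarith [sq_nonneg (η * L - 1)]
  have h6 : s / (1 + s) ≤ 1 := (div_le_one (by linarith)).2 (by linarith)
  calc 2 * η ^ 2 * L / (1 + s) * cutSlope η s * s
      = 2 * η * ((η * L * cutSlope η s) * (s / (1 + s))) := by ring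
    _ ≤ 2 * η * (1 * 1) := by
        have h7 : 0 ≤ s / (1 + s) := by positivity
        gcongr
    _ = 2 * η := by ring

theorem cutSlope_mul_le {η : ℝ} (hη : 0 < η) {s : ℝ} (hs : 0 < s) :
    cutSlope η s * (1 + s) ≤ Real.exp (1 / (4 * η ^ 2)) := by
  have h1 : (1 + s) = Real.exp (Real.log (1 + s)) := (Real.exp_log (by linarith)).symm
  rw [cutSlope, gaussWeight]
  conv_lhs => rw [h1, Real.log_exp, ← Real.exp_add]
  refine Real.exp_le_exp.2 ?_
  set L := Real.log (1 + s)
  have h2 : 1 / (4 * η ^ 2) - (-(η * L) ^ 2 + L) = (2 * η ^ 2 * L - 1) ^ 2 / (4 * η ^ 2) := by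
    field_simp
    ring
  have h3 : 0 ≤ (2 * η ^ 2 * L - 1) ^ 2 / (4 * η ^ 2) := by positivity
  linarith

theorem continuousOn_cutSize (η : ℝ) : ContinuousOn (cutSize η) (Ioi 0) := fun s hs =>
  (hasDerivAt_cutSize η (by linarith [mem_Ioi.1 hs])).continuousAt.continuousWithinAt

theorem cutSize_zero (η : ℝ) : cutSize η 0 = 0 := by simp [cutSize, truncExp]

theorem antitoneOn_cutSlope (η : ℝ) : AntitoneOn (cutSlope η) (Ici 0) := by
  refine antitoneOn_of_deriv_nonpos (convex_Ici 0) (fun s hs => ?_) (fun s hs => ?_) fun s hs => ?_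
  · exact (hasDerivAt_cutSlope η (by linarith [mem_Ici.1 hs])).continuousAt.continuousWithinAt
  · rw [interior_Ici] at hs
    exact (hasDerivAt_cutSlope η
      (by linarith [mem_Ioi.1 hs])).differentiableAt.differentiableWithinAt
  · rw [interior_Ici] at hs
    exact deriv_cutSlope_nonpos η hs

/-- Concavity: the slope of a chord from `0` lies between the final slope and `1`. -/
theorem cutSize_mem (η : ℝ) {s : ℝ} (hs : 0 < s) :
    s * cutSlope η s ≤ cutSize η s ∧ cutSize η s ≤ s := by
  obtain ⟨c, hc, h⟩ := exists_hasDerivAt_eq_slope (cutSize η) (cutSlope η) hs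
    (fun r hr => (hasDerivAt_cutSize η (by linarith [hr.1])).continuousAt.continuousWithinAt)
    fun r hr => hasDerivAt_cutSize η (by linarith [hr.1])
  rw [cutSize_zero, sub_zero, sub_zero, eq_div_iff hs.ne'] at h
  rw [← h]
  constructor
  · rw [mul_comm]
    exact mul_le_mul_of_nonneg_right
      (antitoneOn_cutSlope η (mem_Ici.2 hc.1.le) (mem_Ici.2 hs.le) hc.2.le) hs.le
  · exact mul_le_of_le_one_left hs.le (cutSlope_le_one _ _)

theorem cutSize_pos (η : ℝ) {s : ℝ} (hs : 0 < s) : 0 < cutSize η s :=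
  (mul_pos hs (cutSlope_pos η s)).trans_le (cutSize_mem η hs).1

theorem tendsto_gaussWeight (y : ℝ) : Tendsto (fun ε => gaussWeight ε y) (𝓝 0) (𝓝 1) := by
  have h : Continuous fun ε => gaussWeight ε y := by unfold gaussWeight; fun_prop
  simpa [gaussWeight] using h.tendsto 0

theorem tendsto_cutSize {s : ℝ} (hs : 0 < s) : Tendsto (fun η => cutSize η s) (𝓝 0) (𝓝 s) := by
  refine tendsto_of_tendsto_of_tendsto_of_le_of_le (g := fun η => s * cutSlope η s) ?_
    tendsto_const_nhds (fun η => (cutSize_mem η hs).1) fun η => (cutSize_mem η hs).2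
  simpa [cutSlope] using (tendsto_gaussWeight (Real.log (1 + s))).const_mul s

/-- The truncated entropy density `F φ(G / F)`, where `φ` is the truncation of `r log r - r + 1`
with `φ(exp y) = exp y * truncId ε y - truncExp ε y`. -/
def truncEntropy (ε F G : ℝ) : ℝ :=
  G * truncId ε (Real.log G - Real.log F) - F * truncExp ε (Real.log G - Real.log F)

theorem truncEntropy_eq (ε : ℝ) {F G : ℝ} (hF : 0 < F) (hG : 0 < G) :
    truncEntropy ε F G = F * (Real.exp (Real.log G - Real.log F) *
      truncId ε (Real.log G - Real.log F) - truncExp ε (Real.log G - Real.log F)) := by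
  rw [truncEntropy, Real.exp_sub, Real.exp_log hF, Real.exp_log hG]
  field_simp

theorem truncEntropy_nonneg (ε : ℝ) {F G : ℝ} (hF : 0 < F) (hG : 0 < G) :
    0 ≤ truncEntropy ε F G := by
  rw [truncEntropy_eq ε hF hG]
  exact mul_nonneg hF.le (exp_mul_truncId_sub_truncExp_mem _ _).1

theorem truncEntropy_le_klFun (ε : ℝ) {F G : ℝ} (hF : 0 < F) (hG : 0 < G) :
    truncEntropy ε F G ≤ F * InformationTheory.klFun (G / F) := by
  rw [truncEntropy_eq ε hF hG]
  refine mul_le_mul_of_nonneg_left ?_ hF.le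
  have h := (exp_mul_truncId_sub_truncExp_mem ε (Real.log G - Real.log F)).2
  rwa [← Real.log_div hG.ne' hF.ne', Real.exp_log (by positivity)] at *

theorem truncEntropy_le {ε M F G : ℝ} (hM : ∀ y, |truncId ε y| ≤ M ∧ |truncExp ε y| ≤ M)
    (hF : 0 < F) (hG : 0 < G) : truncEntropy ε F G ≤ M * (F + G) := by
  have h1 := (abs_le.1 (hM (Real.log G - Real.log F)).1).2
  have h2 := (abs_le.1 (hM (Real.log G - Real.log F)).2).1
  rw [truncEntropy]
  nlinarith

/-- Chain rule for the truncated entropy: its partial derivatives are `- truncExp` and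
`truncId`. -/
theorem hasDerivAt_truncEntropy (ε : ℝ) {F G : ℝ → ℝ} {F' G' t : ℝ} (hF : HasDerivAt F F' t)
    (hG : HasDerivAt G G' t) (hF0 : 0 < F t) (hG0 : 0 < G t) :
    HasDerivAt (fun s => truncEntropy ε (F s) (G s))
      (G' * truncId ε (Real.log (G t) - Real.log (F t)) -
        F' * truncExp ε (Real.log (G t) - Real.log (F t))) t := by
  have hy := (hG.log hG0.ne').sub (hF.log hF0.ne')
  have h1 := hG.mul ((hasDerivAt_truncId ε _).comp t hy)
  have h2 := hF.mul ((hasDerivAt_truncExp ε _).comp t hy)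
  refine (h1.sub h2).congr_deriv ?_
  simp only [Function.comp_apply, Pi.sub_apply, Real.exp_sub, Real.exp_log hF0, Real.exp_log hG0]
  field_simp
  ring

theorem continuousOn_truncEntropy (ε : ℝ) :
    ContinuousOn (fun p : ℝ × ℝ => truncEntropy ε p.1 p.2) (Ioi 0 ×ˢ Ioi 0) := by
  have h1 : ContinuousOn (fun p : ℝ × ℝ => Real.log p.2 - Real.log p.1) (Ioi 0 ×ˢ Ioi 0) :=
    (continuousOn_snd.log fun p hp => (mem_Ioi.1 hp.2).ne').sub
      (continuousOn_fst.log fun p hp => (mem_Ioi.1 hp.1).ne')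
  exact (continuousOn_snd.mul ((contDiff_truncId ε).continuous.comp_continuousOn h1)).sub
    (continuousOn_fst.mul ((contDiff_truncExp ε).continuous.comp_continuousOn h1))

/-! ### Gradients, cutoffs and differentiation under the integral -/

section Calculus

variable {d : ℕ}

theorem gradient_mul {u v : E d → ℝ} {x : E d} (hu : DifferentiableAt ℝ u x)
    (hv : DifferentiableAt ℝ v x) :
    gradient (fun y => u y * v y) x = u x • gradient v x + v x • gradient u x := by
  refine HasGradientAt.gradient (hasGradientAt_iff_hasFDerivAt.2 ?_)
  refine (hu.hasFDerivAt.mul hv.hasFDerivAt).congr_fderiv ?_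
  simp

theorem gradient_comp {h : ℝ → ℝ} {h' : ℝ} {u : E d → ℝ} {x : E d} (hh : HasDerivAt h h' (u x))
    (hu : DifferentiableAt ℝ u x) : gradient (fun y => h (u y)) x = h' • gradient u x := by
  refine HasGradientAt.gradient (hasGradientAt_iff_hasFDerivAt.2 ?_)
  refine (hh.comp_hasFDerivAt x hu.hasFDerivAt).congr_fderiv ?_
  simp

theorem gradient_sub {u v : E d → ℝ} {x : E d} (hu : DifferentiableAt ℝ u x)
    (hv : DifferentiableAt ℝ v x) :
    gradient (fun y => u y - v y) x = gradient u x - gradient v x := by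
  refine HasGradientAt.gradient (hasGradientAt_iff_hasFDerivAt.2 ?_)
  refine (hu.hasFDerivAt.sub hv.hasFDerivAt).congr_fderiv ?_
  simp

theorem continuous_gradient {u : E d → ℝ} (hu : ContDiff ℝ 1 u) : Continuous (gradient u) :=
  (InnerProductSpace.toDual ℝ (E d)).symm.continuous.comp (hu.continuous_fderiv one_ne_zero)

theorem hasCompactSupport_gradient {u : E d → ℝ} (hu : HasCompactSupport u) :
    HasCompactSupport (gradient u) :=
  (hu.fderiv (𝕜 := ℝ)).comp_left (g := (InnerProductSpace.toDual ℝ (E d)).symm) (map_zero _)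

theorem measurable_gradient_uncurry {g : ℝ → E d → ℝ} (hg : Continuous (Function.uncurry g)) :
    Measurable fun p : ℝ × E d => gradient (g p.1) p.2 :=
  (InnerProductSpace.toDual ℝ (E d)).symm.continuous.measurable.comp
    (measurable_fderiv_with_param ℝ hg)

theorem measurable_gradient_log_sub {f g : ℝ → E d → ℝ} (hf : Continuous (Function.uncurry f))
    (hg : Continuous (Function.uncurry g)) :
    Measurable fun p : ℝ × E d => (1 / g p.1 p.2) • gradient (g p.1) p.2 -
      (1 / f p.1 p.2) • gradient (f p.1) p.2 :=
  ((measurable_const.div hg.measurable).smul (measurable_gradient_uncurry hg)).sub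
    ((measurable_const.div hf.measurable).smul (measurable_gradient_uncurry hf))

theorem norm_add_sq_le {κ : ℝ} (hκ : 0 < κ) (A B : E d) :
    ‖A + B‖ ^ 2 ≤ (1 + κ) * ‖A‖ ^ 2 + (1 + κ⁻¹) * ‖B‖ ^ 2 := by
  have h1 := norm_add_le A B
  have h2 : ‖A + B‖ ^ 2 ≤ (‖A‖ + ‖B‖) ^ 2 := pow_le_pow_left₀ (norm_nonneg _) h1 2
  have h3 : 0 ≤ κ⁻¹ * (κ * ‖A‖ - ‖B‖) ^ 2 := by positivity
  have h4 : κ⁻¹ * (κ * ‖A‖ - ‖B‖) ^ 2 = κ * ‖A‖ ^ 2 - 2 * ‖A‖ * ‖B‖ + κ⁻¹ * ‖B‖ ^ 2 := by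
    field_simp
    ring
  nlinarith

theorem abs_two_mul_inner_le {δ : ℝ} (hδ : 0 < δ) (t : ℝ) (Y Z : E d) :
    |2 * t * ⟪Z, Y⟫_ℝ| ≤ δ * (t ^ 2 * ‖Y‖ ^ 2) + δ⁻¹ * ‖Z‖ ^ 2 := by
  have h1 := abs_real_inner_le_norm Z Y
  have h3 : 0 ≤ δ⁻¹ * (δ * (|t| * ‖Y‖) - ‖Z‖) ^ 2 := by positivity
  have h4 : δ⁻¹ * (δ * (|t| * ‖Y‖) - ‖Z‖) ^ 2 =
      δ * (t ^ 2 * ‖Y‖ ^ 2) - 2 * |t| * (‖Z‖ * ‖Y‖) + δ⁻¹ * ‖Z‖ ^ 2 := by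
    rw [← sq_abs t]
    field_simp
    ring
  rw [abs_mul, abs_mul, abs_two]
  have h5 : 2 * |t| * |⟪Z, Y⟫_ℝ| ≤ 2 * |t| * (‖Z‖ * ‖Y‖) := by gcongr
  linarith

/-- A compactly supported cutoff function of class `C¹` with values in `[0, 1]` and gradient
of norm at most `c`. -/
structure IsCutoff (c : ℝ) (χ : E d → ℝ) : Prop where
  contDiff : ContDiff ℝ 1 χ
  hasCompactSupport : HasCompactSupport χ
  nonneg : ∀ x, 0 ≤ χ x
  le_one : ∀ x, χ x ≤ 1
  norm_gradient_le : ∀ x, ‖gradient χ x‖ ≤ c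

theorem IsCutoff.hasCompactSupport_sq {c : ℝ} {χ : E d → ℝ} (hχ : IsCutoff c χ) :
    HasCompactSupport fun x => χ x ^ 2 :=
  hχ.hasCompactSupport.comp_left (g := fun y : ℝ => y ^ 2) (by simp)

theorem IsCutoff.gradient_sq_mul {c : ℝ} {χ a : E d → ℝ} (hχ : IsCutoff c χ) {x : E d}
    (ha : DifferentiableAt ℝ a x) : gradient (fun y => χ y ^ 2 * a y) x =
      (2 * (χ x * a x)) • gradient χ x + χ x ^ 2 • gradient a x := by
  have hχd : DifferentiableAt ℝ χ x := hχ.contDiff.differentiable one_ne_zero x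
  have h2 : DifferentiableAt ℝ (fun y => χ y ^ 2) x := hχd.pow 2
  rw [gradient_mul h2 ha,
    gradient_comp (h := fun y => y ^ 2) (by simpa using hasDerivAt_pow 2 (χ x)) hχd, smul_smul,
    add_comm]
  congr 2
  ring

/-- Rescalings of one bump function give cutoffs that are eventually `1` at each point, while their
gradients tend to `0` uniformly. -/
theorem exists_cutoff (d : ℕ) : ∃ (χ : ℕ → E d → ℝ) (c : ℕ → ℝ),
    (∀ n, 0 < c n ∧ c n ≤ 1 ∧ IsCutoff (c n) (χ n)) ∧ Tendsto c atTop (𝓝 0) ∧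
      ∀ x, ∀ᶠ n in atTop, χ n x = 1 := by
  let b : ContDiffBump (0 : E d) := ⟨1, 2, one_pos, one_lt_two⟩
  have hb : ContDiff ℝ 1 b := b.contDiff
  obtain ⟨C, hC⟩ := (hasCompactSupport_gradient b.hasCompactSupport).exists_bound_of_continuous
    (continuous_gradient hb)
  have hC0 : 0 ≤ C := (norm_nonneg _).trans (hC 0)
  -- The scale is chosen larger than the bound on the gradient of the bump.
  let r : ℕ → ℝ := fun n => (C + 1) * (n + 1)
  have hr : ∀ n, 0 < r n := fun n => by positivity
  have hrt : Tendsto r atTop atTop := by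
    refine Tendsto.const_mul_atTop (by positivity) ?_
    exact tendsto_atTop_add_const_right _ _ tendsto_natCast_atTop_atTop
  refine ⟨fun n x => b ((r n)⁻¹ • x), fun n => 1 / ((n : ℝ) + 1), fun n => ⟨by positivity, ?_, ?_⟩,
    tendsto_one_div_add_atTop_nhds_zero_nat, fun x => ?_⟩
  · rw [div_le_one (by positivity)]
    have : (0 : ℝ) ≤ n := Nat.cast_nonneg n
    linarith
  · refine ⟨hb.comp (contDiff_const_smul _), ?_, fun x => b.nonneg, fun x => b.le_one, fun x => ?_⟩
    · exact b.hasCompactSupport.comp_homeomorph (Homeomorph.smulOfNeZero _ (inv_ne_zero (hr n).ne'))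
    · have hg : gradient (fun x => b ((r n)⁻¹ • x)) x =
          (r n)⁻¹ • gradient b ((r n)⁻¹ • x) := by
        refine HasGradientAt.gradient (hasGradientAt_iff_hasFDerivAt.2 ?_)
        have h1 : HasFDerivAt (fun x : E d => (r n)⁻¹ • x)
            ((r n)⁻¹ • ContinuousLinearMap.id ℝ (E d)) x :=
          (hasFDerivAt_id x).const_smul (r n)⁻¹
        have h2 := (hb.differentiable one_ne_zero
          ((r n)⁻¹ • x)).hasGradientAt.hasFDerivAt.comp x h1
        refine h2.congr_fderiv ?_
        ext v
        simp
      rw [hg, norm_smul, norm_inv, Real.norm_of_nonneg (hr n).le, inv_mul_le_iff₀ (hr n)]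
      refine (hC _).trans ?_
      have : r n * (1 / ((n : ℝ) + 1)) = C + 1 := by simp only [r]; field_simp
      rw [this]
      linarith
  · filter_upwards [hrt.eventually_ge_atTop ‖x‖] with n hn
    refine b.one_of_mem_closedBall ?_
    rw [mem_closedBall_zero_iff, norm_smul, norm_inv, Real.norm_of_nonneg (hr n).le,
      inv_mul_le_iff₀ (hr n)]
    simpa [b] using hn

variable {m : Measure (E d)} [IsFiniteMeasure m] {χ : E d → ℝ}

theorem continuous_integral_mul (hχ : Continuous χ) (hs : HasCompactSupport χ)
    {Θ : ℝ → E d → ℝ} (hΘ : Continuous (Function.uncurry Θ)) :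
    Continuous fun t => ∫ x, χ x * Θ t x ∂m := by
  have h : ∀ t, ∫ x in tsupport χ, χ x * Θ t x ∂m = ∫ x, χ x * Θ t x ∂m := fun t =>
    setIntegral_eq_integral_of_forall_compl_eq_zero fun x hx => by
      rw [image_eq_zero_of_notMem_tsupport hx, zero_mul]
  simp_rw [← h]
  exact continuous_parametric_integral_of_continuous
    (((hχ.comp continuous_snd).mul hΘ : Continuous (Function.uncurry fun t x => χ x * Θ t x)))
    hs

theorem integrable_of_continuous_mul (hχ : Continuous χ) (hs : HasCompactSupport χ)
    {u : E d → ℝ} (hu : Continuous u) : Integrable (fun x => χ x * u x) m :=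
  (hχ.mul hu).integrable_of_hasCompactSupport hs.mul_right

theorem integrable_inner_gradient {φ : E d → ℝ} (hφ : ContDiff ℝ 1 φ) (hs : HasCompactSupport φ)
    {Y : E d → E d} (hY : Continuous Y) : Integrable (fun x => ⟪gradient φ x, Y x⟫_ℝ) m := by
  refine ((continuous_gradient hφ).inner hY).integrable_of_hasCompactSupport ?_
  refine (hasCompactSupport_gradient hs).mono fun x hx => ?_
  rw [Function.mem_support] at hx ⊢
  contrapose! hx
  rw [hx, inner_zero_left]

theorem integrable_norm_gradient_sq_mul {φ : E d → ℝ} (hφ : ContDiff ℝ 1 φ)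
    (hs : HasCompactSupport φ) {u : E d → ℝ} (hu : Continuous u) :
    Integrable (fun x => ‖gradient φ x‖ ^ 2 * u x) m := by
  refine (((continuous_gradient hφ).norm.pow 2).mul hu).integrable_of_hasCompactSupport ?_
  refine (hasCompactSupport_gradient hs).mono fun x hx => ?_
  rw [Function.mem_support] at hx ⊢
  contrapose! hx
  simp [hx]

theorem hasDerivAt_integral_mul (hχ : Continuous χ) (hs : HasCompactSupport χ)
    {Θ Θ' : ℝ → E d → ℝ} (hΘ : Continuous (Function.uncurry Θ))
    (hd : ∀ t, 0 < t → ∀ x, HasDerivAt (fun s => Θ s x) (Θ' t x) t)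
    (hΘ' : ContinuousOn (Function.uncurry Θ') (Ioi 0 ×ˢ univ)) {t : ℝ} (ht : 0 < t) :
    HasDerivAt (fun s => ∫ x, χ x * Θ s x ∂m) (∫ x, χ x * Θ' t x ∂m) t := by
  have hsub : Icc (t / 2) (2 * t) ×ˢ tsupport χ ⊆ Ioi (0 : ℝ) ×ˢ (univ : Set (E d)) :=
    prod_mono (fun s hs => (by linarith [hs.1] : (0 : ℝ) < s)) (subset_univ _)
  obtain ⟨C, hC⟩ := (isCompact_Icc.prod hs).exists_bound_of_continuousOn (hΘ'.mono hsub)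
  have hcx : ∀ s, 0 < s → Continuous (Θ' s) := fun s hs =>
    (hΘ'.comp_continuous (by fun_prop : Continuous fun x : E d => (s, x)) fun x => ⟨hs, mem_univ _⟩)
  have hcΘ : ∀ s, Continuous (Θ s) := fun s =>
    hΘ.comp (by fun_prop : Continuous fun x : E d => (s, x))
  refine (hasDerivAt_integral_of_dominated_loc_of_deriv_le
    (F := fun s x => χ x * Θ s x) (F' := fun s x => χ x * Θ' s x) (bound := fun x => ‖χ x‖ * C)
    (Icc_mem_nhds (by linarith : t / 2 < t) (by linarith : t < 2 * t))
    (Eventually.of_forall fun s => (hχ.mul (hcΘ s)).aestronglyMeasurable)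
    (integrable_of_continuous_mul hχ hs (hcΘ t))
    (hχ.mul (hcx t ht)).aestronglyMeasurable
    (Eventually.of_forall fun x s hs' => ?_)
    ((hχ.norm.integrable_of_hasCompactSupport hs.norm).mul_const C)
    (Eventually.of_forall fun x s hs' => ?_)).2
  · by_cases hx : x ∈ tsupport χ
    · rw [norm_mul]
      exact mul_le_mul_of_nonneg_left (hC (s, x) ⟨hs', hx⟩) (norm_nonneg _)
    · simp [image_eq_zero_of_notMem_tsupport hx]
  · exact (hd s (by linarith [hs'.1]) x).const_mul (χ x)

end Calculus

/-! ### Integration of a differential inequality -/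

/-- A differential inequality `F' ≤ b + e - a`, integrated over `(0, T)`. The function `e` need not
be measurable: once `a` is cut off at a constant, which makes it integrable, `e` may be replaced by
the smaller measurable function `max (a + F' - b) 0`. -/
theorem lintegral_le_of_deriv_le {F F' a b e : ℝ → ℝ} {T : ℝ} (hT : 0 < T)
    (hF : Continuous F) (hF' : ∀ t, 0 < t → HasDerivAt F (F' t) t)
    (ha : Measurable a) (hb : Measurable b) (ha0 : ∀ t, 0 ≤ a t) (hb0 : ∀ t, 0 ≤ b t)
    (hle : ∀ t, 0 < t → a t + F' t ≤ b t + e t) :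
    ∫⁻ t in Ioc 0 T, ENNReal.ofReal (a t) ≤ ENNReal.ofReal (F 0 - F T) +
      (∫⁻ t in Ioc 0 T, ENNReal.ofReal (b t)) + ∫⁻ t in Ioc 0 T, ENNReal.ofReal (e t) := by
  by_cases hbT : ∫⁻ t in Ioc 0 T, ENNReal.ofReal (b t) = ∞
  · rw [hbT, add_top, top_add]
    exact le_top
  by_cases heT : ∫⁻ t in Ioc 0 T, ENNReal.ofReal (e t) = ∞
  · rw [heT, add_top]
    exact le_top
  have hbI : IntegrableOn b (Ioc 0 T) :=
    ⟨hb.aestronglyMeasurable, by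
      rw [hasFiniteIntegral_iff_ofReal (Eventually.of_forall hb0)]
      exact lt_top_iff_ne_top.2 hbT⟩
  have hmono : ∀ t, ENNReal.ofReal (a t) = ⨆ n : ℕ, ENNReal.ofReal (min (a t) n) := by
    intro t
    refine le_antisymm ?_ (iSup_le fun n => ENNReal.ofReal_le_ofReal (min_le_left _ _))
    obtain ⟨n, hn⟩ := exists_nat_ge (a t)
    exact le_iSup_of_le n (by rw [min_eq_left hn])
  simp_rw [hmono]
  rw [lintegral_iSup (fun n => (ha.min measurable_const).ennreal_ofReal)
    (fun n k hnk t => ENNReal.ofReal_le_ofReal (min_le_min_left _ (by exact_mod_cast hnk)))]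
  refine iSup_le fun n => ?_
  set an : ℝ → ℝ := fun t => min (a t) n with han
  have han0 : ∀ t, 0 ≤ an t := fun t => le_min (ha0 t) (Nat.cast_nonneg n)
  have hanm : Measurable an := ha.min measurable_const
  set e₁ : ℝ → ℝ := fun t => max (an t + deriv F t - b t) 0 with he₁
  have he₁m : Measurable e₁ := ((hanm.add (measurable_deriv F)).sub hb).max measurable_const
  have he₁0 : ∀ t, 0 ≤ e₁ t := fun t => le_max_right _ _
  have he₁le : ∫⁻ t in Ioc 0 T, ENNReal.ofReal (e₁ t) ≤
      ∫⁻ t in Ioc 0 T, ENNReal.ofReal (e t) := by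
    refine setLIntegral_mono' measurableSet_Ioc fun t ht => ?_
    rw [he₁, ENNReal.ofReal_max, ENNReal.ofReal_zero, max_eq_left zero_le]
    refine ENNReal.ofReal_le_ofReal ?_
    have h1 := hle t ht.1
    rw [← (hF' t ht.1).deriv] at h1
    have h2 : an t ≤ a t := min_le_left _ _
    linarith
  have he₁I : IntegrableOn e₁ (Ioc 0 T) :=
    ⟨he₁m.aestronglyMeasurable, by
      rw [hasFiniteIntegral_iff_ofReal (Eventually.of_forall he₁0)]
      exact he₁le.trans_lt (lt_top_iff_ne_top.2 heT)⟩
  have hanI : IntegrableOn an (Ioc 0 T) := by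
    refine Integrable.mono' (g := fun _ => (n : ℝ)) (integrable_const _)
      hanm.aestronglyMeasurable (Eventually.of_forall fun t => ?_)
    rw [Real.norm_of_nonneg (han0 t)]
    exact min_le_right _ _
  have hFTC := intervalIntegral.sub_le_integral_of_hasDeriv_right_of_le (g := F) (g' := F')
    (φ := fun t => b t + e₁ t - an t) hT.le hF.continuousOn
    (fun t ht => (hF' t ht.1).hasDerivWithinAt)
    (by
      rw [integrableOn_Icc_iff_integrableOn_Ioc]
      exact (hbI.add he₁I).sub hanI)
    (fun t ht => by
      have h1 : an t + deriv F t - b t ≤ e₁ t := le_max_left _ _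
      rw [(hF' t ht.1).deriv] at h1
      linarith)
  have hsplit : ∫ t in Ioc 0 T, (b t + e₁ t - an t) =
      (∫ t in Ioc 0 T, b t) + (∫ t in Ioc 0 T, e₁ t) - ∫ t in Ioc 0 T, an t := by
    rw [← integral_add hbI he₁I]
    exact integral_sub (hbI.add he₁I) hanI
  rw [intervalIntegral.integral_of_le hT.le, hsplit] at hFTC
  calc ∫⁻ t in Ioc 0 T, ENNReal.ofReal (an t) = ENNReal.ofReal (∫ t in Ioc 0 T, an t) :=
        (ofReal_integral_eq_lintegral_ofReal hanI (Eventually.of_forall han0)).symm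
    _ ≤ ENNReal.ofReal (F 0 - F T + ∫ t in Ioc 0 T, b t) +
        ENNReal.ofReal (∫ t in Ioc 0 T, e₁ t) := by
        rw [add_comm]
        refine le_trans ?_ (ENNReal.ofReal_add_le.trans_eq (add_comm _ _))
        exact ENNReal.ofReal_le_ofReal (by linarith)
    _ ≤ ENNReal.ofReal (F 0 - F T) + ENNReal.ofReal (∫ t in Ioc 0 T, b t) +
        ENNReal.ofReal (∫ t in Ioc 0 T, e₁ t) := by
        gcongr
        exact ENNReal.ofReal_add_le
    _ ≤ _ := by
        rw [ofReal_integral_eq_lintegral_ofReal hbI (Eventually.of_forall hb0),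
          ofReal_integral_eq_lintegral_ofReal he₁I (Eventually.of_forall he₁0)]
        exact add_le_add le_rfl he₁le

/-! ### Perturbed diffusions -/

/-- A positive solution `g` of `∂_t g = m⁻¹ ∇ · (m (∇ g + g w))`, a density with respect to the
reversible measure `m` of the unperturbed diffusion. Only the bound `‖w‖² ≤ e` in `L²(g m)` of the
perturbation `w` is recorded, through Young's inequality for the pairing of `w` with `∇ φ`. -/
structure IsPerturbedFlow {d : ℕ} (m : Measure (E d)) (g g' : ℝ → E d → ℝ) (e : ℝ → ℝ) : Prop where
  continuous : Continuous (Function.uncurry g)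
  contDiff : ∀ t, ContDiff ℝ 1 (g t)
  pos : ∀ t x, 0 < g t x
  hasDerivAt : ∀ t, 0 < t → ∀ x, HasDerivAt (fun s => g s x) (g' t x) t
  continuousOn_deriv : ContinuousOn (Function.uncurry g') (Ioi 0 ×ˢ univ)
  integrable : ∀ t, Integrable (g t) m
  integral_eq_one : ∀ t, ∫ x, g t x ∂m = 1
  weak : ∀ t, 0 < t → ∀ φ : E d → ℝ, ContDiff ℝ 1 φ → HasCompactSupport φ → ∀ s, 0 < s →
    |(∫ x, φ x * g' t x ∂m) + ∫ x, ⟪gradient φ x, gradient (g t) x⟫_ℝ ∂m| ≤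
      s * e t + (4 * s)⁻¹ * ∫ x, ‖gradient φ x‖ ^ 2 * g t x ∂m

/-- The logarithmic energy `∫ χ² |∇ log (1 + g)|² dm` at time `t`, localized by `χ`. -/
def logEnergy {d : ℕ} (m : Measure (E d)) (χ : E d → ℝ) (g : ℝ → E d → ℝ) (t : ℝ) : ℝ :=
  ∫ x, χ x ^ 2 * (‖gradient (g t) x‖ ^ 2 / (1 + g t x) ^ 2) ∂m

/-- The dissipation `∫ χ² |α'(g)| |∇ g|² dm` at time `t` of a concave function of `g` with
derivative `α`, localized by `χ`. -/
def dissipation {d : ℕ} (m : Measure (E d)) (χ : E d → ℝ) (α : ℝ → ℝ) (g : ℝ → E d → ℝ)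
    (t : ℝ) : ℝ :=
  ∫ x, χ x ^ 2 * (|deriv α (g t x)| * ‖gradient (g t) x‖ ^ 2) ∂m

section Flow

theorem logEnergy_nonneg {d : ℕ} (m : Measure (E d)) (χ : E d → ℝ) (g : ℝ → E d → ℝ)
    (t : ℝ) : 0 ≤ logEnergy m χ g t :=
  integral_nonneg fun x => by positivity

theorem dissipation_nonneg {d : ℕ} (m : Measure (E d)) (χ : E d → ℝ) (α : ℝ → ℝ)
    (g : ℝ → E d → ℝ) (t : ℝ) : 0 ≤ dissipation m χ α g t :=
  integral_nonneg fun x => by positivity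

variable {d : ℕ} {m : Measure (E d)} {g g' : ℝ → E d → ℝ} {e : ℝ → ℝ}

theorem IsPerturbedFlow.integral_cutoff_le_one (hf : IsPerturbedFlow m g g' e) {χ : E d → ℝ}
    {c : ℝ} (hχ : IsCutoff c χ) {S : ℝ → ℝ} (hS0 : ∀ s, 0 < s → 0 ≤ S s)
    (hS1 : ∀ s, 0 < s → S s ≤ s) (t : ℝ) :
    0 ≤ ∫ x, χ x ^ 2 * S (g t x) ∂m ∧ ∫ x, χ x ^ 2 * S (g t x) ∂m ≤ 1 := by
  refine ⟨integral_nonneg fun x => mul_nonneg (sq_nonneg _) (hS0 _ (hf.pos t x)), ?_⟩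
  rw [← hf.integral_eq_one t]
  refine integral_mono_of_nonneg
    (Eventually.of_forall fun x => mul_nonneg (sq_nonneg _) (hS0 _ (hf.pos t x))) (hf.integrable t)
    (Eventually.of_forall fun x => ?_)
  have h1 : χ x ^ 2 ≤ 1 := pow_le_one₀ (hχ.nonneg x) (hχ.le_one x)
  exact (mul_le_of_le_one_left (hS0 _ (hf.pos t x)) h1).trans (hS1 _ (hf.pos t x))

variable [IsProbabilityMeasure m]

theorem measurable_integral_cutoff {χ : E d → ℝ} (hχ : Continuous χ) {u : ℝ → E d → ℝ}
    (hu : Measurable (Function.uncurry u)) : Measurable fun t => ∫ x, χ x ^ 2 * u t x ∂m := by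
  have h : Measurable fun p : ℝ × E d => χ p.2 ^ 2 * u p.1 p.2 :=
    ((hχ.measurable.comp measurable_snd).pow_const 2).mul hu
  exact (StronglyMeasurable.integral_prod_right' (ν := m) h.stronglyMeasurable).measurable

theorem measurable_logEnergy {χ : E d → ℝ} (hχ : Continuous χ)
    (hg : Continuous (Function.uncurry g)) : Measurable (logEnergy m χ g) := by
  refine measurable_integral_cutoff hχ ?_
  exact ((measurable_gradient_uncurry hg).norm.pow_const 2).div
    ((measurable_const.add hg.measurable).pow_const 2)

theorem measurable_dissipation {χ : E d → ℝ} (hχ : Continuous χ) (α : ℝ → ℝ)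
    (hg : Continuous (Function.uncurry g)) : Measurable (dissipation m χ α g) := by
  refine measurable_integral_cutoff hχ ?_
  exact ((measurable_deriv α).comp hg.measurable).norm.mul
    ((measurable_gradient_uncurry hg).norm.pow_const 2)

/-- The pointwise estimate behind the dissipation inequality; `a`, `b` stand for `α(g)`,
`|α'(g)|`, and `Y`, `Z` for `∇ g`, `∇ χ`. -/
theorem dissipation_pointwise {χ a b s θ C c δ : ℝ} {Y Z : E d} (hχ0 : 0 ≤ χ) (hχ1 : χ ≤ 1)
    (ha : 0 ≤ a) (hb : 0 ≤ b) (hs : 0 < s) (hθ : 0 < θ) (hδ : 0 < δ) (hbs : b * s ≤ θ)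
    (hC : a * (1 + s) ≤ C) (hZ : ‖Z‖ ≤ c) :
    1 / 2 * (χ ^ 2 * (b * ‖Y‖ ^ 2)) ≤
      -⟪(2 * (χ * a)) • Z - (χ ^ 2 * b) • Y, Y⟫_ℝ -
        (4 * θ)⁻¹ * (‖(2 * (χ * a)) • Z - (χ ^ 2 * b) • Y‖ ^ 2 * s) +
        δ * C ^ 2 * (χ ^ 2 * (‖Y‖ ^ 2 / (1 + s) ^ 2)) + (δ⁻¹ + 2 / θ * C ^ 2) * c ^ 2 := by
  have h1s : 0 < 1 + s := by linarith
  have hC0 : 0 ≤ C := le_trans (by positivity) hC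
  have hχ2 : χ ^ 2 ≤ 1 := pow_le_one₀ hχ0 hχ1
  have hZ2 : ‖Z‖ ^ 2 ≤ c ^ 2 := pow_le_pow_left₀ (norm_nonneg _) hZ 2
  have haC : (a * (1 + s)) ^ 2 ≤ C ^ 2 := pow_le_pow_left₀ (by positivity) hC 2
  have hinner : ⟪(2 * (χ * a)) • Z - (χ ^ 2 * b) • Y, Y⟫_ℝ =
      2 * (χ * a) * ⟪Z, Y⟫_ℝ - χ ^ 2 * (b * ‖Y‖ ^ 2) := by
    rw [inner_sub_left, real_inner_smul_left, real_inner_smul_left, real_inner_self_eq_norm_sq]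
    ring
  have hcross := (abs_le.1 (abs_two_mul_inner_le hδ (χ * a) Y Z)).2
  have haY : (χ * a) ^ 2 * ‖Y‖ ^ 2 ≤ C ^ 2 * (χ ^ 2 * (‖Y‖ ^ 2 / (1 + s) ^ 2)) := by
    have : (χ * a) ^ 2 * ‖Y‖ ^ 2 =
        (a * (1 + s)) ^ 2 * (χ ^ 2 * (‖Y‖ ^ 2 / (1 + s) ^ 2)) := by
      field_simp
    rw [this]
    gcongr
  have hnorm : ‖(2 * (χ * a)) • Z - (χ ^ 2 * b) • Y‖ ^ 2 ≤
      8 * (χ ^ 2 * a ^ 2 * ‖Z‖ ^ 2) + 2 * (χ ^ 4 * b ^ 2 * ‖Y‖ ^ 2) := by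
    have h := norm_add_sq_le one_pos ((2 * (χ * a)) • Z) (-((χ ^ 2 * b) • Y))
    rw [← sub_eq_add_neg, norm_neg, norm_smul, norm_smul, mul_pow, mul_pow, Real.norm_eq_abs,
      Real.norm_eq_abs, sq_abs, sq_abs] at h
    norm_num at h
    nlinarith
  have hA : χ ^ 2 * a ^ 2 * ‖Z‖ ^ 2 * s ≤ C ^ 2 * c ^ 2 := by
    have h1 : a ^ 2 * s ≤ C ^ 2 := by nlinarith [sq_nonneg a, mul_nonneg (sq_nonneg a) hs.le]
    calc χ ^ 2 * a ^ 2 * ‖Z‖ ^ 2 * s = χ ^ 2 * (a ^ 2 * s) * ‖Z‖ ^ 2 := by ring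
      _ ≤ 1 * C ^ 2 * c ^ 2 := by gcongr
      _ = _ := by ring
  have hB : χ ^ 4 * b ^ 2 * ‖Y‖ ^ 2 * s ≤ θ * (χ ^ 2 * (b * ‖Y‖ ^ 2)) := by
    calc χ ^ 4 * b ^ 2 * ‖Y‖ ^ 2 * s = χ ^ 2 * (b * s) * (χ ^ 2 * (b * ‖Y‖ ^ 2)) := by ring
      _ ≤ 1 * θ * (χ ^ 2 * (b * ‖Y‖ ^ 2)) := by gcongr
      _ = _ := by ring
  have hq : (4 * θ)⁻¹ * (‖(2 * (χ * a)) • Z - (χ ^ 2 * b) • Y‖ ^ 2 * s) ≤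
      2 / θ * (C ^ 2 * c ^ 2) + 1 / 2 * (χ ^ 2 * (b * ‖Y‖ ^ 2)) := by
    rw [inv_mul_le_iff₀ (by positivity)]
    have h1 : ‖(2 * (χ * a)) • Z - (χ ^ 2 * b) • Y‖ ^ 2 * s ≤
        (8 * (χ ^ 2 * a ^ 2 * ‖Z‖ ^ 2) + 2 * (χ ^ 4 * b ^ 2 * ‖Y‖ ^ 2)) * s := by gcongr
    have h2 : 4 * θ * (2 / θ * (C ^ 2 * c ^ 2) + 1 / 2 * (χ ^ 2 * (b * ‖Y‖ ^ 2))) =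
        8 * (C ^ 2 * c ^ 2) + 2 * (θ * (χ ^ 2 * (b * ‖Y‖ ^ 2))) := by
      field_simp
      ring
    rw [h2]
    linarith
  have h5 : δ * ((χ * a) ^ 2 * ‖Y‖ ^ 2) ≤
      δ * (C ^ 2 * (χ ^ 2 * (‖Y‖ ^ 2 / (1 + s) ^ 2))) := by gcongr
  have h6 : δ⁻¹ * ‖Z‖ ^ 2 ≤ δ⁻¹ * c ^ 2 := by gcongr
  rw [hinner]
  linarith

theorem integral_le_of_forall_le {n : ℕ} {v : E d → ℝ} {u : Fin n → E d → ℝ} {k : Fin n → ℝ}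
    {a : ℝ} (hv : Integrable v m) (hu : ∀ i, Integrable (u i) m)
    (h : ∀ x, v x ≤ ∑ i, k i * u i x + a) : ∫ x, v x ∂m ≤ ∑ i, k i * ∫ x, u i x ∂m + a := by
  have hs : Integrable (fun x => ∑ i, k i * u i x) m :=
    integrable_finsetSum _ fun i _ => (hu i).const_mul (k i)
  refine (integral_mono hv (hs.add (integrable_const a)) h).trans_eq ?_
  have h1 : ∫ x, (∑ i, k i * u i x + a) ∂m = ∫ x, ∑ i, k i * u i x ∂m + a := by
    rw [integral_add hs (integrable_const a), integral_const, probReal_univ, one_smul]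
  refine h1.trans ?_
  rw [integral_finsetSum _ fun i _ => (hu i).const_mul (k i)]
  simp only [integral_const_mul]

/-- Testing the equation with `χ² α(g)` for a decreasing slope `α` of small logarithmic
variation `θ`. -/
theorem IsPerturbedFlow.dissipation_le (hf : IsPerturbedFlow m g g' e) {χ : E d → ℝ} {c : ℝ}
    (hχ : IsCutoff c χ) {α : ℝ → ℝ} {θ C δ : ℝ} (hα : ContDiffOn ℝ 1 α (Ioi 0))
    (hα0 : ∀ s, 0 < s → 0 ≤ α s) (hα1 : ∀ s, 0 < s → deriv α s ≤ 0)
    (hθ : ∀ s, 0 < s → |deriv α s| * s ≤ θ) (hC : ∀ s, 0 < s → α s * (1 + s) ≤ C) (hθ0 : 0 < θ)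
    (hδ : 0 < δ) {t : ℝ} (ht : 0 < t) :
    1 / 2 * dissipation m χ α g t ≤ (∫ x, χ x ^ 2 * (α (g t x) * g' t x) ∂m) + θ * e t +
      δ * C ^ 2 * logEnergy m χ g t + (δ⁻¹ + 2 / θ * C ^ 2) * c ^ 2 := by
  have hgd : Differentiable ℝ (g t) := (hf.contDiff t).differentiable one_ne_zero
  have hχd : Differentiable ℝ χ := hχ.contDiff.differentiable one_ne_zero
  have hgc : Continuous (g t) := hgd.continuous
  have hχc : Continuous χ := hχd.continuous
  have hYc : Continuous (gradient (g t)) := continuous_gradient (hf.contDiff t)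
  have hαg : ContDiff ℝ 1 fun x => α (g t x) :=
    contDiffOn_univ.1 (hα.comp (hf.contDiff t).contDiffOn fun x _ => hf.pos t x)
  have hα'g : Continuous fun x => deriv α (g t x) :=
    (hα.continuousOn_deriv_of_isOpen isOpen_Ioi le_rfl).comp_continuous hgc fun x => hf.pos t x
  have hαd : ∀ s, 0 < s → HasDerivAt α (deriv α s) s := fun s hs =>
    ((hα.differentiableOn one_ne_zero).differentiableAt (Ioi_mem_nhds hs)).hasDerivAt
  set φ : E d → ℝ := fun x => χ x ^ 2 * α (g t x) with hφ
  have hφ1 : ContDiff ℝ 1 φ := (hχ.contDiff.pow 2).mul hαg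
  have hχ2s : HasCompactSupport fun x => χ x ^ 2 := hχ.hasCompactSupport_sq
  have hφs : HasCompactSupport φ := hχ2s.mul_right
  have hgrad : ∀ x, gradient φ x = (2 * (χ x * α (g t x))) • gradient χ x -
      (χ x ^ 2 * |deriv α (g t x)|) • gradient (g t) x := by
    intro x
    rw [hχ.gradient_sq_mul (hαg.differentiable one_ne_zero x),
      gradient_comp (hαd _ (hf.pos t x)) (hgd x), abs_of_nonpos (hα1 _ (hf.pos t x)), smul_smul,
      mul_neg, neg_smul, sub_neg_eq_add]
  have hw := hf.weak t ht φ hφ1 hφs θ hθ0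
  have hw' := (abs_le.1 hw).1
  have i1 : Integrable (fun x => ⟪gradient φ x, gradient (g t) x⟫_ℝ) m :=
    integrable_inner_gradient hφ1 hφs hYc
  have i2 : Integrable (fun x => ‖gradient φ x‖ ^ 2 * g t x) m :=
    integrable_norm_gradient_sq_mul hφ1 hφs hgc
  have hχ2c : Continuous fun x => χ x ^ 2 := hχc.pow 2
  have i3 : Integrable (fun x => χ x ^ 2 * (‖gradient (g t) x‖ ^ 2 / (1 + g t x) ^ 2)) m :=
    integrable_of_continuous_mul hχ2c hχ2s ((hYc.norm.pow 2).div ((continuous_const.add hgc).pow 2)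
      fun x => by have := hf.pos t x; positivity)
  have i4 : Integrable (fun x => χ x ^ 2 * (|deriv α (g t x)| * ‖gradient (g t) x‖ ^ 2)) m :=
    integrable_of_continuous_mul hχ2c hχ2s (hα'g.abs.mul (hYc.norm.pow 2))
  have hmono : 1 / 2 * dissipation m χ α g t ≤
      -(∫ x, ⟪gradient φ x, gradient (g t) x⟫_ℝ ∂m) -
        (4 * θ)⁻¹ * (∫ x, ‖gradient φ x‖ ^ 2 * g t x ∂m) +
        δ * C ^ 2 * logEnergy m χ g t + (δ⁻¹ + 2 / θ * C ^ 2) * c ^ 2 := by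
    have h := integral_le_of_forall_le (m := m) (n := 3) (i4.const_mul (1 / 2))
      (u := ![fun x => ⟪gradient φ x, gradient (g t) x⟫_ℝ, fun x => ‖gradient φ x‖ ^ 2 * g t x,
        fun x => χ x ^ 2 * (‖gradient (g t) x‖ ^ 2 / (1 + g t x) ^ 2)])
      (k := ![-1, -(4 * θ)⁻¹, δ * C ^ 2]) (a := (δ⁻¹ + 2 / θ * C ^ 2) * c ^ 2)
      (by simp only [Fin.forall_fin_succ]; exact ⟨i1, i2, i3, fun i => i.elim0⟩)
      (fun x => by
        have h := dissipation_pointwise (Y := gradient (g t) x) (hχ.nonneg x) (hχ.le_one x)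
          (hα0 _ (hf.pos t x)) (abs_nonneg (deriv α (g t x))) (hf.pos t x) hθ0 hδ
          (hθ _ (hf.pos t x)) (hC _ (hf.pos t x)) (hχ.norm_gradient_le x)
        rw [← hgrad] at h
        simp only [Fin.sum_univ_three, Matrix.cons_val]
        linarith)
    simp only [Fin.sum_univ_three, Matrix.cons_val, integral_const_mul] at h
    rw [dissipation, logEnergy]
    linarith
  have hφg' : ∫ x, φ x * g' t x ∂m = ∫ x, χ x ^ 2 * (α (g t x) * g' t x) ∂m := by
    simp only [hφ, mul_assoc]
  rw [hφg'] at hw'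
  linarith

/-- Differentiation in time of the localized integral of a function of `g`. -/
theorem IsPerturbedFlow.hasDerivAt_integral_comp (hf : IsPerturbedFlow m g g' e) {χ : E d → ℝ}
    {c : ℝ} (hχ : IsCutoff c χ) {α S : ℝ → ℝ} (hα : ContinuousOn α (Ioi 0))
    (hS : ∀ s, 0 < s → HasDerivAt S (α s) s) :
    (Continuous fun t => ∫ x, χ x ^ 2 * S (g t x) ∂m) ∧ ∀ t, 0 < t →
      HasDerivAt (fun t => ∫ x, χ x ^ 2 * S (g t x) ∂m)
        (∫ x, χ x ^ 2 * (α (g t x) * g' t x) ∂m) t := by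
  have hχc : Continuous fun x => χ x ^ 2 := hχ.contDiff.continuous.pow 2
  have hχs : HasCompactSupport fun x => χ x ^ 2 := hχ.hasCompactSupport_sq
  have hSc : ContinuousOn S (Ioi 0) := fun s hs => (hS s hs).continuousAt.continuousWithinAt
  have hc : Continuous (Function.uncurry fun t x => S (g t x)) :=
    hSc.comp_continuous hf.continuous fun p => hf.pos p.1 p.2
  refine ⟨continuous_integral_mul hχc hχs hc, fun t ht => hasDerivAt_integral_mul hχc hχs hc
    (fun t ht x => (hS _ (hf.pos t x)).comp t (hf.hasDerivAt t ht x)) ?_ ht⟩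
  exact (hα.comp_continuous hf.continuous fun p => hf.pos p.1 p.2).continuousOn.mul
    hf.continuousOn_deriv

/-- The logarithmic energy of a perturbed flow is integrable in time, uniformly in the cutoff: this
is the dissipation of `log (1 + g)`. -/
theorem IsPerturbedFlow.lintegral_logEnergy_le (hf : IsPerturbedFlow m g g' e) {T : ℝ}
    (hT : 0 < T) {χ : E d → ℝ} {c : ℝ} (hχ : IsCutoff c χ) (hc0 : 0 < c) (hc1 : c ≤ 1) :
    ∫⁻ t in Ioc 0 T, ENNReal.ofReal (logEnergy m χ g t) ≤
      4 * (1 + ENNReal.ofReal (6 * T) + ∫⁻ t in Ioc 0 T, ENNReal.ofReal (e t)) := by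
  have hd : ∀ s : ℝ, 0 < s → HasDerivAt (fun s : ℝ => (1 + s)⁻¹) (-1 / (1 + s) ^ 2) s :=
    fun s hs => ((hasDerivAt_id s).const_add 1).inv (by simp; linarith)
  have hder : ∀ s : ℝ, 0 < s → |deriv (fun s : ℝ => (1 + s)⁻¹) s| = 1 / (1 + s) ^ 2 := by
    intro s hs
    rw [(hd s hs).deriv, abs_div, abs_neg, abs_one, abs_of_nonneg (by positivity)]
  have hα : ContDiffOn ℝ 1 (fun s : ℝ => (1 + s)⁻¹) (Ioi 0) :=
    ContDiffOn.inv (by fun_prop) fun s hs => by have := mem_Ioi.1 hs; positivity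
  have hL : ∀ s : ℝ, 0 < s → HasDerivAt (fun s : ℝ => Real.log (1 + s)) (1 + s)⁻¹ s :=
    fun s hs => by simpa using ((hasDerivAt_id s).const_add 1).log (by simp; linarith)
  obtain ⟨hFc, hF'⟩ := hf.hasDerivAt_integral_comp hχ hα.continuousOn hL
  have hF01 := hf.integral_cutoff_le_one hχ (S := fun s => Real.log (1 + s))
    (fun s hs => Real.log_nonneg (by linarith))
    (fun s hs => by have := Real.log_le_sub_one_of_pos (by linarith : 0 < 1 + s); linarith)
  have hdis : ∀ t, dissipation m χ (fun s : ℝ => (1 + s)⁻¹) g t = logEnergy m χ g t := fun t => by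
    rw [dissipation, logEnergy]
    refine integral_congr_ae (Eventually.of_forall fun x => ?_)
    simp only [hder _ (hf.pos t x)]
    ring
  -- With `θ = C = 1` and `δ = 1 / 4`, half of the energy remains on the left, the cross terms
  -- use up a quarter, and `6 = δ⁻¹ + 2 / θ` bounds the cutoff error.
  have key := lintegral_le_of_deriv_le (a := fun t => 1 / 4 * logEnergy m χ g t)
    (b := fun _ => 6) (e := e) hT hFc.neg (fun t ht => (hF' t ht).neg)
    ((measurable_logEnergy hχ.contDiff.continuous hf.continuous).const_mul _) measurable_const
    (fun t => mul_nonneg (by norm_num) (logEnergy_nonneg _ _ _ _)) (fun _ => by norm_num)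
    (fun t ht => by
      have h := hf.dissipation_le hχ hα (fun s hs => by positivity)
        (fun s hs => by
          rw [(hd s hs).deriv, neg_div]
          have : 0 ≤ 1 / (1 + s) ^ 2 := by positivity
          linarith)
        (θ := 1) (fun s hs => by
          rw [hder s hs, div_mul_eq_mul_div, one_mul, div_le_one (by positivity)]
          nlinarith)
        (C := 1) (fun s hs => by rw [inv_mul_cancel₀ (by positivity)]) one_pos
        (δ := 1 / 4) (by norm_num) ht
      rw [hdis] at h
      have hc2 : c ^ 2 ≤ 1 := pow_le_one₀ hc0.le hc1
      norm_num at h ⊢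
      linarith)
  have h4 : ∀ t, ENNReal.ofReal (logEnergy m χ g t) =
      4 * ENNReal.ofReal (1 / 4 * logEnergy m χ g t) := fun t => by
    rw [← ENNReal.ofReal_ofNat, ← ENNReal.ofReal_mul (by norm_num)]
    congr 1
    ring
  simp_rw [h4]
  rw [lintegral_const_mul' _ _ (by simp)]
  refine mul_le_mul_right (key.trans ?_) _
  refine add_le_add (add_le_add ?_ ?_) le_rfl
  · rw [← ENNReal.ofReal_one]
    refine ENNReal.ofReal_le_ofReal ?_
    have h1 := (hF01 0).1
    have h2 := (hF01 T).2
    simp only [Pi.neg_apply]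
    linarith
  · rw [setLIntegral_const, Real.volume_Ioc, sub_zero, ENNReal.ofReal_mul (by norm_num)]

/-- The dissipation of the truncation `cutSize η` is controlled by the mass that the truncation
cuts off at time `0`, up to an error of order `η` and a cutoff error of order `c`. -/
theorem IsPerturbedFlow.lintegral_dissipation_cutSlope_le (hf : IsPerturbedFlow m g g' e) {T : ℝ}
    (hT : 0 < T) {χ : E d → ℝ} {c : ℝ} (hχ : IsCutoff c χ) (hc0 : 0 < c) (hc1 : c ≤ 1) {η C : ℝ}
    (hη : 0 < η) (hC : ∀ s, 0 < s → cutSlope η s * (1 + s) ≤ C) :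
    ∫⁻ t in Ioc 0 T, ENNReal.ofReal (dissipation m χ (cutSlope η) g t) ≤
      2 * (ENNReal.ofReal (1 - ∫ x, χ x ^ 2 * cutSize η (g 0 x) ∂m) +
        ENNReal.ofReal c * (ENNReal.ofReal (C ^ 2) *
          (∫⁻ t in Ioc 0 T, ENNReal.ofReal (logEnergy m χ g t)) +
          ENNReal.ofReal ((1 + C ^ 2 / η) * T)) +
        ENNReal.ofReal (2 * η) * ∫⁻ t in Ioc 0 T, ENNReal.ofReal (e t)) := by
  obtain ⟨hFc, hF'⟩ := hf.hasDerivAt_integral_comp hχ (contDiffOn_cutSlope η).continuousOn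
    (S := cutSize η) (fun s hs => hasDerivAt_cutSize η (by linarith))
  have hF01 := hf.integral_cutoff_le_one hχ (S := cutSize η)
    (fun s hs => (cutSize_pos η hs).le) (fun s hs => (cutSize_mem η hs).2)
  have hLm := measurable_logEnergy (m := m) hχ.contDiff.continuous hf.continuous
  have hL0 := logEnergy_nonneg m χ g
  have key := lintegral_le_of_deriv_le
    (a := fun t => 1 / 2 * dissipation m χ (cutSlope η) g t)
    (b := fun t => c * (C ^ 2 * logEnergy m χ g t + (1 + C ^ 2 / η)))
    (e := fun t => 2 * η * e t) hT hFc.neg (fun t ht => (hF' t ht).neg)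
    ((measurable_dissipation hχ.contDiff.continuous _ hf.continuous).const_mul _)
    (((hLm.const_mul _).add measurable_const).const_mul _)
    (fun t => mul_nonneg (by norm_num) (dissipation_nonneg _ _ _ _ _))
    (fun t => by have := hL0 t; positivity)
    (fun t ht => by
      have h := hf.dissipation_le hχ (contDiffOn_cutSlope η) (fun s hs => (cutSlope_pos η s).le)
        (fun s hs => deriv_cutSlope_nonpos η hs) (θ := 2 * η)
        (fun s hs => abs_deriv_cutSlope_mul_le hη hs) hC (by positivity) hc0 ht
      have h1 : (c⁻¹ + 2 / (2 * η) * C ^ 2) * c ^ 2 ≤ c * (1 + C ^ 2 / η) := by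
        have h2 : (c⁻¹ + 2 / (2 * η) * C ^ 2) * c ^ 2 = c * (1 + C ^ 2 / η * c) := by
          field_simp
        rw [h2]
        gcongr
        exact mul_le_of_le_one_right (by positivity) hc1
      linarith)
  have h2 : ∀ t, ENNReal.ofReal (dissipation m χ (cutSlope η) g t) =
      2 * ENNReal.ofReal (1 / 2 * dissipation m χ (cutSlope η) g t) := fun t => by
    rw [← ENNReal.ofReal_ofNat, ← ENNReal.ofReal_mul (by norm_num)]
    congr 1
    ring
  simp_rw [h2]
  rw [lintegral_const_mul' _ _ (by simp)]
  refine mul_le_mul_right (key.trans ?_) _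
  refine add_le_add (add_le_add ?_ ?_) ?_
  · refine ENNReal.ofReal_le_ofReal ?_
    have h2 := (hF01 T).2
    simp only [Pi.neg_apply]
    linarith
  · have h3 : ∀ t, ENNReal.ofReal (c * (C ^ 2 * logEnergy m χ g t + (1 + C ^ 2 / η))) =
        ENNReal.ofReal c * (ENNReal.ofReal (C ^ 2) * ENNReal.ofReal (logEnergy m χ g t) +
          ENNReal.ofReal (1 + C ^ 2 / η)) := fun t => by
      rw [ENNReal.ofReal_mul hc0.le, ENNReal.ofReal_add (mul_nonneg (sq_nonneg _) (hL0 t))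
        (by positivity), ENNReal.ofReal_mul (sq_nonneg _)]
    simp_rw [h3]
    rw [lintegral_const_mul' _ _ (by simp), lintegral_add_right _ measurable_const,
      lintegral_const_mul' _ _ (by simp), setLIntegral_const, Real.volume_Ioc, sub_zero,
      ENNReal.ofReal_mul (p := 1 + C ^ 2 / η) (by positivity)]
  · simp_rw [ENNReal.ofReal_mul (by positivity : 0 ≤ 2 * η)]
    rw [lintegral_const_mul' _ _ (by finiteness)]

end Flow

/-! ### The truncated entropy dissipation inequality -/

/-- The logarithmic ratio `log (S b / S a)` of the truncations by `S = cutSize η`. -/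
def cutLogRatio (η a b : ℝ) : ℝ := Real.log (cutSize η b) - Real.log (cutSize η a)

/-- The gradient of the logarithmic ratio of the truncations of `g` and `f` at time `t`. -/
def gradCutLogRatio {d : ℕ} (η : ℝ) (f g : ℝ → E d → ℝ) (t : ℝ) (x : E d) : E d :=
  (cutSlope η (g t x) / cutSize η (g t x)) • gradient (g t) x -
    (cutSlope η (f t x) / cutSize η (f t x)) • gradient (f t) x

/-- The density of the truncated relative Fisher information of `g` with respect to `f`. -/
def cutFisher {d : ℕ} (ε η : ℝ) (f g : ℝ → E d → ℝ) (t : ℝ) (x : E d) : ℝ :=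
  gaussWeight ε (cutLogRatio η (f t x) (g t x)) * cutSize η (g t x) *
    ‖gradCutLogRatio η f g t x‖ ^ 2

/-- The part of the entropy estimate that comes from the perturbation: the dissipation absorbs a
quarter of the square of the gradient `U` of the test function. -/
theorem quarter_norm_sq_le {d : ℕ} {χ a b s G P p κ C M c : ℝ} {Y Z W : E d}
    (hχ0 : 0 ≤ χ) (hχ1 : χ ≤ 1) (ha : 0 ≤ a) (ha1 : a ≤ 1) (hb : 0 ≤ b) (hs : 0 < s)
    (hbs : b * s ≤ 1) (hC : a * (1 + s) ≤ C) (hsG : s * a ≤ G)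
    (hP : |P| ≤ M) (hp : 0 < p) (hp1 : p ≤ 1) (hκ : 0 < κ) (hc : 0 < c)
    (hc1 : c ≤ 1) (hZ : ‖Z‖ ≤ c) :
    (4 * (1 + κ))⁻¹ * (‖(2 * (χ * (a * P))) • Z + χ ^ 2 • ((a * p) • W - (b * P) • Y)‖ ^ 2 * s) ≤
      1 / 4 * (χ ^ 2 * (p * G * ‖W‖ ^ 2)) +
      (2 * M ^ 2 * C ^ 2 / κ * c + M ^ 2 / (2 * κ) * (χ ^ 2 * (b * ‖Y‖ ^ 2))) := by
  have hM : 0 ≤ M := (abs_nonneg P).trans hP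
  have hC0 : 0 ≤ C := le_trans (by positivity) hC
  have hχ2 : χ ^ 2 ≤ 1 := pow_le_one₀ hχ0 hχ1
  have hZ2 : ‖Z‖ ^ 2 ≤ c ^ 2 := pow_le_pow_left₀ (norm_nonneg _) hZ 2
  have hP2 : P ^ 2 ≤ M ^ 2 := by rw [← sq_abs]; exact pow_le_pow_left₀ (abs_nonneg _) hP 2
  set U := (2 * (χ * (a * P))) • Z + χ ^ 2 • ((a * p) • W - (b * P) • Y) with hU
  have hκ1 : 0 < 1 + κ⁻¹ := by positivity
  have hsplit : U = (χ ^ 2 * (a * p)) • W +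
      ((2 * (χ * (a * P))) • Z - (χ ^ 2 * (b * P)) • Y) := by
    rw [hU, smul_sub, smul_smul, smul_smul]
    abel
  have hR : ‖(2 * (χ * (a * P))) • Z - (χ ^ 2 * (b * P)) • Y‖ ^ 2 ≤
      8 * (χ ^ 2 * a ^ 2 * P ^ 2 * ‖Z‖ ^ 2) + 2 * (χ ^ 4 * b ^ 2 * P ^ 2 * ‖Y‖ ^ 2) := by
    have h := norm_add_sq_le one_pos ((2 * (χ * (a * P))) • Z) (-((χ ^ 2 * (b * P)) • Y))
    rw [← sub_eq_add_neg, norm_neg, norm_smul, norm_smul, mul_pow, mul_pow, Real.norm_eq_abs,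
      Real.norm_eq_abs, sq_abs, sq_abs] at h
    norm_num at h
    nlinarith
  have hUle : ‖U‖ ^ 2 ≤ (1 + κ) * ((χ ^ 2 * (a * p)) ^ 2 * ‖W‖ ^ 2) + (1 + κ⁻¹) *
      (8 * (χ ^ 2 * a ^ 2 * P ^ 2 * ‖Z‖ ^ 2) + 2 * (χ ^ 4 * b ^ 2 * P ^ 2 * ‖Y‖ ^ 2)) := by
    rw [hsplit]
    refine (norm_add_sq_le hκ _ _).trans ?_
    rw [norm_smul, mul_pow, Real.norm_eq_abs, sq_abs]
    exact add_le_add le_rfl (mul_le_mul_of_nonneg_left hR hκ1.le)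
  -- A quarter of the dissipation absorbs the main part of the perturbation.
  have hA : (χ ^ 2 * (a * p)) ^ 2 * ‖W‖ ^ 2 * s ≤ χ ^ 2 * (p * G * ‖W‖ ^ 2) := by
    calc (χ ^ 2 * (a * p)) ^ 2 * ‖W‖ ^ 2 * s
        = χ ^ 2 * a * p * (χ ^ 2 * (p * (s * a) * ‖W‖ ^ 2)) := by ring
      _ ≤ 1 * 1 * 1 * (χ ^ 2 * (p * G * ‖W‖ ^ 2)) := by gcongr
      _ = _ := by ring
  have hB : χ ^ 2 * a ^ 2 * P ^ 2 * ‖Z‖ ^ 2 * s ≤ M ^ 2 * C ^ 2 * c := by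
    have h1 : a ^ 2 * s ≤ C ^ 2 := by
      have haC : (a * (1 + s)) ^ 2 ≤ C ^ 2 := pow_le_pow_left₀ (by positivity) hC 2
      nlinarith [sq_nonneg a, mul_nonneg (sq_nonneg a) hs.le]
    have h2 : c ^ 2 ≤ c := by nlinarith
    calc χ ^ 2 * a ^ 2 * P ^ 2 * ‖Z‖ ^ 2 * s = χ ^ 2 * (P ^ 2) * (a ^ 2 * s) * ‖Z‖ ^ 2 := by ring
      _ ≤ 1 * M ^ 2 * C ^ 2 * c ^ 2 := by gcongr
      _ ≤ 1 * M ^ 2 * C ^ 2 * c := by gcongr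
      _ = _ := by ring
  have hD : χ ^ 4 * b ^ 2 * P ^ 2 * ‖Y‖ ^ 2 * s ≤ M ^ 2 * (χ ^ 2 * (b * ‖Y‖ ^ 2)) := by
    calc χ ^ 4 * b ^ 2 * P ^ 2 * ‖Y‖ ^ 2 * s
        = χ ^ 2 * (b * s) * P ^ 2 * (χ ^ 2 * (b * ‖Y‖ ^ 2)) := by ring
      _ ≤ 1 * 1 * M ^ 2 * (χ ^ 2 * (b * ‖Y‖ ^ 2)) := by gcongr
      _ = _ := by ring
  have h0 : ‖U‖ ^ 2 * s ≤ ((1 + κ) * ((χ ^ 2 * (a * p)) ^ 2 * ‖W‖ ^ 2) + (1 + κ⁻¹) *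
      (8 * (χ ^ 2 * a ^ 2 * P ^ 2 * ‖Z‖ ^ 2) + 2 * (χ ^ 4 * b ^ 2 * P ^ 2 * ‖Y‖ ^ 2))) * s :=
    mul_le_mul_of_nonneg_right hUle hs.le
  have h1 := mul_le_mul_of_nonneg_left hA (by positivity : 0 ≤ 1 + κ)
  have h2 := mul_le_mul_of_nonneg_left hB hκ1.le
  have h3 := mul_le_mul_of_nonneg_left hD hκ1.le
  have h4 : 4 * (1 + κ) * (1 / 4 * (χ ^ 2 * (p * G * ‖W‖ ^ 2)) +
      (2 * M ^ 2 * C ^ 2 / κ * c + M ^ 2 / (2 * κ) * (χ ^ 2 * (b * ‖Y‖ ^ 2)))) =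
      (1 + κ) * (χ ^ 2 * (p * G * ‖W‖ ^ 2)) + 8 * ((1 + κ⁻¹) * (M ^ 2 * C ^ 2 * c)) +
        2 * ((1 + κ⁻¹) * (M ^ 2 * (χ ^ 2 * (b * ‖Y‖ ^ 2)))) := by
    field_simp
    ring
  rw [inv_mul_le_iff₀ (by positivity), h4]
  linarith

/-- The pointwise estimate behind the entropy dissipation inequality. `Y`, `X`, `Z` stand for
`∇ g`, `∇ f`, `∇ χ`, `W` for the gradient of the logarithmic ratio `log (G / F)`, and the two
vectors `U`, `V` are the gradients of the test functions `χ² S'(g) P` and `χ² S'(f) K`. -/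
theorem entropy_pointwise {d : ℕ} {χ a b s a' b' s' F G P K p κ C M c : ℝ} {X Y Z W U V : E d}
    (hχ0 : 0 ≤ χ) (hχ1 : χ ≤ 1) (ha : 0 ≤ a) (ha1 : a ≤ 1) (hb : 0 ≤ b) (hs : 0 < s)
    (hbs : b * s ≤ 1) (hC : a * (1 + s) ≤ C) (hG : 0 < G) (hsG : s * a ≤ G)
    (ha' : 0 ≤ a') (hb' : 0 ≤ b') (hs' : 0 < s') (hC' : a' * (1 + s') ≤ C) (hF : 0 < F)
    (hP : |P| ≤ M) (hK : |K| ≤ M) (hp : 0 < p) (hp1 : p ≤ 1) (hκ : 0 < κ) (hc : 0 < c)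
    (hc1 : c ≤ 1) (hZ : ‖Z‖ ≤ c) (hW : W = (a / G) • Y - (a' / F) • X)
    (hU : U = (2 * (χ * (a * P))) • Z + χ ^ 2 • ((a * p) • W - (b * P) • Y))
    (hV : V = (2 * (χ * (a' * K))) • Z + χ ^ 2 • ((a' * (G / F * p)) • W - (b' * K) • X)) :
    3 / 4 * (χ ^ 2 * (p * G * ‖W‖ ^ 2)) ≤ ⟪U, Y⟫_ℝ - ⟪V, X⟫_ℝ -
      (4 * (1 + κ))⁻¹ * (‖U‖ ^ 2 * s) +
      (M + M ^ 2 / (2 * κ)) * (χ ^ 2 * (b * ‖Y‖ ^ 2)) +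
      (M + M ^ 2 / (2 * κ)) * (χ ^ 2 * (b' * ‖X‖ ^ 2)) +
      c * C ^ 2 * (χ ^ 2 * (‖Y‖ ^ 2 / (1 + s) ^ 2)) +
      c * C ^ 2 * (χ ^ 2 * (‖X‖ ^ 2 / (1 + s') ^ 2)) +
      c * (2 * M ^ 2 + 2 * M ^ 2 * C ^ 2 / κ) := by
  have hM : 0 ≤ M := (abs_nonneg P).trans hP
  have hC0 : 0 ≤ C := le_trans (by positivity) hC
  have hχ2 : χ ^ 2 ≤ 1 := pow_le_one₀ hχ0 hχ1
  have hZ2 : ‖Z‖ ^ 2 ≤ c ^ 2 := pow_le_pow_left₀ (norm_nonneg _) hZ 2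
  have hP2 : P ^ 2 ≤ M ^ 2 := by rw [← sq_abs]; exact pow_le_pow_left₀ (abs_nonneg _) hP 2
  have hK2 : K ^ 2 ≤ M ^ 2 := by rw [← sq_abs]; exact pow_le_pow_left₀ (abs_nonneg _) hK 2
  -- The quadratic terms combine to the dissipation.
  have hsum : ⟪U, Y⟫_ℝ - ⟪V, X⟫_ℝ = χ ^ 2 * (p * G * ‖W‖ ^ 2) +
      2 * (χ * (a * P)) * ⟪Z, Y⟫_ℝ - 2 * (χ * (a' * K)) * ⟪Z, X⟫_ℝ -
      χ ^ 2 * (b * P * ‖Y‖ ^ 2) + χ ^ 2 * (b' * K * ‖X‖ ^ 2) := by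
    have hWW : ‖W‖ ^ 2 = a / G * ⟪W, Y⟫_ℝ - a' / F * ⟪W, X⟫_ℝ := by
      rw [← real_inner_self_eq_norm_sq]
      conv_lhs => rw [hW, inner_sub_left, real_inner_smul_left, real_inner_smul_left, ← hW]
      rw [real_inner_comm, real_inner_comm W X]
    rw [hU, hV]
    simp only [inner_add_left, inner_sub_left, real_inner_smul_left, real_inner_self_eq_norm_sq]
    rw [hWW]
    field_simp
    ring
  have hcut : ∀ {a s Q : ℝ} {Y : E d}, 0 ≤ a → 0 < s → a * (1 + s) ≤ C → Q ^ 2 ≤ M ^ 2 →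
      |2 * (χ * (a * Q)) * ⟪Z, Y⟫_ℝ| ≤
        c * C ^ 2 * (χ ^ 2 * (‖Y‖ ^ 2 / (1 + s) ^ 2)) + c * M ^ 2 := by
    intro a s Q Y ha hs hC hQ
    have h1s : 0 < 1 + s := by linarith
    -- The bound on `Q` is put on the side of `∇ χ`, as the energy must not be multiplied by it.
    have h := abs_two_mul_inner_le hc (χ * a) Y (Q • Z)
    have h1 : 2 * (χ * a) * ⟪Q • Z, Y⟫_ℝ = 2 * (χ * (a * Q)) * ⟪Z, Y⟫_ℝ := by
      rw [real_inner_smul_left]; ring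
    rw [h1, norm_smul, mul_pow, mul_pow, Real.norm_eq_abs, sq_abs] at h
    refine h.trans (add_le_add ?_ ?_)
    · have h2 : χ ^ 2 * a ^ 2 * ‖Y‖ ^ 2 =
          (a * (1 + s)) ^ 2 * (χ ^ 2 * (‖Y‖ ^ 2 / (1 + s) ^ 2)) := by
        field_simp
      rw [h2, mul_assoc]
      gcongr
    · calc c⁻¹ * (Q ^ 2 * ‖Z‖ ^ 2) ≤ c⁻¹ * (M ^ 2 * c ^ 2) := by gcongr
        _ = c * M ^ 2 := by field_simp
  have hc1' := (abs_le.1 (hcut (Y := Y) ha hs hC hP2)).1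
  have hc2' := (abs_le.1 (hcut (Y := X) ha' hs' hC' hK2)).2
  have hd1 : χ ^ 2 * (b * P * ‖Y‖ ^ 2) ≤ M * (χ ^ 2 * (b * ‖Y‖ ^ 2)) := by
    calc χ ^ 2 * (b * P * ‖Y‖ ^ 2) = P * (χ ^ 2 * (b * ‖Y‖ ^ 2)) := by ring
      _ ≤ _ := mul_le_mul_of_nonneg_right ((le_abs_self P).trans hP) (by positivity)
  have hd2 : -(M * (χ ^ 2 * (b' * ‖X‖ ^ 2))) ≤ χ ^ 2 * (b' * K * ‖X‖ ^ 2) := by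
    calc -(M * (χ ^ 2 * (b' * ‖X‖ ^ 2))) = -M * (χ ^ 2 * (b' * ‖X‖ ^ 2)) := by ring
      _ ≤ K * (χ ^ 2 * (b' * ‖X‖ ^ 2)) :=
        mul_le_mul_of_nonneg_right (abs_le.1 hK).1 (by positivity)
      _ = _ := by ring
  have hd3 : 0 ≤ M ^ 2 / (2 * κ) * (χ ^ 2 * (b' * ‖X‖ ^ 2)) := by positivity
  have hq := quarter_norm_sq_le (Y := Y) (W := W) hχ0 hχ1 ha ha1 hb hs hbs hC hsG hP hp hp1 hκ hc
    hc1 hZ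
  rw [← hU] at hq
  rw [hsum]
  have e1 : c * (2 * M ^ 2 + 2 * M ^ 2 * C ^ 2 / κ) =
      c * M ^ 2 + c * M ^ 2 + 2 * M ^ 2 * C ^ 2 / κ * c := by ring
  rw [e1]
  linarith

section Entropy

variable {d : ℕ} {m : Measure (E d)} {f f' g g' : ℝ → E d → ℝ} {e : ℝ → ℝ}

theorem measurable_cutFisher (ε η : ℝ) (hf : Continuous (Function.uncurry f))
    (hg : Continuous (Function.uncurry g)) :
    Measurable fun p : ℝ × E d => cutFisher ε η f g p.1 p.2 := by
  have hS : Measurable (cutSize η) := by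
    have h1 : Measurable (truncExp η) := (contDiff_truncExp η).continuous.measurable
    exact h1.comp (Real.measurable_log.comp (measurable_const.add measurable_id))
  have hs : Measurable (cutSlope η) :=
    (continuous_gaussWeight η).measurable.comp
      (Real.measurable_log.comp (measurable_const.add measurable_id))
  have hfm : Measurable fun p : ℝ × E d => f p.1 p.2 := hf.measurable
  have hgm : Measurable fun p : ℝ × E d => g p.1 p.2 := hg.measurable
  have hY := measurable_gradient_uncurry hg
  have hX := measurable_gradient_uncurry hf
  have hw := (continuous_gaussWeight ε).measurable
  have hW : Measurable fun p : ℝ × E d => gradCutLogRatio η f g p.1 p.2 :=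
    (((hs.comp hgm).div (hS.comp hgm)).smul hY).sub (((hs.comp hfm).div (hS.comp hfm)).smul hX)
  exact ((hw.comp ((Real.measurable_log.comp (hS.comp hgm)).sub
    (Real.measurable_log.comp (hS.comp hfm)))).mul (hS.comp hgm)).mul (hW.norm.pow_const 2)

theorem continuous_cutFisher (ε : ℝ) {η t : ℝ} (hf : ContDiff ℝ 1 (f t)) (hg : ContDiff ℝ 1 (g t))
    (hf0 : ∀ x, 0 < f t x) (hg0 : ∀ x, 0 < g t x) : Continuous (cutFisher ε η f g t) := by
  have hSc := continuousOn_cutSize η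
  have hsc := (contDiffOn_cutSlope η).continuousOn
  have hF0 : ∀ x, cutSize η (f t x) ≠ 0 := fun x => (cutSize_pos η (hf0 x)).ne'
  have hG0 : ∀ x, cutSize η (g t x) ≠ 0 := fun x => (cutSize_pos η (hg0 x)).ne'
  have hF := hSc.comp_continuous hf.continuous hf0
  have hG := hSc.comp_continuous hg.continuous hg0
  have hW : Continuous (gradCutLogRatio η f g t) :=
    (((hsc.comp_continuous hg.continuous hg0).div hG hG0).smul (continuous_gradient hg)).sub
      (((hsc.comp_continuous hf.continuous hf0).div hF hF0).smul (continuous_gradient hf))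
  exact (((continuous_gaussWeight ε).comp ((hG.log hG0).sub (hF.log hF0))).mul hG).mul
    (hW.norm.pow 2)

theorem cutFisher_nonneg (ε η : ℝ) {t : ℝ} {x : E d} (hg : 0 < g t x) :
    0 ≤ cutFisher ε η f g t x :=
  mul_nonneg (mul_nonneg (gaussWeight_pos _ _).le (cutSize_pos η hg).le) (sq_nonneg _)

/-- Without perturbation, the weak formulation is an equation. -/
theorem IsPerturbedFlow.weak_eq (hf : IsPerturbedFlow m f f' fun _ => 0) {t : ℝ} (ht : 0 < t)
    {φ : E d → ℝ} (hφ : ContDiff ℝ 1 φ) (hs : HasCompactSupport φ) :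
    ∫ x, φ x * f' t x ∂m = -∫ x, ⟪gradient φ x, gradient (f t) x⟫_ℝ ∂m := by
  rw [← sub_eq_zero, sub_neg_eq_add, ← abs_nonpos_iff]
  have hlim : Tendsto (fun s : ℝ => s * 0 +
      (4 * s)⁻¹ * ∫ x, ‖gradient φ x‖ ^ 2 * f t x ∂m) atTop (𝓝 0) := by
    have h1 : Tendsto (fun s : ℝ => (4 * s)⁻¹) atTop (𝓝 0) :=
      tendsto_inv_atTop_zero.comp (tendsto_id.const_mul_atTop (by norm_num))
    simpa using h1.mul_const (∫ x, ‖gradient φ x‖ ^ 2 * f t x ∂m)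
  exact ge_of_tendsto hlim ((eventually_gt_atTop 0).mono fun s h => hf.weak t ht φ hφ hs s h)

variable [IsProbabilityMeasure m]

/-- The truncated entropy is differentiable in time, as a localized integral. -/
theorem hasDerivAt_integral_truncEntropy {e' : ℝ → ℝ} (hf : IsPerturbedFlow m f f' e')
    (hg : IsPerturbedFlow m g g' e) {χ : E d → ℝ} {c : ℝ} (hχ : IsCutoff c χ) (ε η : ℝ) :
    (Continuous fun t => ∫ x, χ x ^ 2 *
      truncEntropy ε (cutSize η (f t x)) (cutSize η (g t x)) ∂m) ∧
    ∀ t, 0 < t → HasDerivAt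
      (fun t => ∫ x, χ x ^ 2 * truncEntropy ε (cutSize η (f t x)) (cutSize η (g t x)) ∂m)
      (∫ x, χ x ^ 2 *
        (cutSlope η (g t x) * g' t x * truncId ε (cutLogRatio η (f t x) (g t x)) -
          cutSlope η (f t x) * f' t x * truncExp ε (cutLogRatio η (f t x) (g t x))) ∂m) t := by
  have hχc : Continuous fun x => χ x ^ 2 := hχ.contDiff.continuous.pow 2
  have hSc := continuousOn_cutSize η
  have hFc : Continuous fun p : ℝ × E d => cutSize η (f p.1 p.2) :=
    hSc.comp_continuous hf.continuous fun p => hf.pos p.1 p.2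
  have hGc : Continuous fun p : ℝ × E d => cutSize η (g p.1 p.2) :=
    hSc.comp_continuous hg.continuous fun p => hg.pos p.1 p.2
  have hF0 : ∀ t x, 0 < cutSize η (f t x) := fun t x => cutSize_pos η (hf.pos t x)
  have hG0 : ∀ t x, 0 < cutSize η (g t x) := fun t x => cutSize_pos η (hg.pos t x)
  have hc : Continuous (Function.uncurry fun t x =>
      truncEntropy ε (cutSize η (f t x)) (cutSize η (g t x))) :=
    (continuousOn_truncEntropy ε).comp_continuous (hFc.prodMk hGc)
      fun p => ⟨hF0 p.1 p.2, hG0 p.1 p.2⟩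
  have hyc : Continuous fun p : ℝ × E d => cutLogRatio η (f p.1 p.2) (g p.1 p.2) :=
    (hGc.log fun p => (hG0 p.1 p.2).ne').sub (hFc.log fun p => (hF0 p.1 p.2).ne')
  have hsc := (contDiffOn_cutSlope η).continuousOn
  have hafc : Continuous fun p : ℝ × E d => cutSlope η (f p.1 p.2) :=
    hsc.comp_continuous hf.continuous fun p => hf.pos p.1 p.2
  have hagc : Continuous fun p : ℝ × E d => cutSlope η (g p.1 p.2) :=
    hsc.comp_continuous hg.continuous fun p => hg.pos p.1 p.2
  refine ⟨continuous_integral_mul hχc hχ.hasCompactSupport_sq hc, fun t ht =>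
    hasDerivAt_integral_mul hχc hχ.hasCompactSupport_sq hc
      (Θ' := fun t x => cutSlope η (g t x) * g' t x * truncId ε (cutLogRatio η (f t x) (g t x)) -
        cutSlope η (f t x) * f' t x * truncExp ε (cutLogRatio η (f t x) (g t x)))
      (fun t ht x => ?_) ?_ ht⟩
  · exact hasDerivAt_truncEntropy ε
      ((hasDerivAt_cutSize η (by linarith [hf.pos t x])).comp t (hf.hasDerivAt t ht x))
      ((hasDerivAt_cutSize η (by linarith [hg.pos t x])).comp t (hg.hasDerivAt t ht x))
      (hF0 t x) (hG0 t x)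
  · exact ((hagc.continuousOn.mul hg.continuousOn_deriv).mul
      ((contDiff_truncId ε).continuous.comp hyc).continuousOn).sub
      ((hafc.continuousOn.mul hf.continuousOn_deriv).mul
      ((contDiff_truncExp ε).continuous.comp hyc).continuousOn)

/-- Entropy dissipation at a fixed time: the equation of `g` is tested with `χ² S'(g) P` and that
of `f` with `- χ² S'(f) K`, where `P`, `- K` are the partial derivatives of the truncated
entropy. -/
theorem integral_cutFisher_le (hf : IsPerturbedFlow m f f' fun _ => 0)
    (hg : IsPerturbedFlow m g g' e) {χ : E d → ℝ} {c : ℝ} (hχ : IsCutoff c χ) (hc : 0 < c)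
    (hc1 : c ≤ 1) {ε η κ C M : ℝ} (hη : 0 < η) (hη1 : 2 * η ≤ 1) (hκ : 0 < κ)
    (hC : ∀ s, 0 < s → cutSlope η s * (1 + s) ≤ C)
    (hM : ∀ y, |truncId ε y| ≤ M ∧ |truncExp ε y| ≤ M) {t : ℝ} (ht : 0 < t) :
    3 / 4 * (∫ x, χ x ^ 2 * cutFisher ε η f g t x ∂m) +
      (∫ x, χ x ^ 2 *
        (cutSlope η (g t x) * g' t x * truncId ε (cutLogRatio η (f t x) (g t x)) -
          cutSlope η (f t x) * f' t x * truncExp ε (cutLogRatio η (f t x) (g t x))) ∂m) ≤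
    (M + M ^ 2 / (2 * κ)) * (dissipation m χ (cutSlope η) g t + dissipation m χ (cutSlope η) f t) +
      c * C ^ 2 * (logEnergy m χ g t + logEnergy m χ f t) +
      c * (2 * M ^ 2 + 2 * M ^ 2 * C ^ 2 / κ) + (1 + κ) * e t := by
  have hgd : Differentiable ℝ (g t) := (hg.contDiff t).differentiable one_ne_zero
  have hfd : Differentiable ℝ (f t) := (hf.contDiff t).differentiable one_ne_zero
  have hF0 : ∀ x, 0 < cutSize η (f t x) := fun x => cutSize_pos η (hf.pos t x)
  have hG0 : ∀ x, 0 < cutSize η (g t x) := fun x => cutSize_pos η (hg.pos t x)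
  have hSd : ∀ s, 0 < s → HasDerivAt (cutSize η) (cutSlope η s) s := fun s hs =>
    hasDerivAt_cutSize η (by linarith)
  have hαd : ∀ s, 0 < s → HasDerivAt (cutSlope η) (deriv (cutSlope η) s) s := fun s hs =>
    (hasDerivAt_cutSlope η (by linarith)).differentiableAt.hasDerivAt
  have hα1 : ∀ s, 0 < s → |deriv (cutSlope η) s| = -deriv (cutSlope η) s := fun s hs =>
    abs_of_nonpos (deriv_cutSlope_nonpos η hs)
  have hS1 : ContDiffOn ℝ 1 (cutSize η) (Ioi 0) := by
    exact (contDiff_truncExp η).comp_contDiffOn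
      (ContDiffOn.log (by fun_prop) fun s hs => by have := mem_Ioi.1 hs; positivity)
  have hcomp : ∀ {h : ℝ → ℝ} {u : E d → ℝ}, ContDiffOn ℝ 1 h (Ioi 0) → ContDiff ℝ 1 u →
      (∀ x, 0 < u x) → ContDiff ℝ 1 fun x => h (u x) := fun hh hu h0 =>
    contDiffOn_univ.1 (hh.comp hu.contDiffOn fun x _ => h0 x)
  have hGs := hcomp hS1 (hg.contDiff t) (hg.pos t)
  have hFs := hcomp hS1 (hf.contDiff t) (hf.pos t)
  have hags := hcomp (contDiffOn_cutSlope η) (hg.contDiff t) (hg.pos t)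
  have hafs := hcomp (contDiffOn_cutSlope η) (hf.contDiff t) (hf.pos t)
  set y : E d → ℝ := fun x => cutLogRatio η (f t x) (g t x) with hy
  have hlogG : ContDiff ℝ 1 fun x => Real.log (cutSize η (g t x)) :=
    hGs.log fun x => (hG0 x).ne'
  have hlogF : ContDiff ℝ 1 fun x => Real.log (cutSize η (f t x)) :=
    hFs.log fun x => (hF0 x).ne'
  have hys : ContDiff ℝ 1 y := hlogG.sub hlogF
  have hgrady : ∀ x, gradient y x = gradCutLogRatio η f g t x := by
    intro x
    have h1 := gradient_comp ((hSd _ (hg.pos t x)).log (hG0 x).ne') (hgd x)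
    have h2 := gradient_comp ((hSd _ (hf.pos t x)).log (hF0 x).ne') (hfd x)
    have h3 := gradient_sub (hlogG.differentiable one_ne_zero x)
      (hlogF.differentiable one_ne_zero x)
    rw [h1, h2] at h3
    exact h3
  have hexp : ∀ x, Real.exp (y x) = cutSize η (g t x) / cutSize η (f t x) := fun x => by
    simp only [hy, cutLogRatio]
    rw [Real.exp_sub, Real.exp_log (hG0 x), Real.exp_log (hF0 x)]
  have hPs : ContDiff ℝ 1 fun x => truncId ε (y x) := (contDiff_truncId ε).comp hys
  have hKs : ContDiff ℝ 1 fun x => truncExp ε (y x) := (contDiff_truncExp ε).comp hys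
  set φ : E d → ℝ := fun x => χ x ^ 2 * (cutSlope η (g t x) * truncId ε (y x)) with hφ
  set ψ : E d → ℝ := fun x => χ x ^ 2 * (cutSlope η (f t x) * truncExp ε (y x)) with hψ
  have hφ1 : ContDiff ℝ 1 φ := (hχ.contDiff.pow 2).mul (hags.mul hPs)
  have hψ1 : ContDiff ℝ 1 ψ := (hχ.contDiff.pow 2).mul (hafs.mul hKs)
  have hφs : HasCompactSupport φ := hχ.hasCompactSupport_sq.mul_right
  have hψs : HasCompactSupport ψ := hχ.hasCompactSupport_sq.mul_right
  have hU : ∀ x, gradient φ x = (2 * (χ x * (cutSlope η (g t x) * truncId ε (y x)))) •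
      gradient χ x + χ x ^ 2 • ((cutSlope η (g t x) * gaussWeight ε (y x)) •
        gradCutLogRatio η f g t x -
        (|deriv (cutSlope η) (g t x)| * truncId ε (y x)) • gradient (g t) x) := by
    intro x
    rw [hφ, hχ.gradient_sq_mul ((hags.mul hPs).differentiable one_ne_zero x),
      gradient_mul (hags.differentiable one_ne_zero x) (hPs.differentiable one_ne_zero x),
      gradient_comp (hαd _ (hg.pos t x)) (hgd x),
      gradient_comp (hasDerivAt_truncId ε (y x)) (hys.differentiable one_ne_zero x), hgrady,
      hα1 _ (hg.pos t x), smul_smul, smul_smul, neg_mul, neg_smul, sub_neg_eq_add,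
      mul_comm (truncId ε (y x)) (deriv _ _)]
  have hV : ∀ x, gradient ψ x = (2 * (χ x * (cutSlope η (f t x) * truncExp ε (y x)))) •
      gradient χ x + χ x ^ 2 • ((cutSlope η (f t x) *
        (cutSize η (g t x) / cutSize η (f t x) * gaussWeight ε (y x))) •
        gradCutLogRatio η f g t x -
        (|deriv (cutSlope η) (f t x)| * truncExp ε (y x)) • gradient (f t) x) := by
    intro x
    rw [hψ, hχ.gradient_sq_mul ((hafs.mul hKs).differentiable one_ne_zero x),
      gradient_mul (hafs.differentiable one_ne_zero x) (hKs.differentiable one_ne_zero x),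
      gradient_comp (hαd _ (hf.pos t x)) (hfd x),
      gradient_comp (hasDerivAt_truncExp ε (y x)) (hys.differentiable one_ne_zero x), hgrady,
      hα1 _ (hf.pos t x), smul_smul, smul_smul, neg_mul, neg_smul, sub_neg_eq_add,
      mul_comm (truncExp ε (y x)) (deriv _ _), hexp]
  have hYc : Continuous (gradient (g t)) := continuous_gradient (hg.contDiff t)
  have hXc : Continuous (gradient (f t)) := continuous_gradient (hf.contDiff t)
  have hχ2c : Continuous fun x => χ x ^ 2 := hχ.contDiff.continuous.pow 2
  have hχ2s := hχ.hasCompactSupport_sq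
  have hderc := (contDiffOn_cutSlope η).continuousOn_deriv_of_isOpen isOpen_Ioi le_rfl
  have i0 : Integrable (fun x => χ x ^ 2 * cutFisher ε η f g t x) m :=
    integrable_of_continuous_mul hχ2c hχ2s
      (continuous_cutFisher ε (hf.contDiff t) (hg.contDiff t) (hf.pos t) (hg.pos t))
  have i1 : Integrable (fun x => ⟪gradient φ x, gradient (g t) x⟫_ℝ) m :=
    integrable_inner_gradient hφ1 hφs hYc
  have i2 : Integrable (fun x => ⟪gradient ψ x, gradient (f t) x⟫_ℝ) m :=
    integrable_inner_gradient hψ1 hψs hXc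
  have i3 : Integrable (fun x => ‖gradient φ x‖ ^ 2 * g t x) m :=
    integrable_norm_gradient_sq_mul hφ1 hφs hgd.continuous
  have i4 : Integrable (fun x =>
      χ x ^ 2 * (|deriv (cutSlope η) (g t x)| * ‖gradient (g t) x‖ ^ 2)) m :=
    integrable_of_continuous_mul hχ2c hχ2s
      ((hderc.comp_continuous hgd.continuous (hg.pos t)).abs.mul (hYc.norm.pow 2))
  have i5 : Integrable (fun x =>
      χ x ^ 2 * (|deriv (cutSlope η) (f t x)| * ‖gradient (f t) x‖ ^ 2)) m :=
    integrable_of_continuous_mul hχ2c hχ2s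
      ((hderc.comp_continuous hfd.continuous (hf.pos t)).abs.mul (hXc.norm.pow 2))
  have i6 : Integrable (fun x => χ x ^ 2 * (‖gradient (g t) x‖ ^ 2 / (1 + g t x) ^ 2)) m :=
    integrable_of_continuous_mul hχ2c hχ2s ((hYc.norm.pow 2).div
      ((continuous_const.add hgd.continuous).pow 2) fun x => by have := hg.pos t x; positivity)
  have i7 : Integrable (fun x => χ x ^ 2 * (‖gradient (f t) x‖ ^ 2 / (1 + f t x) ^ 2)) m :=
    integrable_of_continuous_mul hχ2c hχ2s ((hXc.norm.pow 2).div
      ((continuous_const.add hfd.continuous).pow 2) fun x => by have := hf.pos t x; positivity)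
  have hmain := integral_le_of_forall_le (m := m) (n := 7) (i0.const_mul (3 / 4))
    (u := ![fun x => ⟪gradient φ x, gradient (g t) x⟫_ℝ,
      fun x => ⟪gradient ψ x, gradient (f t) x⟫_ℝ, fun x => ‖gradient φ x‖ ^ 2 * g t x,
      fun x => χ x ^ 2 * (|deriv (cutSlope η) (g t x)| * ‖gradient (g t) x‖ ^ 2),
      fun x => χ x ^ 2 * (|deriv (cutSlope η) (f t x)| * ‖gradient (f t) x‖ ^ 2),
      fun x => χ x ^ 2 * (‖gradient (g t) x‖ ^ 2 / (1 + g t x) ^ 2),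
      fun x => χ x ^ 2 * (‖gradient (f t) x‖ ^ 2 / (1 + f t x) ^ 2)])
    (k := ![1, -1, -(4 * (1 + κ))⁻¹, M + M ^ 2 / (2 * κ), M + M ^ 2 / (2 * κ), c * C ^ 2,
      c * C ^ 2]) (a := c * (2 * M ^ 2 + 2 * M ^ 2 * C ^ 2 / κ))
    (by simp only [Fin.forall_fin_succ]; exact ⟨i1, i2, i3, i4, i5, i6, i7, fun i => i.elim0⟩)
    (fun x => by
      have hθ : ∀ s, 0 < s → |deriv (cutSlope η) s| * s ≤ 1 := fun s hs =>
        (abs_deriv_cutSlope_mul_le hη hs).trans hη1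
      have h := entropy_pointwise (Y := gradient (g t) x) (X := gradient (f t) x) (hχ.nonneg x)
        (hχ.le_one x) (cutSlope_pos η (g t x)).le (cutSlope_le_one η (g t x))
        (abs_nonneg (deriv (cutSlope η) (g t x))) (hg.pos t x) (hθ _ (hg.pos t x))
        (hC _ (hg.pos t x)) (hG0 x) (cutSize_mem η (hg.pos t x)).1 (cutSlope_pos η (f t x)).le
        (abs_nonneg (deriv (cutSlope η) (f t x))) (hf.pos t x) (hC _ (hf.pos t x)) (hF0 x)
        (hM (y x)).1 (hM (y x)).2 (gaussWeight_pos ε (y x)) (gaussWeight_le_one ε (y x)) hκ hc hc1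
        (hχ.norm_gradient_le x) rfl (hU x) (hV x)
      simp only [Fin.sum_univ_seven, Matrix.cons_val]
      have h0 : cutFisher ε η f g t x = gaussWeight ε (y x) * cutSize η (g t x) *
        ‖(cutSlope η (g t x) / cutSize η (g t x)) • gradient (g t) x -
          (cutSlope η (f t x) / cutSize η (f t x)) • gradient (f t) x‖ ^ 2 := rfl
      rw [h0]
      linarith)
  simp only [Fin.sum_univ_seven, Matrix.cons_val, integral_const_mul] at hmain
  -- The parameter `1 + κ` in Young's inequality leaves a quarter of the dissipation for the
  -- perturbation.
  have hwg := (abs_le.1 (hg.weak t ht φ hφ1 hφs (1 + κ) (by positivity))).2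
  have hwf := hf.weak_eq ht hψ1 hψs
  have hg'c : Continuous (g' t) := hg.continuousOn_deriv.comp_continuous
    (by fun_prop : Continuous fun x : E d => (t, x)) fun x => ⟨ht, mem_univ _⟩
  have hf'c : Continuous (f' t) := hf.continuousOn_deriv.comp_continuous
    (by fun_prop : Continuous fun x : E d => (t, x)) fun x => ⟨ht, mem_univ _⟩
  have hsplit : ∫ x, χ x ^ 2 * (cutSlope η (g t x) * g' t x * truncId ε (y x) -
      cutSlope η (f t x) * f' t x * truncExp ε (y x)) ∂m =
      (∫ x, φ x * g' t x ∂m) - ∫ x, ψ x * f' t x ∂m := by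
    rw [← integral_sub (integrable_of_continuous_mul hφ1.continuous hφs hg'c)
      (integrable_of_continuous_mul hψ1.continuous hψs hf'c)]
    refine integral_congr_ae (Eventually.of_forall fun x => ?_)
    simp only [hφ, hψ]
    ring
  rw [hsplit, hwf]
  simp only [dissipation, logEnergy]
  linarith

end Entropy

/-! ### Removal of the truncations -/

section Pointwise

variable {d : ℕ} {m : Measure (E d)} {f g : ℝ → E d → ℝ}

theorem tendsto_cutSize_comp {η : ℕ → ℝ} (hη : Tendsto η atTop (𝓝 0)) {s : ℝ} (hs : 0 < s) :
    Tendsto (fun n => cutSize (η n) s) atTop (𝓝 s) := (tendsto_cutSize hs).comp hη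

theorem tendsto_cutFisher (ε : ℝ) {η : ℕ → ℝ} (hη : Tendsto η atTop (𝓝 0)) {t : ℝ} {x : E d}
    (hf : 0 < f t x) (hg : 0 < g t x) :
    Tendsto (fun n => cutFisher ε (η n) f g t x) atTop
      (𝓝 (gaussWeight ε (Real.log (g t x) - Real.log (f t x)) * g t x *
        ‖(1 / g t x) • gradient (g t) x - (1 / f t x) • gradient (f t) x‖ ^ 2)) := by
  have hS := tendsto_cutSize_comp hη hg
  have hs : ∀ s : ℝ, Tendsto (fun n => cutSlope (η n) s) atTop (𝓝 1) := fun s =>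
    (tendsto_gaussWeight _).comp hη
  have t1 : Tendsto (fun n => cutLogRatio (η n) (f t x) (g t x)) atTop
      (𝓝 (Real.log (g t x) - Real.log (f t x))) :=
    (hS.log hg.ne').sub ((tendsto_cutSize_comp hη hf).log hf.ne')
  have t2 : Tendsto (fun n => gaussWeight ε (cutLogRatio (η n) (f t x) (g t x))) atTop
      (𝓝 (gaussWeight ε (Real.log (g t x) - Real.log (f t x)))) :=
    ((continuous_gaussWeight ε).tendsto _).comp t1
  have t3 : Tendsto (fun n => gradCutLogRatio (η n) f g t x) atTop
      (𝓝 ((1 / g t x) • gradient (g t) x - (1 / f t x) • gradient (f t) x)) :=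
    (((hs (g t x)).div hS hg.ne').smul_const (gradient (g t) x)).sub
      (((hs (f t x)).div (tendsto_cutSize_comp hη hf) hf.ne').smul_const (gradient (f t) x))
  have t4 := t3.norm.pow 2
  have t5 := (t2.mul hS).mul t4
  exact t5

theorem continuous_cutSize_comp (η : ℝ) {u : E d → ℝ} (hu : Continuous u) (h0 : ∀ x, 0 < u x) :
    Continuous fun x => cutSize η (u x) :=
  (continuousOn_cutSize η).comp_continuous hu h0

theorem tendsto_ofReal_one_sub_integral_cutSize {η : ℕ → ℝ} (hη : Tendsto η atTop (𝓝 0))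
    {u : E d → ℝ} (hu : Continuous u) (h0 : ∀ x, 0 < u x) (hi : Integrable u m)
    (h1 : ∫ x, u x ∂m = 1) :
    Tendsto (fun n => ENNReal.ofReal (1 - ∫ x, cutSize (η n) (u x) ∂m)) atTop (𝓝 0) := by
  have h2 : Tendsto (fun n => ∫ x, cutSize (η n) (u x) ∂m) atTop (𝓝 (∫ x, u x ∂m)) :=
    tendsto_integral_of_dominated_convergence u
      (fun n => (continuous_cutSize_comp (η n) hu h0).aestronglyMeasurable) hi
      (fun n => Eventually.of_forall fun x => by
        rw [Real.norm_of_nonneg (cutSize_pos _ (h0 x)).le]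
        exact (cutSize_mem _ (h0 x)).2)
      (Eventually.of_forall fun x => tendsto_cutSize_comp hη (h0 x))
  rw [h1] at h2
  have h3 := ENNReal.tendsto_ofReal (h2.const_sub 1)
  rwa [sub_self, ENNReal.ofReal_zero] at h3

theorem tendsto_integral_truncEntropy {ε M : ℝ} (hM0 : 0 ≤ M)
    (hM : ∀ y, |truncId ε y| ≤ M ∧ |truncExp ε y| ≤ M) {η : ℕ → ℝ} (hη : Tendsto η atTop (𝓝 0))
    {u v : E d → ℝ} (hu : Continuous u) (hv : Continuous v) (hu0 : ∀ x, 0 < u x)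
    (hv0 : ∀ x, 0 < v x) (hui : Integrable u m) (hvi : Integrable v m) :
    Tendsto (fun n => ∫ x, truncEntropy ε (cutSize (η n) (u x)) (cutSize (η n) (v x)) ∂m) atTop
      (𝓝 (∫ x, truncEntropy ε (u x) (v x) ∂m)) := by
  have hTEc := continuousOn_truncEntropy ε
  refine tendsto_integral_of_dominated_convergence (fun x => M * (u x + v x))
    (fun n => ?_) ((hui.add hvi).const_mul M)
    (fun n => Eventually.of_forall fun x => ?_) (Eventually.of_forall fun x => ?_)
  · exact (hTEc.comp_continuous ((continuous_cutSize_comp (η n) hu hu0).prodMk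
      (continuous_cutSize_comp (η n) hv hv0)) fun x =>
        ⟨cutSize_pos _ (hu0 x), cutSize_pos _ (hv0 x)⟩).aestronglyMeasurable
  · have hF0 := cutSize_pos (η n) (hu0 x)
    have hG0 := cutSize_pos (η n) (hv0 x)
    rw [Real.norm_of_nonneg (truncEntropy_nonneg ε hF0 hG0)]
    refine (truncEntropy_le hM hF0 hG0).trans (mul_le_mul_of_nonneg_left ?_ hM0)
    exact add_le_add (cutSize_mem _ (hu0 x)).2 (cutSize_mem _ (hv0 x)).2
  · have hat : ContinuousAt (fun p : ℝ × ℝ => truncEntropy ε p.1 p.2) (u x, v x) :=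
      hTEc.continuousAt (prod_mem_nhds (Ioi_mem_nhds (hu0 x)) (Ioi_mem_nhds (hv0 x)))
    have h2 : Tendsto (fun n => (cutSize (η n) (u x), cutSize (η n) (v x))) atTop
        (𝓝 (u x, v x)) :=
      (tendsto_cutSize_comp hη (hu0 x)).prodMk_nhds (tendsto_cutSize_comp hη (hv0 x))
    exact hat.tendsto.comp h2

theorem ofReal_integral_truncEntropy_le {ε M : ℝ}
    (hM : ∀ y, |truncId ε y| ≤ M ∧ |truncExp ε y| ≤ M)
    {u v : E d → ℝ} (hu : Continuous u) (hv : Continuous v) (hu0 : ∀ x, 0 < u x)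
    (hv0 : ∀ x, 0 < v x) (hui : Integrable u m) (hvi : Integrable v m) :
    ENNReal.ofReal (∫ x, truncEntropy ε (u x) (v x) ∂m) ≤
      ∫⁻ x, ENNReal.ofReal (u x * InformationTheory.klFun (v x / u x)) ∂m := by
  have hcont : Continuous fun x => truncEntropy ε (u x) (v x) :=
    (continuousOn_truncEntropy ε).comp_continuous (hu.prodMk hv) fun x => ⟨hu0 x, hv0 x⟩
  have h0 : ∀ x, 0 ≤ truncEntropy ε (u x) (v x) := fun x => truncEntropy_nonneg ε (hu0 x) (hv0 x)
  have hi : Integrable (fun x => truncEntropy ε (u x) (v x)) m :=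
    ((hui.add hvi).const_mul M).mono' hcont.aestronglyMeasurable
      (Eventually.of_forall fun x => by
        rw [Real.norm_of_nonneg (h0 x)]
        exact truncEntropy_le hM (hu0 x) (hv0 x))
  rw [ofReal_integral_eq_lintegral_ofReal hi (Eventually.of_forall h0)]
  exact lintegral_mono fun x =>
    ENNReal.ofReal_le_ofReal (truncEntropy_le_klFun ε (hu0 x) (hv0 x))

end Pointwise

section Limit

variable {d : ℕ} {m : Measure (E d)} [IsProbabilityMeasure m] {f f' g g' : ℝ → E d → ℝ} {e : ℝ → ℝ}

/-- The entropy dissipation inequality integrated over `(0, T)`. -/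
theorem lintegral_integral_cutFisher_le (hf : IsPerturbedFlow m f f' fun _ => 0)
    (hg : IsPerturbedFlow m g g' e) {T : ℝ} (hT : 0 < T) {χ : E d → ℝ} {c : ℝ}
    (hχ : IsCutoff c χ) (hc : 0 < c)
    (hc1 : c ≤ 1) {ε η κ C M : ℝ} (hη : 0 < η) (hη1 : 2 * η ≤ 1) (hκ : 0 < κ) (hM1 : 0 ≤ M)
    (hC : ∀ s, 0 < s → cutSlope η s * (1 + s) ≤ C)
    (hM : ∀ y, |truncId ε y| ≤ M ∧ |truncExp ε y| ≤ M) :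
    ∫⁻ t in Ioc 0 T, ENNReal.ofReal (3 / 4 * ∫ x, χ x ^ 2 * cutFisher ε η f g t x ∂m) ≤
      ENNReal.ofReal (∫ x, χ x ^ 2 *
        truncEntropy ε (cutSize η (f 0 x)) (cutSize η (g 0 x)) ∂m) +
      (ENNReal.ofReal (M + M ^ 2 / (2 * κ)) *
        ((∫⁻ t in Ioc 0 T, ENNReal.ofReal (dissipation m χ (cutSlope η) g t)) +
          ∫⁻ t in Ioc 0 T, ENNReal.ofReal (dissipation m χ (cutSlope η) f t)) +
      ENNReal.ofReal c * (ENNReal.ofReal (C ^ 2) *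
        ((∫⁻ t in Ioc 0 T, ENNReal.ofReal (logEnergy m χ g t)) +
          ∫⁻ t in Ioc 0 T, ENNReal.ofReal (logEnergy m χ f t)) +
        ENNReal.ofReal ((2 * M ^ 2 + 2 * M ^ 2 * C ^ 2 / κ) * T))) +
      ENNReal.ofReal (1 + κ) * ∫⁻ t in Ioc 0 T, ENNReal.ofReal (e t) := by
  obtain ⟨hEc, hE'⟩ := hasDerivAt_integral_truncEntropy hf hg hχ ε η
  have hχc := hχ.contDiff.continuous
  have hLg := measurable_logEnergy (m := m) hχc hg.continuous
  have hLf := measurable_logEnergy (m := m) hχc hf.continuous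
  have hDg := measurable_dissipation (m := m) hχc (cutSlope η) hg.continuous
  have hDf := measurable_dissipation (m := m) hχc (cutSlope η) hf.continuous
  have hLg0 := logEnergy_nonneg m χ g
  have hLf0 := logEnergy_nonneg m χ f
  have hDg0 := dissipation_nonneg m χ (cutSlope η) g
  have hDf0 := dissipation_nonneg m χ (cutSlope η) f
  have hN : 0 ≤ M + M ^ 2 / (2 * κ) := by positivity
  have hN3 : 0 ≤ 2 * M ^ 2 + 2 * M ^ 2 * C ^ 2 / κ := by positivity
  have hcF : Measurable fun t => ∫ x, χ x ^ 2 * cutFisher ε η f g t x ∂m :=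
    measurable_integral_cutoff hχc (measurable_cutFisher ε η hf.continuous hg.continuous)
  have key := lintegral_le_of_deriv_le
    (a := fun t => 3 / 4 * ∫ x, χ x ^ 2 * cutFisher ε η f g t x ∂m)
    (b := fun t => (M + M ^ 2 / (2 * κ)) *
        (dissipation m χ (cutSlope η) g t + dissipation m χ (cutSlope η) f t) +
      c * (C ^ 2 * (logEnergy m χ g t + logEnergy m χ f t) +
        (2 * M ^ 2 + 2 * M ^ 2 * C ^ 2 / κ)))
    (e := fun t => (1 + κ) * e t) hT hEc hE' (hcF.const_mul _)
    (((hDg.add hDf).const_mul _).add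
      ((((hLg.add hLf).const_mul _).add measurable_const).const_mul _))
    (fun t => mul_nonneg (by norm_num) (integral_nonneg fun x =>
      mul_nonneg (sq_nonneg _) (cutFisher_nonneg ε η (hg.pos t x))))
    (fun t => by have := hLg0 t; have := hLf0 t; have := hDg0 t; have := hDf0 t; positivity)
    (fun t ht => by
      have h := integral_cutFisher_le hf hg hχ hc hc1 hη hη1 hκ hC hM ht
      linarith)
  refine key.trans (add_le_add (add_le_add ?_ ?_) ?_)
  · refine ENNReal.ofReal_le_ofReal (sub_le_self _ ?_)
    exact integral_nonneg fun x => mul_nonneg (sq_nonneg _)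
      (truncEntropy_nonneg ε (cutSize_pos η (hf.pos T x)) (cutSize_pos η (hg.pos T x)))
  · have h3 : ∀ t, ENNReal.ofReal ((M + M ^ 2 / (2 * κ)) *
          (dissipation m χ (cutSlope η) g t + dissipation m χ (cutSlope η) f t) +
        c * (C ^ 2 * (logEnergy m χ g t + logEnergy m χ f t) +
          (2 * M ^ 2 + 2 * M ^ 2 * C ^ 2 / κ))) =
        ENNReal.ofReal (M + M ^ 2 / (2 * κ)) *
          (ENNReal.ofReal (dissipation m χ (cutSlope η) g t) +
            ENNReal.ofReal (dissipation m χ (cutSlope η) f t)) +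
        ENNReal.ofReal c * (ENNReal.ofReal (C ^ 2) * (ENNReal.ofReal (logEnergy m χ g t) +
          ENNReal.ofReal (logEnergy m χ f t)) +
          ENNReal.ofReal (2 * M ^ 2 + 2 * M ^ 2 * C ^ 2 / κ)) := fun t => by
      have := hLg0 t; have := hLf0 t; have := hDg0 t; have := hDf0 t
      rw [ENNReal.ofReal_add (by positivity) (by positivity), ENNReal.ofReal_mul hN,
        ENNReal.ofReal_add (hDg0 t) (hDf0 t), ENNReal.ofReal_mul hc.le,
        ENNReal.ofReal_add (by positivity) hN3, ENNReal.ofReal_mul (sq_nonneg _),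
        ENNReal.ofReal_add (hLg0 t) (hLf0 t)]
    have hm : Measurable fun t => ENNReal.ofReal (M + M ^ 2 / (2 * κ)) *
        (ENNReal.ofReal (dissipation m χ (cutSlope η) g t) +
          ENNReal.ofReal (dissipation m χ (cutSlope η) f t)) :=
      (hDg.ennreal_ofReal.add hDf.ennreal_ofReal).const_mul _
    simp_rw [h3]
    rw [lintegral_add_left hm,
      lintegral_const_mul' _ _ (by simp), lintegral_add_left hDg.ennreal_ofReal,
      lintegral_const_mul' _ _ (by simp), lintegral_add_right _ measurable_const,
      lintegral_const_mul' _ _ (by simp), lintegral_add_left hLg.ennreal_ofReal,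
      setLIntegral_const, Real.volume_Ioc, sub_zero,
      ENNReal.ofReal_mul hN3]
  · simp_rw [ENNReal.ofReal_mul (by positivity : 0 ≤ 1 + κ)]
    rw [lintegral_const_mul' _ _ (by finiteness)]

/-- The bound on the truncated Fisher information with all error terms made explicit: the mass cut
off at time `0`, the perturbation at order `η`, and a cutoff error of order `c`. -/
theorem exists_lintegral_cutFisher_le (hf : IsPerturbedFlow m f f' fun _ => 0)
    (hg : IsPerturbedFlow m g g' e) {T : ℝ} (hT : 0 < T) {ε κ M : ℝ} (hκ : 0 < κ) (hM1 : 0 ≤ M)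
    (hM : ∀ y, |truncId ε y| ≤ M ∧ |truncExp ε y| ≤ M)
    (hJ : ∫⁻ t in Ioc 0 T, ENNReal.ofReal (e t) ≠ ∞) {η : ℝ} (hη : 0 < η) (hη1 : 2 * η ≤ 1) :
    ∃ K : ℝ≥0∞, K ≠ ∞ ∧ ∀ (c : ℝ) (χ : E d → ℝ), 0 < c → c ≤ 1 → IsCutoff c χ →
      ∫⁻ p, ENNReal.ofReal (χ p.2 ^ 2 * cutFisher ε η f g p.1 p.2)
          ∂((volume.restrict (Ioc 0 T)).prod m) ≤
        4 / 3 * (ENNReal.ofReal (∫ x, χ x ^ 2 *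
            truncEntropy ε (cutSize η (f 0 x)) (cutSize η (g 0 x)) ∂m) +
          2 * ENNReal.ofReal (M + M ^ 2 / (2 * κ)) *
            (ENNReal.ofReal (1 - ∫ x, χ x ^ 2 * cutSize η (g 0 x) ∂m) +
              ENNReal.ofReal (1 - ∫ x, χ x ^ 2 * cutSize η (f 0 x) ∂m) +
              ENNReal.ofReal (2 * η) * ∫⁻ t in Ioc 0 T, ENNReal.ofReal (e t)) +
          ENNReal.ofReal c * K +
          ENNReal.ofReal (1 + κ) * ∫⁻ t in Ioc 0 T, ENNReal.ofReal (e t)) := by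
  set J := ∫⁻ t in Ioc 0 T, ENNReal.ofReal (e t) with hJdef
  set C := Real.exp (1 / (4 * η ^ 2)) with hCdef
  have hC : ∀ s, 0 < s → cutSlope η s * (1 + s) ≤ C := fun s hs => cutSlope_mul_le hη hs
  set N := ENNReal.ofReal (M + M ^ 2 / (2 * κ)) with hN
  set A : ℝ≥0∞ := 4 * (1 + ENNReal.ofReal (6 * T) + J) with hA
  set Q : ℝ≥0∞ := ENNReal.ofReal (C ^ 2) * A + ENNReal.ofReal ((1 + C ^ 2 / η) * T) with hQ
  have hA' : A ≠ ∞ := by finiteness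
  refine ⟨N * (4 * Q) + (ENNReal.ofReal (C ^ 2) * (A + A) +
    ENNReal.ofReal ((2 * M ^ 2 + 2 * M ^ 2 * C ^ 2 / κ) * T)), by finiteness,
    fun c χ hc hc1 hχ => ?_⟩
  have hLg : ∫⁻ t in Ioc 0 T, ENNReal.ofReal (logEnergy m χ g t) ≤ A :=
    hg.lintegral_logEnergy_le hT hχ hc hc1
  have hLf : ∫⁻ t in Ioc 0 T, ENNReal.ofReal (logEnergy m χ f t) ≤ A := by
    refine (hf.lintegral_logEnergy_le hT hχ hc hc1).trans ?_
    rw [hA]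
    gcongr
    simp
  have hDg := hg.lintegral_dissipation_cutSlope_le hT hχ hc hc1 hη hC
  have hDf := hf.lintegral_dissipation_cutSlope_le hT hχ hc hc1 hη hC
  simp only [ENNReal.ofReal_zero, lintegral_zero, mul_zero, add_zero] at hDf
  have hDg' : ∫⁻ t in Ioc 0 T, ENNReal.ofReal (dissipation m χ (cutSlope η) g t) ≤
      2 * (ENNReal.ofReal (1 - ∫ x, χ x ^ 2 * cutSize η (g 0 x) ∂m) + ENNReal.ofReal c * Q +
        ENNReal.ofReal (2 * η) * J) := hDg.trans (by rw [hQ]; gcongr)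
  have hDf' : ∫⁻ t in Ioc 0 T, ENNReal.ofReal (dissipation m χ (cutSlope η) f t) ≤
      2 * (ENNReal.ofReal (1 - ∫ x, χ x ^ 2 * cutSize η (f 0 x) ∂m) + ENNReal.ofReal c * Q) :=
    hDf.trans (by rw [hQ]; gcongr)
  have hmain := lintegral_integral_cutFisher_le hf hg hT hχ hc hc1 hη hη1 hκ hM1 hC hM
  have hcF : Measurable fun p : ℝ × E d =>
      ENNReal.ofReal (χ p.2 ^ 2 * cutFisher ε η f g p.1 p.2) :=
    (((hχ.contDiff.continuous.measurable.comp measurable_snd).pow_const 2).mul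
      (measurable_cutFisher ε η hf.continuous hg.continuous)).ennreal_ofReal
  rw [lintegral_prod _ hcF.aemeasurable]
  have hin : ∀ t, ∫⁻ x, ENNReal.ofReal (χ x ^ 2 * cutFisher ε η f g t x) ∂m =
      4 / 3 * ENNReal.ofReal (3 / 4 * ∫ x, χ x ^ 2 * cutFisher ε η f g t x ∂m) := fun t => by
    have hi : Integrable (fun x => χ x ^ 2 * cutFisher ε η f g t x) m :=
      integrable_of_continuous_mul (χ := fun x => χ x ^ 2) (hχ.contDiff.continuous.pow 2)
        hχ.hasCompactSupport_sq
        (continuous_cutFisher ε (hf.contDiff t) (hg.contDiff t) (hf.pos t) (hg.pos t))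
    rw [← ofReal_integral_eq_lintegral_ofReal hi
      (Eventually.of_forall fun x => mul_nonneg (sq_nonneg _)
        (cutFisher_nonneg ε η (hg.pos t x)))]
    have h43 : (4 / 3 : ℝ≥0∞) = ENNReal.ofReal (4 / 3) := by
      rw [ENNReal.ofReal_div_of_pos (by norm_num)]; norm_num
    rw [h43, ← ENNReal.ofReal_mul (by norm_num), ← mul_assoc]
    norm_num
  simp_rw [hin]
  rw [lintegral_const_mul' _ _ (by finiteness)]
  refine mul_le_mul_right (hmain.trans ?_) _
  refine add_le_add ?_ le_rfl
  rw [add_assoc]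
  refine add_le_add le_rfl ?_
  calc _ ≤ N * (2 * (ENNReal.ofReal (1 - ∫ x, χ x ^ 2 * cutSize η (g 0 x) ∂m) +
          ENNReal.ofReal c * Q + ENNReal.ofReal (2 * η) * J) +
        2 * (ENNReal.ofReal (1 - ∫ x, χ x ^ 2 * cutSize η (f 0 x) ∂m) + ENNReal.ofReal c * Q)) +
        ENNReal.ofReal c * (ENNReal.ofReal (C ^ 2) * (A + A) +
          ENNReal.ofReal ((2 * M ^ 2 + 2 * M ^ 2 * C ^ 2 / κ) * T)) := by gcongr
    _ = _ := by ring

/-- Fatou's lemma for a sequence of integrals with convergent bounds. -/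
theorem lintegral_le_of_tendsto {X : Type*} [MeasurableSpace X] {ν : Measure X}
    {u : ℕ → X → ℝ≥0∞} {v : X → ℝ≥0∞} {R : ℕ → ℝ≥0∞} {r : ℝ≥0∞} (hu : ∀ n, Measurable (u n))
    (huv : ∀ x, Tendsto (fun n => u n x) atTop (𝓝 (v x))) (hle : ∀ n, ∫⁻ x, u n x ∂ν ≤ R n)
    (hR : Tendsto R atTop (𝓝 r)) : ∫⁻ x, v x ∂ν ≤ r := by
  calc ∫⁻ x, v x ∂ν = ∫⁻ x, liminf (fun n => u n x) atTop ∂ν :=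
        lintegral_congr fun x => (huv x).liminf_eq.symm
    _ ≤ liminf (fun n => ∫⁻ x, u n x ∂ν) atTop := lintegral_liminf_le hu
    _ ≤ liminf R atTop := liminf_le_liminf (Eventually.of_forall hle)
    _ = r := hR.liminf_eq

/-- Removal of the cutoff in space. -/
theorem lintegral_cutFisher_le (hf : IsPerturbedFlow m f f' fun _ => 0)
    (hg : IsPerturbedFlow m g g' e) {T : ℝ} (hT : 0 < T) {ε κ M : ℝ} (hκ : 0 < κ) (hM1 : 0 ≤ M)
    (hM : ∀ y, |truncId ε y| ≤ M ∧ |truncExp ε y| ≤ M)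
    (hJ : ∫⁻ t in Ioc 0 T, ENNReal.ofReal (e t) ≠ ∞) {η : ℝ} (hη : 0 < η) (hη1 : 2 * η ≤ 1) :
    ∫⁻ p, ENNReal.ofReal (cutFisher ε η f g p.1 p.2) ∂((volume.restrict (Ioc 0 T)).prod m) ≤
      4 / 3 * (ENNReal.ofReal (∫ x,
            truncEntropy ε (cutSize η (f 0 x)) (cutSize η (g 0 x)) ∂m) +
          2 * ENNReal.ofReal (M + M ^ 2 / (2 * κ)) *
            (ENNReal.ofReal (1 - ∫ x, cutSize η (g 0 x) ∂m) +
              ENNReal.ofReal (1 - ∫ x, cutSize η (f 0 x) ∂m) +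
              ENNReal.ofReal (2 * η) * ∫⁻ t in Ioc 0 T, ENNReal.ofReal (e t)) +
          ENNReal.ofReal (1 + κ) * ∫⁻ t in Ioc 0 T, ENNReal.ofReal (e t)) := by
  obtain ⟨χ, c, hχ, hc, hχ1⟩ := exists_cutoff d
  obtain ⟨K, hK, hle⟩ := exists_lintegral_cutFisher_le hf hg hT hκ hM1 hM hJ hη hη1
  have hSc := continuousOn_cutSize η
  have hχt : ∀ x, Tendsto (fun n => χ n x ^ 2) atTop (𝓝 1) := fun x =>
    tendsto_const_nhds.congr' ((hχ1 x).mono fun n hn => by simp only [hn, one_pow])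
  have hχ2 : ∀ n x, χ n x ^ 2 ≤ 1 := fun n x =>
    pow_le_one₀ ((hχ n).2.2.nonneg x) ((hχ n).2.2.le_one x)
  have hmass : ∀ {u : E d → ℝ} {B : E d → ℝ}, Integrable B m → Continuous u → (∀ x, |u x| ≤ B x) →
      Tendsto (fun n => ∫ x, χ n x ^ 2 * u x ∂m) atTop (𝓝 (∫ x, u x ∂m)) := by
    intro u B hB hu huB
    refine tendsto_integral_of_dominated_convergence B
      (fun n => (((hχ n).2.2.contDiff.continuous.pow 2).mul hu).aestronglyMeasurable) hB
      (fun n => Eventually.of_forall fun x => ?_) (Eventually.of_forall fun x => ?_)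
    · rw [norm_mul, Real.norm_of_nonneg (sq_nonneg _)]
      exact (mul_le_of_le_one_left (norm_nonneg _) (hχ2 n x)).trans (huB x)
    · simpa using (hχt x).mul_const (u x)
  have hS : ∀ {s : ℝ}, 0 < s → |cutSize η s| ≤ s := fun hs => by
    rw [abs_of_pos (cutSize_pos η hs)]
    exact (cutSize_mem η hs).2
  have hGc : Continuous fun x => cutSize η (g 0 x) :=
    hSc.comp_continuous (hg.contDiff 0).continuous (hg.pos 0)
  have hFc : Continuous fun x => cutSize η (f 0 x) :=
    hSc.comp_continuous (hf.contDiff 0).continuous (hf.pos 0)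
  have l1 := hmass (hg.integrable 0) hGc fun x => hS (hg.pos 0 x)
  have l2 := hmass (hf.integrable 0) hFc fun x => hS (hf.pos 0 x)
  have l3 := hmass (u := fun x => truncEntropy ε (cutSize η (f 0 x)) (cutSize η (g 0 x)))
    (((hf.integrable 0).add (hg.integrable 0)).const_mul M)
    ((continuousOn_truncEntropy ε).comp_continuous (hFc.prodMk hGc)
      fun x => ⟨cutSize_pos η (hf.pos 0 x), cutSize_pos η (hg.pos 0 x)⟩)
    (fun x => by
      have hF0 := cutSize_pos η (hf.pos 0 x)
      have hG0 := cutSize_pos η (hg.pos 0 x)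
      rw [abs_of_nonneg (truncEntropy_nonneg ε hF0 hG0)]
      refine (truncEntropy_le hM hF0 hG0).trans (mul_le_mul_of_nonneg_left ?_ hM1)
      exact add_le_add (cutSize_mem η (hf.pos 0 x)).2 (cutSize_mem η (hg.pos 0 x)).2)
  refine lintegral_le_of_tendsto
    (u := fun n p => ENNReal.ofReal (χ n p.2 ^ 2 * cutFisher ε η f g p.1 p.2))
    (fun n => ?_) (fun p => ?_) (fun n => hle (c n) (χ n) (hχ n).1 (hχ n).2.1 (hχ n).2.2) ?_
  · exact ((((hχ n).2.2.contDiff.continuous.measurable.comp measurable_snd).pow_const 2).mul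
      (measurable_cutFisher ε η hf.continuous hg.continuous)).ennreal_ofReal
  · refine (ENNReal.continuous_ofReal.tendsto _).comp ?_
    simpa using (hχt p.2).mul_const (cutFisher ε η f g p.1 p.2)
  · have lc : Tendsto (fun n => ENNReal.ofReal (c n) * K) atTop (𝓝 0) := by
      simpa using ENNReal.Tendsto.mul_const (ENNReal.tendsto_ofReal hc) (Or.inr hK)
    refine ENNReal.Tendsto.const_mul ?_ (Or.inr (by finiteness))
    refine Tendsto.add ?_ tendsto_const_nhds
    have := ((ENNReal.tendsto_ofReal l3).add (ENNReal.Tendsto.const_mul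
      (((ENNReal.tendsto_ofReal (l1.const_sub 1)).add (ENNReal.tendsto_ofReal (l2.const_sub 1))).add
        (tendsto_const_nhds (x := ENNReal.ofReal (2 * η) *
          ∫⁻ t in Ioc 0 T, ENNReal.ofReal (e t))))
      (Or.inr (by finiteness : 2 * ENNReal.ofReal (M + M ^ 2 / (2 * κ)) ≠ ∞)))).add lc
    simpa using this

/-- Removal of the truncation of the densities. -/
theorem lintegral_gaussWeight_fisher_le (hf : IsPerturbedFlow m f f' fun _ => 0)
    (hg : IsPerturbedFlow m g g' e) {T : ℝ} (hT : 0 < T) {ε κ : ℝ} (hε : 0 < ε) (hκ : 0 < κ)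
    (hJ : ∫⁻ t in Ioc 0 T, ENNReal.ofReal (e t) ≠ ∞) :
    ∫⁻ p, ENNReal.ofReal (gaussWeight ε (Real.log (g p.1 p.2) - Real.log (f p.1 p.2)) * g p.1 p.2 *
        ‖(1 / g p.1 p.2) • gradient (g p.1) p.2 - (1 / f p.1 p.2) • gradient (f p.1) p.2‖ ^ 2)
        ∂((volume.restrict (Ioc 0 T)).prod m) ≤
      4 / 3 * ((∫⁻ x, ENNReal.ofReal (f 0 x * InformationTheory.klFun (g 0 x / f 0 x)) ∂m) +
          ENNReal.ofReal (1 + κ) * ∫⁻ t in Ioc 0 T, ENNReal.ofReal (e t)) := by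
  obtain ⟨M, hM1, hM⟩ := exists_bound_trunc hε
  have hM0 : 0 ≤ M := zero_le_one.trans hM1
  have hgc := (hg.contDiff 0).continuous
  have hfc := (hf.contDiff 0).continuous
  obtain ⟨η, hη0, hη1, hηt⟩ : ∃ η : ℕ → ℝ, (∀ n, 0 < η n) ∧ (∀ n, 2 * η n ≤ 1) ∧
      Tendsto η atTop (𝓝 0) := by
    refine ⟨fun n => 1 / ((n : ℝ) + 1) / 2, fun n => by positivity, fun n => ?_, ?_⟩
    · have h1 : 1 / ((n : ℝ) + 1) ≤ 1 := by
        rw [div_le_one (by positivity)]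
        linarith [(Nat.cast_nonneg n : (0 : ℝ) ≤ n)]
      linarith
    · have := (tendsto_one_div_add_atTop_nhds_zero_nat (𝕜 := ℝ)).div_const 2
      rwa [zero_div] at this
  have lg := tendsto_ofReal_one_sub_integral_cutSize hηt hgc (hg.pos 0) (hg.integrable 0)
    (hg.integral_eq_one 0)
  have lf := tendsto_ofReal_one_sub_integral_cutSize hηt hfc (hf.pos 0) (hf.integrable 0)
    (hf.integral_eq_one 0)
  have hent := ENNReal.tendsto_ofReal (tendsto_integral_truncEntropy hM0 hM hηt hfc hgc (hf.pos 0)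
    (hg.pos 0) (hf.integrable 0) (hg.integrable 0))
  have hentle := ofReal_integral_truncEntropy_le hM hfc hgc (hf.pos 0)
    (hg.pos 0) (hf.integrable 0) (hg.integrable 0)
  have hbound := fun n => lintegral_cutFisher_le hf hg hT hκ hM0 hM hJ (hη0 n) (hη1 n)
  set J := ∫⁻ t in Ioc 0 T, ENNReal.ofReal (e t) with hJdef
  have l0 : Tendsto (fun n => ENNReal.ofReal (2 * η n) * J) atTop (𝓝 0) := by
    have h := ENNReal.Tendsto.mul_const (ENNReal.tendsto_ofReal (hηt.const_mul 2)) (Or.inr hJ)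
    rwa [mul_zero, ENNReal.ofReal_zero, zero_mul] at h
  have l1 := ENNReal.Tendsto.const_mul ((lg.add lf).add l0)
    (Or.inr (by finiteness : 2 * ENNReal.ofReal (M + M ^ 2 / (2 * κ)) ≠ ∞))
  rw [add_zero, add_zero, mul_zero] at l1
  have l2 := hent.add l1
  rw [add_zero] at l2
  have l3 := ENNReal.Tendsto.const_mul
    (l2.add (tendsto_const_nhds (x := ENNReal.ofReal (1 + κ) * J)))
    (Or.inr (by finiteness : (4 / 3 : ℝ≥0∞) ≠ ∞))
  have hlim : ∀ p : ℝ × E d, Tendsto (fun n => ENNReal.ofReal (cutFisher ε (η n) f g p.1 p.2)) atTop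
      (𝓝 (ENNReal.ofReal (gaussWeight ε (Real.log (g p.1 p.2) - Real.log (f p.1 p.2)) *
        g p.1 p.2 * ‖(1 / g p.1 p.2) • gradient (g p.1) p.2 -
          (1 / f p.1 p.2) • gradient (f p.1) p.2‖ ^ 2))) := fun p =>
    ENNReal.tendsto_ofReal (tendsto_cutFisher ε hηt (hf.pos p.1 p.2) (hg.pos p.1 p.2))
  refine (lintegral_le_of_tendsto (fun n =>
    (measurable_cutFisher ε (η n) hf.continuous hg.continuous).ennreal_ofReal)
    hlim hbound l3).trans ?_
  exact mul_le_mul_right (add_le_add hentle le_rfl) _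

/-- The Fisher information of a perturbed flow relative to an unperturbed one, integrated over
`(0, T)`, is bounded by the initial relative entropy and the size of the perturbation. -/
theorem lintegral_fisher_le (hf : IsPerturbedFlow m f f' fun _ => 0)
    (hg : IsPerturbedFlow m g g' e) {T : ℝ} (hT : 0 < T) :
    ∫⁻ p, ENNReal.ofReal (g p.1 p.2 *
        ‖(1 / g p.1 p.2) • gradient (g p.1) p.2 - (1 / f p.1 p.2) • gradient (f p.1) p.2‖ ^ 2)
        ∂((volume.restrict (Ioc 0 T)).prod m) ≤
      4 / 3 * ((∫⁻ x, ENNReal.ofReal (f 0 x * InformationTheory.klFun (g 0 x / f 0 x)) ∂m) +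
          ∫⁻ t in Ioc 0 T, ENNReal.ofReal (e t)) := by
  by_cases hJ : ∫⁻ t in Ioc 0 T, ENNReal.ofReal (e t) = ∞
  · rw [hJ, add_top, ENNReal.mul_top (by simp)]
    exact le_top
  have hn : Tendsto (fun n : ℕ => 1 / ((n : ℝ) + 1)) atTop (𝓝 0) :=
    tendsto_one_div_add_atTop_nhds_zero_nat
  have hlog : Measurable fun p : ℝ × E d => Real.log (g p.1 p.2) - Real.log (f p.1 p.2) :=
    (Real.measurable_log.comp hg.continuous.measurable).sub
      (Real.measurable_log.comp hf.continuous.measurable)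
  have hgm : Measurable fun p : ℝ × E d => g p.1 p.2 := hg.continuous.measurable
  have hW := measurable_gradient_log_sub hf.continuous hg.continuous
  refine lintegral_le_of_tendsto (u := fun (n : ℕ) p => ENNReal.ofReal (
      gaussWeight (1 / ((n : ℝ) + 1)) (Real.log (g p.1 p.2) - Real.log (f p.1 p.2)) * g p.1 p.2 *
        ‖(1 / g p.1 p.2) • gradient (g p.1) p.2 - (1 / f p.1 p.2) • gradient (f p.1) p.2‖ ^ 2))
    (fun n => ?_) (fun p => ?_)
    (fun n => lintegral_gaussWeight_fisher_le hf hg hT (by positivity)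
      (κ := 1 / ((n : ℝ) + 1)) (by positivity) hJ) ?_
  · exact ((((continuous_gaussWeight _).measurable.comp hlog).mul hgm).mul
      (hW.norm.pow_const 2)).ennreal_ofReal
  · refine (ENNReal.continuous_ofReal.tendsto _).comp ?_
    have h1 := (tendsto_gaussWeight (Real.log (g p.1 p.2) - Real.log (f p.1 p.2))).comp hn
    simpa using (h1.mul_const (g p.1 p.2)).mul_const
      (‖(1 / g p.1 p.2) • gradient (g p.1) p.2 - (1 / f p.1 p.2) • gradient (f p.1) p.2‖ ^ 2)
  · refine ENNReal.Tendsto.const_mul ?_ (Or.inr (by finiteness))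
    refine tendsto_const_nhds.add ?_
    simpa using ENNReal.Tendsto.mul_const (ENNReal.tendsto_ofReal (hn.const_add 1)) (Or.inr hJ)

end Limit

/-! ### Densities relative to the target -/

section Reduction

variable {d : ℕ} {π : E d → ℝ}

theorem IsDensity.measurable_ofReal {ρ : E d → ℝ} (hρ : IsDensity ρ) :
    Measurable fun x => ENNReal.ofReal (ρ x) :=
  hρ.contDiff.continuous.measurable.ennreal_ofReal

theorem lintegral_densityMeasure {ρ : E d → ℝ} (hρ : IsDensity ρ) (h : E d → ℝ≥0∞) :
    ∫⁻ x, h x ∂densityMeasure ρ = ∫⁻ x, ENNReal.ofReal (ρ x) * h x :=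
  lintegral_withDensity_eq_lintegral_mul_non_measurable _ hρ.measurable_ofReal
    (Eventually.of_forall fun _ => ENNReal.ofReal_lt_top) h

theorem integral_densityMeasure {ρ : E d → ℝ} (hρ : IsDensity ρ) (h : E d → ℝ) :
    ∫ x, h x ∂densityMeasure ρ = ∫ x, ρ x * h x := by
  rw [densityMeasure, integral_withDensity_eq_integral_toReal_smul hρ.measurable_ofReal
    (Eventually.of_forall fun _ => ENNReal.ofReal_lt_top)]
  simp only [ENNReal.toReal_ofReal (hρ.pos _).le, smul_eq_mul]

theorem integrable_densityMeasure_iff {ρ : E d → ℝ} (hρ : IsDensity ρ) {h : E d → ℝ} :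
    Integrable h (densityMeasure ρ) ↔ Integrable fun x => ρ x * h x := by
  rw [densityMeasure, integrable_withDensity_iff_integrable_smul' hρ.measurable_ofReal
    (Eventually.of_forall fun _ => ENNReal.ofReal_lt_top)]
  simp only [ENNReal.toReal_ofReal (hρ.pos _).le, smul_eq_mul]

/-- The density of `ρ_t` relative to `π`, extended to `t < 0` by its value at time `0`. -/
def relDensity (π : E d → ℝ) (ρ : ℝ → E d → ℝ) (t : ℝ) (x : E d) : ℝ := ρ (max t 0) x / π x

theorem relDensity_of_nonneg (ρ : ℝ → E d → ℝ) {t : ℝ} (ht : 0 ≤ t) :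
    relDensity π ρ t = fun x => ρ t x / π x := by
  ext x
  rw [relDensity, max_eq_left ht]

theorem contDiff_div_density (hπ : IsDensity π) {ρ : E d → ℝ} (hρ : IsDensity ρ) :
    ContDiff ℝ 1 fun x => ρ x / π x :=
  (hρ.contDiff.of_le one_le_two).div (hπ.contDiff.of_le one_le_two) fun x => (hπ.pos x).ne'

theorem gradient_log_div_density (hπ : IsDensity π) {ρ : E d → ℝ} (hρ : IsDensity ρ) (x : E d) :
    gradLogRatio ρ π x = (1 / (ρ x / π x)) • gradient (fun y => ρ y / π y) x := by
  rw [one_div]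
  exact gradient_comp (h := Real.log) (u := fun y => ρ y / π y)
    (Real.hasDerivAt_log (div_pos (hρ.pos x) (hπ.pos x)).ne')
    ((contDiff_div_density hπ hρ).differentiable one_ne_zero x)

theorem gradLogRatio_eq_sub (hπ : IsDensity π) {ρ σ : E d → ℝ} (hρ : IsDensity ρ)
    (hσ : IsDensity σ) (x : E d) :
    gradLogRatio ρ σ x = gradLogRatio ρ π x - gradLogRatio σ π x := by
  have hlog : ∀ {u : E d → ℝ}, IsDensity u →
      DifferentiableAt ℝ (fun y => Real.log (u y / π y)) x := fun hu =>
    ((contDiff_div_density hπ hu).differentiable one_ne_zero x).log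
      (div_pos (hu.pos x) (hπ.pos x)).ne'
  have h : (fun y => Real.log (ρ y / σ y)) =
      fun y => Real.log (ρ y / π y) - Real.log (σ y / π y) := by
    ext y
    have h1 := (hρ.pos y).ne'
    have h2 := (hσ.pos y).ne'
    have h3 := (hπ.pos y).ne'
    rw [Real.log_div h1 h2, Real.log_div h1 h3, Real.log_div h2 h3]
    ring
  rw [gradLogRatio, h, gradient_sub (hlog hρ) (hlog hσ)]
  rfl

theorem integral_inner_gradLogRatio (hπ : IsDensity π) {ρ : E d → ℝ} (hρ : IsDensity ρ)
    (φ : E d → ℝ) :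
    ∫ x, ⟪gradient φ x, gradLogRatio ρ π x⟫_ℝ ∂densityMeasure ρ =
      ∫ x, ⟪gradient φ x, gradient (fun y => ρ y / π y) x⟫_ℝ ∂densityMeasure π := by
  rw [integral_densityMeasure hρ, integral_densityMeasure hπ]
  refine integral_congr_ae (Eventually.of_forall fun x => ?_)
  have h1 := (hρ.pos x).ne'
  have h2 := (hπ.pos x).ne'
  simp only [gradient_log_div_density hπ hρ x, inner_smul_right]
  field_simp

/-- Relative to `π`, a solution of `∂_t ρ = ∇ · (ρ v)` is a perturbed flow as soon as `v` is close
to the velocity `∇ log (ρ / π)` of the Wasserstein gradient flow. -/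
theorem SolvesContinuityEq.isPerturbedFlow (hπ : IsDensity π) {ρ : ℝ → E d → ℝ}
    {v : ℝ → E d → E d} (hρ : SolvesContinuityEq ρ v) {e : ℝ → ℝ}
    (hv : ∀ t, 0 < t → ∀ φ : E d → ℝ, ContDiff ℝ 1 φ → HasCompactSupport φ → ∀ s, 0 < s →
      |-(∫ x, ⟪gradient φ x, v t x⟫_ℝ ∂densityMeasure (ρ t)) +
          ∫ x, ⟪gradient φ x, gradLogRatio (ρ t) π x⟫_ℝ ∂densityMeasure (ρ t)| ≤
        s * e t + (4 * s)⁻¹ * ∫ x, ‖gradient φ x‖ ^ 2 ∂densityMeasure (ρ t)) :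
    IsPerturbedFlow (densityMeasure π) (relDensity π ρ)
      (fun t x => deriv (fun s => ρ s x) t / π x) e where
  continuous := by
    have h : Continuous fun p : ℝ × E d => ρ (max p.1 0) p.2 :=
      hρ.continuousOn.comp_continuous (f := fun p : ℝ × E d => (max p.1 0, p.2))
        (by fun_prop) fun p => ⟨le_max_right p.1 0, mem_univ _⟩
    exact h.div (hπ.contDiff.continuous.comp continuous_snd) fun p => (hπ.pos p.2).ne'
  contDiff t := contDiff_div_density hπ (hρ.isDensity _ (le_max_right _ _))
  pos t x := div_pos ((hρ.isDensity _ (le_max_right _ _)).pos x) (hπ.pos x)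
  hasDerivAt t ht x := by
    refine ((hρ.differentiableAt t ht x).hasDerivAt.div_const (π x)).congr_of_eventuallyEq ?_
    filter_upwards [Ioi_mem_nhds ht] with s hs
    rw [relDensity, max_eq_left (le_of_lt hs)]
  continuousOn_deriv :=
    hρ.continuousOn_deriv.div (hπ.contDiff.continuous.comp continuous_snd).continuousOn
      fun p _ => (hπ.pos p.2).ne'
  integrable t := by
    rw [integrable_densityMeasure_iff hπ]
    refine (hρ.isDensity _ (le_max_right t 0)).integrable.congr (Eventually.of_forall fun x => ?_)
    exact (mul_div_cancel₀ _ (hπ.pos x).ne').symm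
  integral_eq_one t := by
    rw [integral_densityMeasure hπ, ← (hρ.isDensity _ (le_max_right t 0)).integral_eq_one]
    exact integral_congr_ae (Eventually.of_forall fun x => mul_div_cancel₀ _ (hπ.pos x).ne')
  weak t ht φ hφ hs s hs0 := by
    have hd := hρ.isDensity t ht.le
    have h1 : ∫ x, φ x * (deriv (fun s => ρ s x) t / π x) ∂densityMeasure π =
        -∫ x, ⟪gradient φ x, v t x⟫_ℝ ∂densityMeasure (ρ t) := by
      rw [integral_densityMeasure hπ, ← hρ.equation t ht φ hφ hs]
      refine integral_congr_ae (Eventually.of_forall fun x => ?_)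
      have h2 := (hπ.pos x).ne'
      simp only
      field_simp
    have h3 : ∫ x, ‖gradient φ x‖ ^ 2 * relDensity π ρ t x ∂densityMeasure π =
        ∫ x, ‖gradient φ x‖ ^ 2 ∂densityMeasure (ρ t) := by
      rw [integral_densityMeasure hπ, integral_densityMeasure hd]
      refine integral_congr_ae (Eventually.of_forall fun x => ?_)
      have h2 := (hπ.pos x).ne'
      simp only [relDensity_of_nonneg ρ ht.le]
      field_simp
    rw [h1, h3, relDensity_of_nonneg ρ ht.le, ← integral_inner_gradLogRatio hπ hd φ]
    exact hv t ht φ hφ hs s hs0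

theorem IsWGF.isPerturbedFlow (hπ : IsDensity π) {μ : ℝ → E d → ℝ} (hμ : IsWGF π μ) :
    IsPerturbedFlow (densityMeasure π) (relDensity π μ)
      (fun t x => deriv (fun s => μ s x) t / π x) fun _ => 0 := by
  refine SolvesContinuityEq.isPerturbedFlow hπ hμ fun t ht φ hφ hs s hs0 => ?_
  rw [neg_add_cancel, abs_zero, mul_zero, zero_add]
  have : 0 ≤ ∫ x, ‖gradient φ x‖ ^ 2 ∂densityMeasure (μ t) :=
    integral_nonneg fun x => sq_nonneg _
  positivity

variable {H : Type*} [NormedAddCommGroup H] [InnerProductSpace ℝ H] [CompleteSpace H]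
  [RKHS ℝ H (E d) ℝ]

/-- The regularized flow is a perturbation of the Wasserstein gradient flow whose size is the
squared distance in `L₂^d(ρ_t)` between the two velocities. -/
theorem IsRSVGF.isPerturbedFlow (hπ : IsDensity π) {ν : ℝ} {ρ : ℝ → E d → ℝ}
    (hρ : IsRSVGF H ν π ρ) :
    IsPerturbedFlow (densityMeasure π) (relDensity π ρ)
      (fun t x => deriv (fun s => ρ s x) t / π x)
      fun t => ‖velocity H ν (ρ t) (score (ρ t) π) - score (ρ t) π‖ ^ 2 := by
  refine SolvesContinuityEq.isPerturbedFlow hπ hρ.solves fun t ht φ hφ hs s hs0 => ?_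
  have hd := hρ.solves.isDensity t ht.le
  have := isProbabilityMeasure_densityMeasure hd
  have hscore : score (ρ t) π =ᵐ[densityMeasure (ρ t)] gradLogRatio (ρ t) π := by
    rw [score, dif_pos (hρ.score_memLp t ht)]
    exact MemLp.coeFn_toLp _
  have hmem : MemLp (gradient φ) 2 (densityMeasure (ρ t)) :=
    (continuous_gradient hφ).memLp_of_hasCompactSupport (hasCompactSupport_gradient hs)
  set u := score (ρ t) π with hu
  set w := velocity H ν (ρ t) u with hw
  set p : L2 (ρ t) := hmem.toLp with hp
  have hpc : p =ᵐ[densityMeasure (ρ t)] gradient φ := hmem.coeFn_toLp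
  have hinner : ∀ (q : L2 (ρ t)) (r : E d → E d), q =ᵐ[densityMeasure (ρ t)] r →
      ∫ x, ⟪gradient φ x, r x⟫_ℝ ∂densityMeasure (ρ t) = ⟪p, q⟫_ℝ := fun q r hq => by
    rw [L2.inner_def]
    refine integral_congr_ae ?_
    filter_upwards [hpc, hq] with x h1 h2
    rw [h1, h2]
  have hnorm : ∫ x, ‖gradient φ x‖ ^ 2 ∂densityMeasure (ρ t) = ‖p‖ ^ 2 := by
    rw [← real_inner_self_eq_norm_sq, ← hinner p _ hpc]
    simp only [real_inner_self_eq_norm_sq]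
  rw [hinner w w (ae_eq_refl _), hinner u _ hscore, hnorm]
  have h1 : -⟪p, w⟫_ℝ + ⟪p, u⟫_ℝ = -⟪p, w - u⟫_ℝ := by
    rw [inner_sub_right]
    ring
  rw [h1, abs_neg]
  refine (abs_real_inner_le_norm p (w - u)).trans ?_
  have h2 : s * ‖w - u‖ ^ 2 + (4 * s)⁻¹ * ‖p‖ ^ 2 - ‖p‖ * ‖w - u‖ =
      (4 * s)⁻¹ * (2 * s * ‖w - u‖ - ‖p‖) ^ 2 := by
    field_simp
    ring
  have h3 : 0 ≤ (4 * s)⁻¹ * (2 * s * ‖w - u‖ - ‖p‖) ^ 2 := by positivity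
  linarith

theorem fisherInfo_eq_lintegral (hπ : IsDensity π) {ρ σ : E d → ℝ} (hρ : IsDensity ρ)
    (hσ : IsDensity σ) :
    fisherInfo ρ σ = ∫⁻ x, ENNReal.ofReal (ρ x / π x *
      ‖(1 / (ρ x / π x)) • gradient (fun y => ρ y / π y) x -
        (1 / (σ x / π x)) • gradient (fun y => σ y / π y) x‖ ^ 2) ∂densityMeasure π := by
  rw [fisherInfo, lintegral_densityMeasure hρ, lintegral_densityMeasure hπ]
  refine lintegral_congr fun x => ?_
  rw [gradLogRatio_eq_sub hπ hρ hσ, gradient_log_div_density hπ hρ,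
    gradient_log_div_density hπ hσ, ← ofReal_norm, ← ENNReal.ofReal_pow (norm_nonneg _),
    ← ENNReal.ofReal_mul (hρ.pos x).le, ← ENNReal.ofReal_mul (hπ.pos x).le, ← mul_assoc,
    mul_div_cancel₀ _ (hπ.pos x).ne']

theorem klDensity_eq_lintegral (hπ : IsDensity π) {ρ σ : E d → ℝ} (hρ : IsDensity ρ)
    (hσ : IsDensity σ) :
    klDensity ρ σ = ∫⁻ x, ENNReal.ofReal
      (σ x / π x * InformationTheory.klFun ((ρ x / π x) / (σ x / π x))) ∂densityMeasure π := by
  have := isProbabilityMeasure_densityMeasure hρ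
  have := isProbabilityMeasure_densityMeasure hσ
  have hq : Measurable fun x => ENNReal.ofReal (ρ x / σ x) :=
    (hρ.contDiff.continuous.measurable.div hσ.contDiff.continuous.measurable).ennreal_ofReal
  have h : densityMeasure ρ =
      (densityMeasure σ).withDensity fun x => ENNReal.ofReal (ρ x / σ x) := by
    rw [densityMeasure, densityMeasure, ← withDensity_mul _ hσ.measurable_ofReal hq]
    congr 1
    ext x
    rw [Pi.mul_apply, ← ENNReal.ofReal_mul (hσ.pos x).le, mul_div_cancel₀ _ (hσ.pos x).ne']
  have hac : densityMeasure ρ ≪ densityMeasure σ := h ▸ withDensity_absolutelyContinuous _ _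
  have hrn : (densityMeasure ρ).rnDeriv (densityMeasure σ) =ᵐ[densityMeasure σ]
      fun x => ENNReal.ofReal (ρ x / σ x) := by
    have := Measure.rnDeriv_withDensity (densityMeasure σ) hq
    rwa [← h] at this
  rw [klDensity, InformationTheory.klDiv_eq_lintegral_klFun, if_pos hac]
  have h2 : ∫⁻ x, ENNReal.ofReal (InformationTheory.klFun
        ((densityMeasure ρ).rnDeriv (densityMeasure σ) x).toReal) ∂densityMeasure σ =
      ∫⁻ x, ENNReal.ofReal (InformationTheory.klFun (ρ x / σ x)) ∂densityMeasure σ := by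
    refine lintegral_congr_ae ?_
    filter_upwards [hrn] with x hx
    rw [hx, ENNReal.toReal_ofReal (div_pos (hρ.pos x) (hσ.pos x)).le]
  rw [h2, lintegral_densityMeasure hσ, lintegral_densityMeasure hπ]
  refine lintegral_congr fun x => ?_
  rw [← ENNReal.ofReal_mul (hσ.pos x).le, ← ENNReal.ofReal_mul (hπ.pos x).le, ← mul_assoc,
    mul_div_cancel₀ _ (hπ.pos x).ne', div_div_div_cancel_right₀ (hπ.pos x).ne']

/-- The bound on the averaged Fisher information by the initial relative entropy and the
regularization error. -/
theorem lintegral_fisherInfo_le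
    (hk : Continuous fun p : E d × E d => reproKernel H p.1 p.2) (hπ : IsDensity π)
    {μ ρ : ℝ → E d → ℝ} (hμ : IsWGF π μ) {ν : ℝ} (hν : 0 < ν) (hν1 : ν ≤ 1)
    (hρ : IsRSVGF H ν π ρ) {γ : ℝ → ℝ} (hγ : AdmissibleExponents H π ρ γ) {T : ℝ} (hT : 0 < T) :
    ∫⁻ t in Ioc 0 T, fisherInfo (ρ t) (μ t) ≤
      4 / 3 * klDensity (ρ 0) (μ 0) + 4 / 3 * errorIntegral H ν π ρ γ T := by
  have hf := hμ.isPerturbedFlow hπ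
  have hg := hρ.isPerturbedFlow hπ
  have := isProbabilityMeasure_densityMeasure hπ
  set f := relDensity π μ with hfd
  set g := relDensity π ρ with hgd
  have hgm : Measurable fun p : ℝ × E d => g p.1 p.2 := hg.continuous.measurable
  have hW := measurable_gradient_log_sub hf.continuous hg.continuous
  have hWm : Measurable fun p : ℝ × E d => ENNReal.ofReal (g p.1 p.2 *
      ‖(1 / g p.1 p.2) • gradient (g p.1) p.2 - (1 / f p.1 p.2) • gradient (f p.1) p.2‖ ^ 2) :=
    (hgm.mul (hW.norm.pow_const 2)).ennreal_ofReal
  have hmain := lintegral_fisher_le hf hg hT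
  rw [lintegral_prod _ hWm.aemeasurable] at hmain
  have hF : ∫⁻ t in Ioc 0 T, fisherInfo (ρ t) (μ t) = ∫⁻ t in Ioc 0 T, ∫⁻ x,
      ENNReal.ofReal (g t x * ‖(1 / g t x) • gradient (g t) x -
        (1 / f t x) • gradient (f t) x‖ ^ 2) ∂densityMeasure π := by
    refine setLIntegral_congr_fun measurableSet_Ioc fun t ht => ?_
    simp only [hgd, hfd, relDensity_of_nonneg _ ht.1.le]
    exact fisherInfo_eq_lintegral hπ (hρ.solves.isDensity t ht.1.le) (hμ.isDensity t ht.1.le)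
  have hK : ∫⁻ x, ENNReal.ofReal (f 0 x * InformationTheory.klFun (g 0 x / f 0 x))
      ∂densityMeasure π = klDensity (ρ 0) (μ 0) := by
    simp only [hgd, hfd, relDensity_of_nonneg _ le_rfl]
    exact (klDensity_eq_lintegral hπ (hρ.solves.isDensity 0 le_rfl) (hμ.isDensity 0 le_rfl)).symm
  have hE : ∫⁻ t in Ioc 0 T, ENNReal.ofReal
      (‖velocity H ν (ρ t) (score (ρ t) π) - score (ρ t) π‖ ^ 2) ≤ errorIntegral H ν π ρ γ T := by
    refine setLIntegral_mono' measurableSet_Ioc fun t ht => ?_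
    obtain ⟨h0, h1, -⟩ := hγ t ht.1
    exact ofReal_norm_velocity_sub_sq_le hk (hρ.solves.isDensity t ht.1.le)
      (hρ.kernel_integrable t ht.1) hν hν1 h0 (h1.trans (by norm_num))
  rw [hF, ← mul_add, ← hK]
  exact hmain.trans (mul_le_mul_right (add_le_add le_rfl hE) _)

end Reduction

end RSVGF

end

theorem mainTheorem6 {d : ℕ} (k : RSVGF.E d → RSVGF.E d → ℝ)
    (hk : Continuous fun p : RSVGF.E d × RSVGF.E d => k p.1 p.2)
    (H : Type*) [NormedAddCommGroup H] [InnerProductSpace ℝ H] [CompleteSpace H]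
    [RKHS ℝ H (RSVGF.E d) ℝ] (hH : ∀ x y, RSVGF.reproKernel H x y = k x y)
    (π : RSVGF.E d → ℝ) (hπ : RSVGF.IsDensity π)
    (μ : ℝ → RSVGF.E d → ℝ) (hμ : RSVGF.IsWGF π μ) :
    (∀ ν : ℝ, 0 < ν → ν ≤ 1 → ∀ ρ : ℝ → RSVGF.E d → ℝ, RSVGF.IsRSVGF H ν π ρ →
      ∀ γ : ℝ → ℝ, RSVGF.AdmissibleExponents H π ρ γ → ∀ T : ℝ, 0 < T →
        ∫⁻ t in Set.Ioc 0 T, RSVGF.fisherInfo (ρ t) (μ t) ≤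
          4 / 3 * RSVGF.klDensity (ρ 0) (μ 0) + 4 / 3 * RSVGF.errorIntegral H ν π ρ γ T) ∧
    (∀ (α : Type) (l : Filter α) (ν T : α → ℝ) (ρ : α → ℝ → RSVGF.E d → ℝ) (γ : α → ℝ → ℝ),
      (∀ a, 0 < ν a ∧ ν a ≤ 1 ∧ 0 < T a ∧ RSVGF.IsRSVGF H (ν a) π (ρ a) ∧ ρ a 0 = μ 0 ∧
        RSVGF.AdmissibleExponents H π (ρ a) (γ a)) →
      Tendsto (fun a => (ENNReal.ofReal (T a))⁻¹ *
        RSVGF.errorIntegral H (ν a) π (ρ a) (γ a) (T a)) l (𝓝 0) →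
      Tendsto (fun a => (ENNReal.ofReal (T a))⁻¹ *
        ∫⁻ t in Set.Ioc 0 (T a), RSVGF.fisherInfo (ρ a t) (μ t)) l (𝓝 0)) := by
  have hk' : Continuous fun p : RSVGF.E d × RSVGF.E d => RSVGF.reproKernel H p.1 p.2 := by
    simpa only [hH] using hk
  refine ⟨fun ν hν hν1 ρ hρ γ hγ T hT =>
    RSVGF.lintegral_fisherInfo_le hk' hπ hμ hν hν1 hρ hγ hT, fun α l ν T ρ γ h hlim => ?_⟩
  have h43 : Tendsto (fun a => 4 / 3 * ((ENNReal.ofReal (T a))⁻¹ *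
      RSVGF.errorIntegral H (ν a) π (ρ a) (γ a) (T a))) l (𝓝 0) := by
    have := ENNReal.Tendsto.const_mul hlim (Or.inr (by finiteness : (4 / 3 : ℝ≥0∞) ≠ ∞))
    rwa [mul_zero] at this
  refine tendsto_of_tendsto_of_tendsto_of_le_of_le tendsto_const_nhds h43
    (fun a => bot_le) fun a => ?_
  obtain ⟨hν, hν1, hT, hρ, h0, hγ⟩ := h a
  have hle := RSVGF.lintegral_fisherInfo_le hk' hπ hμ hν hν1 hρ hγ hT
  have := RSVGF.isProbabilityMeasure_densityMeasure (hμ.isDensity 0 le_rfl)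
  rw [h0, RSVGF.klDensity, InformationTheory.klDiv_self, mul_zero, zero_add] at hle
  exact (mul_le_mul_right hle _).trans_eq (mul_left_comm _ _ _)
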